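/- Let $n\ge 2$, let $\mathbb T^n=\mathbb R^n/2\pi\mathbb Z^n$ be the flat torus with geodesic distance $d$ and Lebesgue measure $dz$, and fix $x_0\in\mathbb T^n$. Let $0<\eta<1$, let $\rho\in C_0^\infty((-\pi,\pi))$ be real-valued with $\rho(0)\neq 0$, and set $$V(x)=\rho(d(x,x_0))\,d(x,x_0)^{-2+\eta},\qquad V_{jk}=\int_{\mathbb T^n}V(z)\,e^{-i(j-k)\cdot z}\,dz\quad(j,k\in\mathbb Z^n).$$ Let $0<\varepsilon<\frac1{10}\min(\eta,1-\eta)$, let $\varphi\in C_0^\infty(\mathbb R)$ be real-valued and even with $\mathbf 1_{[-1/2,1/2]}\le\varphi\le \mathbf 1_{[-1,1]}$, and for $\lambda\ge1$ put $$h(\tau)=h_\lambda(\tau)=\frac1\pi\int_{\mathbb R}\varphi(t\lambda^{1-\eta-\varepsilon})\,\frac{\sin\lambda t}{t}\,\cos(t\tau)\,dt .$$ Define $$R_1(\lambda,x)=\sum_{j,k\in\mathbb Z^n}\frac{h(|j|)-h(|k|)}{|j|^2-|k|^2}\;e^{ij\cdot x}\,V_{jk}\,e^{-ik\cdot x},$$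 where the quotient is understood as its continuous extension when $|j|=|k|$, i.e. as $h'(|j|)/(2|j|)$ if $|j|=|k|\ne0$ and as $h''(0)/2$ if $j=k=0$. Then for all $\lambda\ge 1$ and $x\in\mathbb T^n$ the double series converges absolutely, and there are constants $c,C>0$ and $\Lambda\ge1$, independent of $\lambda$, such that $$\sup_{x\in\mathbb T^n}|R_1(\lambda,x)|\le C\lambda^{n-\eta}\quad\text{for all }\lambda\ge1,$$ $$|R_1(\lambda,x_0)|\ge c\,\lambda^{n-\eta}\quad\text{for all }\lambda\ge\Lambda .$$ Consequently $c\,\lambda^{n-\eta}\le\sup_{x\in\mathbb T^n}|R_1(\lambda,x)|\le C\lambda^{n-\eta}$ for all $\lambda\ge\Lambda$. -/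

import Mathlib

open Real MeasureTheory
open scoped ContDiff ComplexConjugate

noncomputable section

namespace TorusWeyl

/-- The flat torus `𝕋ⁿ = ℝⁿ / 2πℤⁿ`, as a product of `n` circles of length `2π`. Its `volume` is the
product measure (total mass `(2π)ⁿ`), that is, Lebesgue measure on a fundamental cell. -/
abbrev Torus (n : ℕ) : Type := Fin n → AddCircle (2 * π)

instance twoPiPos : Fact (0 < 2 * π) := ⟨two_pi_pos⟩

/-- Geodesic distance of the flat torus: on each circle `dist` is the arc length
`min_{m ∈ ℤ} |s - t + 2πm|`, and the product metric is Euclidean. -/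
def geodDist {n : ℕ} (x y : Torus n) : ℝ := √(∑ i, dist (x i) (y i) ^ 2)

/-- Euclidean length `|j|` of a lattice point `j ∈ ℤⁿ`. -/
def latticeNorm {n : ℕ} (j : Fin n → ℤ) : ℝ := √(∑ i, (j i : ℝ) ^ 2)

/-- The exponential `e_j(x) = e^{i j·x}` on the torus; `fourier m t = e^{i m t}` on the circle
of length `2π`. -/
def eigenfun {n : ℕ} (j : Fin n → ℤ) (x : Torus n) : ℂ := ∏ i, fourier (j i) (x i)

/-- The potential `V(x) = ρ(d(x, x₀)) d(x, x₀)^{-2+η}`. -/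
def potential {n : ℕ} (ρ : ℝ → ℝ) (η : ℝ) (x₀ x : Torus n) : ℝ :=
  ρ (geodDist x x₀) * geodDist x x₀ ^ (-2 + η)

/-- The matrix coefficients
`V_{jk} = ∫_{𝕋ⁿ} conj (e_j z) e_k(z) V(z) dz = ∫_{𝕋ⁿ} V(z) e^{-i(j-k)·z} dz`. -/
def coeff {n : ℕ} (V : Torus n → ℝ) (j k : Fin n → ℤ) : ℂ :=
  ∫ z : Torus n, conj (eigenfun j z) * eigenfun k z * (V z : ℂ)

/-- The smoothed spectral cutoff
`h(τ) = π⁻¹ ∫ φ(t λ^{1-η-ε}) (sin(λt)/t) cos(tτ) dt`. -/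
def cutoff (φ : ℝ → ℝ) (η ε lam τ : ℝ) : ℝ :=
  (1 / π) * ∫ t : ℝ, φ (t * lam ^ (1 - η - ε)) * (sin (lam * t) / t) * cos (t * τ)

/-- The quotient `(h(a) - h(b)) / (a² - b²)` for `a, b ≥ 0` and a smooth even function `h`,
extended continuously to the diagonal: its value is `h'(a) / (2a)` at `a = b > 0`,
and `h''(0) / 2` at `a = b = 0`. -/
def sqDiffQuot (h : ℝ → ℝ) (a b : ℝ) : ℝ :=
  if a = b then
    if a = 0 then iteratedDeriv 2 h 0 / 2 else deriv h a / (2 * a)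
  else (h a - h b) / (a ^ 2 - b ^ 2)

/-- The `(j, k)` term of the first-order Duhamel expansion. -/
def duhamelTerm {n : ℕ} (h : ℝ → ℝ) (V : Torus n → ℝ) (x : Torus n)
    (p : (Fin n → ℤ) × (Fin n → ℤ)) : ℂ :=
  (sqDiffQuot h (latticeNorm p.1) (latticeNorm p.2) : ℂ) *
    eigenfun p.1 x * coeff V p.1 p.2 * conj (eigenfun p.2 x)

/-- The first-order Duhamel term `R₁(λ, x)`. -/
def R₁ {n : ℕ} (φ ρ : ℝ → ℝ) (η ε : ℝ) (x₀ : Torus n) (lam : ℝ) (x : Torus n) : ℂ :=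
  ∑' p : (Fin n → ℤ) × (Fin n → ℤ), duhamelTerm (cutoff φ η ε lam) (potential ρ η x₀) x p

end TorusWeyl

end

/-! ### Elementary sums of powers -/

namespace TorusWeyl

/-! Replace `h` by the sharp step at `λ`. For lengths `a < b` the quotient then becomes `-1/(b² -
a²)` if `a ≤ λ < b` and `0` otherwise, so it has one sign. Up to the phase `e^{-i(j-k)·x₀}`, the
coefficient `V_{jk}` is the Euclidean Fourier transform of `ρ(|x|)|x|^{-p}`, `p = 2 - η`, at
`(j-k)/2π`. To leading order this is `ρ(0)` times a positive constant times `|j-k|^{-(n-2+η)}`. At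
`x = x₀` the phases cancel and the leading terms cannot cancel one another. Pairs with `|j| ≤ λ/2`
and `|k|` between `2λ` and a multiple of `λ` alone contribute about `λ^{2n} · λ^{-2} · λ^{-(n-2+η)}
= λ^{n-η}` (`exists_core`).

For the upper bound, lattice points are grouped by the integer part of their length. The unit shell
at `β` is essentially `(n-1)`-dimensional, so the sum of `(1+|j-k|)^{-(n-2+η)}` over its points `k`
is `O((1+β)^{1-η})`, uniformly in `j` (`sum_shell_rpow_neg_le`). A pair of shells `α ≤ β` then
carries at most `(1+α)^{n-1} (1+β-α)^{-1-η}` times the size of the quotient in units of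
`1/((1+β-α)(1+β))` (`tsum_shellWeight_le`). Summed over the pairs that straddle `λ`, this gives
`λ^{n-η}`.

Two errors remain. Smoothing at width `w = λ^{1-η-ε}` matters only within about `w` of the sphere of
radius `λ` and costs `w λ^{n-1} = λ^{n-η-ε}` (`abs_sqDiffQuot_sub_sharpQuot_le`,
`shellPairSum_decay_le`). Pairs with `|j-k|` bounded, where the sign of the coefficient is not
controlled, cost `O(λ^{n-1})`. Both are of lower order than `λ^{n-η}`.

The coefficient asymptotics (`tendsto_fourier_radialPow`) come from scaling: the transform at `ξ` is
`|ξ|^{p-n}` times the transform of `ρ(δ|x|)|x|^{-p}` at a unit vector, with `δ = 1/|ξ|`. Repeated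
differences make the latter converge absolutely, uniformly in `δ`, so it has a limit as `δ → 0`;
pairing with a Gaussian evaluates that limit. Throughout the lattice sums `n = d + 1`. -/

/-- Bernoulli's inequality for the concave power `1 - σ`, applied to `1 - 1/(1+d)`. It makes the sum
of `(1+d)^{-σ}` telescope. -/
theorem rpow_neg_le_sub {σ : ℝ} (h0 : 0 ≤ σ) (h1 : σ < 1) (d : ℕ) :
    (1 - σ) * (1 + d : ℝ) ^ (-σ) ≤ ((d + 1 : ℕ) : ℝ) ^ (1 - σ) - (d : ℝ) ^ (1 - σ) := by
  have hd : (0 : ℝ) < 1 + d := by positivity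
  have hb := rpow_one_add_le_one_add_mul_self (s := -(1 / (1 + d : ℝ)))
    (by rw [neg_le_neg_iff, div_le_one hd]; linarith [(Nat.cast_nonneg d : (0 : ℝ) ≤ d)])
    (p := 1 - σ) (by linarith) (by linarith)
  have he : 1 + -(1 / (1 + d : ℝ)) = d / (1 + d) := by field_simp; ring
  rw [he, Real.div_rpow (by positivity) hd.le, div_le_iff₀ (by positivity)] at hb
  have hs : (1 + d : ℝ) ^ (-σ) = (1 + d : ℝ) ^ (1 - σ) / (1 + d) := by
    rw [← Real.rpow_sub_one hd.ne']; ring_nf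
  push_cast
  rw [hs, add_comm (d : ℝ) 1]
  have : (1 - σ) * ((1 + d : ℝ) ^ (1 - σ) / (1 + d))
      = (1 + d : ℝ) ^ (1 - σ) - (1 + (1 - σ) * -(1 / (1 + d : ℝ))) * (1 + d : ℝ) ^ (1 - σ) := by
    field_simp; ring
  linarith

theorem sum_range_rpow_neg_le {σ : ℝ} (h0 : 0 ≤ σ) (h1 : σ < 1) (M : ℕ) :
    ∑ d ∈ Finset.range M, (1 + d : ℝ) ^ (-σ) ≤ (1 - σ)⁻¹ * (M : ℝ) ^ (1 - σ) := by
  have hp : 0 < 1 - σ := by linarith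
  rw [inv_mul_eq_div, le_div_iff₀ hp, mul_comm, Finset.mul_sum]
  calc _ ≤ ∑ d ∈ Finset.range M, (((d + 1 : ℕ) : ℝ) ^ (1 - σ) - (d : ℝ) ^ (1 - σ)) :=
        Finset.sum_le_sum fun d _ => rpow_neg_le_sub h0 h1 d
    _ = _ := by
        rw [Finset.sum_range_sub (fun d : ℕ => (d : ℝ) ^ (1 - σ))]
        simp [Real.zero_rpow hp.ne']

/-- Bernoulli bounds `((y-1)/y)^η` by `1 - η/y`; the inequality `(1 + η/y)(1 - η/y) ≤ 1` turns this
into a lower bound for the reciprocal power. -/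
theorem rpow_neg_one_sub_le_sub {η : ℝ} (h0 : 0 < η) (h1 : η < 1) {y : ℝ} (hy : 1 < y) :
    η * y ^ (-1 - η) ≤ (y - 1) ^ (-η) - y ^ (-η) := by
  have hy0 : 0 < y := by linarith
  have hb := rpow_one_add_le_one_add_mul_self (s := -(1 / y))
    (by rw [neg_le_neg_iff, div_le_one hy0]; exact hy.le) (p := η) h0.le h1.le
  have he : 1 + -(1 / y) = (y - 1) / y := by field_simp; ring
  have hpos : 0 < (y - 1) ^ η := Real.rpow_pos_of_pos (by linarith) _
  have hpos' : 0 < y ^ η := Real.rpow_pos_of_pos (by linarith) _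
  rw [he, Real.div_rpow (by linarith) hy0.le, div_le_iff₀ hpos'] at hb
  rw [Real.rpow_sub hy0, Real.rpow_neg (by linarith) η, Real.rpow_neg hy0.le η, Real.rpow_neg_one]
  have h2 : (1 + η / y) * (y - 1) ^ η ≤ y ^ η := by
    calc _ ≤ (1 + η / y) * ((1 + η * -(1 / y)) * y ^ η) := by gcongr
      _ = (1 - (η / y) ^ 2) * y ^ η := by ring
      _ ≤ 1 * y ^ η := by gcongr; nlinarith [sq_nonneg (η / y)]
      _ = _ := one_mul _
  have h3 : (1 + η / y) * (y ^ η)⁻¹ ≤ ((y - 1) ^ η)⁻¹ := by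
    rw [← div_eq_mul_inv, div_le_iff₀ hpos', inv_mul_eq_div, le_div_iff₀ hpos]; exact h2
  have : η * (y⁻¹ / y ^ η) = (1 + η / y) * (y ^ η)⁻¹ - (y ^ η)⁻¹ := by ring
  linarith

theorem tsum_rpow_neg_le {η : ℝ} (h0 : 0 < η) (h1 : η < 1) (D : ℕ) :
    ∑' d : ℕ, ENNReal.ofReal ((1 + D + d : ℝ) ^ (-1 - η)) ≤
      ENNReal.ofReal ((1 + η⁻¹) * (1 + D : ℝ) ^ (-η)) := by
  refine ENNReal.tsum_le_of_sum_range_le fun M => ?_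
  rw [← ENNReal.ofReal_sum_of_nonneg (fun _ _ => by positivity)]
  refine ENNReal.ofReal_le_ofReal ?_
  have key : ∀ M : ℕ, ∑ d ∈ Finset.range M, (1 + D + (d + 1 : ℕ) : ℝ) ^ (-1 - η) ≤
      η⁻¹ * (1 + D : ℝ) ^ (-η) := by
    intro M
    rw [inv_mul_eq_div, le_div_iff₀ h0, mul_comm, Finset.mul_sum]
    calc _ ≤ ∑ d ∈ Finset.range M,
          ((1 + D + d : ℝ) ^ (-η) - (1 + D + (d + 1 : ℕ) : ℝ) ^ (-η)) := by
          refine Finset.sum_le_sum fun d _ => ?_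
          have := rpow_neg_one_sub_le_sub h0 h1 (y := 1 + D + (d + 1 : ℕ)) (by
            push_cast; linarith [(Nat.cast_nonneg d : (0 : ℝ) ≤ d),
              (Nat.cast_nonneg D : (0 : ℝ) ≤ D)])
          have he : (1 + D + d : ℝ) = 1 + D + (d + 1 : ℕ) - 1 := by push_cast; ring
          rwa [he]
      _ ≤ _ := by
          rw [Finset.sum_range_sub' (fun d : ℕ => (1 + D + d : ℝ) ^ (-η))]
          simp only [Nat.cast_zero, add_zero]
          have : 0 ≤ (1 + D + M : ℝ) ^ (-η) := by positivity
          linarith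
  have hD : (1 + D : ℝ) ^ (-1 - η) ≤ (1 + D : ℝ) ^ (-η) :=
    Real.rpow_le_rpow_of_exponent_le (by linarith [(Nat.cast_nonneg D : (0 : ℝ) ≤ D)])
      (by linarith)
  cases M with
  | zero => simp; positivity
  | succ M =>
    rw [Finset.sum_range_succ']
    have := key M
    simp only [Nat.cast_zero, add_zero]
    linarith

/-- Within distance `B` of `j` each distance is attained at most twice, which leaves a one-sided
power sum. Beyond it each term is at most `(1+B)^{-σ}`, and there are at most `2B + 1` of them. The
bound does not depend on where `j` lies. -/
theorem sum_Icc_rpow_neg_le {σ : ℝ} (h0 : 0 ≤ σ) (h1 : σ < 1) (B : ℕ) (j : ℤ) :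
    ∑ k ∈ Finset.Icc (-(B : ℤ)) B, (1 + |((j - k : ℤ) : ℝ)|) ^ (-σ) ≤
      (3 + 2 * (1 - σ)⁻¹) * (1 + B : ℝ) ^ (1 - σ) := by
  classical
  have hB : (0 : ℝ) < 1 + B := by positivity
  set S := Finset.Icc (-(B : ℤ)) B with hS
  rw [← Finset.sum_filter_add_sum_filter_not S (fun k => (j - k).natAbs ≤ B)]
  have hA : ∑ k ∈ S with (j - k).natAbs ≤ B, (1 + |((j - k : ℤ) : ℝ)|) ^ (-σ) ≤
      2 * ((1 - σ)⁻¹ * ((B + 1 : ℕ) : ℝ) ^ (1 - σ)) := by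
    have hfib : ∀ k ∈ S.filter (fun k => (j - k).natAbs ≤ B),
        (j - k).natAbs ∈ Finset.range (B + 1) := by
      intro k hk
      rw [Finset.mem_filter] at hk
      exact Finset.mem_range.2 (by omega)
    rw [← Finset.sum_fiberwise_of_maps_to hfib]
    calc _ ≤ ∑ d ∈ Finset.range (B + 1), 2 * (1 + d : ℝ) ^ (-σ) := by
          refine Finset.sum_le_sum fun d _ => ?_
          calc _ ≤ ∑ k ∈ (S.filter (fun k => (j - k).natAbs ≤ B)).filter
                (fun k => (j - k).natAbs = d), (1 + d : ℝ) ^ (-σ) := by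
                refine Finset.sum_le_sum fun k hk => ?_
                rw [Finset.mem_filter] at hk
                rw [← hk.2, Nat.cast_natAbs, Int.cast_abs]
            _ ≤ _ := by
                rw [Finset.sum_const, nsmul_eq_mul]
                gcongr
                have : ((S.filter (fun k => (j - k).natAbs ≤ B)).filter
                    (fun k => (j - k).natAbs = d)) ⊆ {j - d, j + d} := by
                  intro k hk
                  rw [Finset.mem_filter] at hk
                  simp only [Finset.mem_insert, Finset.mem_singleton]
                  omega
                exact_mod_cast (Finset.card_le_card this).trans Finset.card_le_two
      _ ≤ _ := by
          rw [← Finset.mul_sum]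
          gcongr
          exact sum_range_rpow_neg_le h0 h1 _
  have hC : ∑ k ∈ S with ¬ (j - k).natAbs ≤ B, (1 + |((j - k : ℤ) : ℝ)|) ^ (-σ) ≤
      3 * (1 + B : ℝ) ^ (1 - σ) := by
    calc _ ≤ ∑ k ∈ S with ¬ (j - k).natAbs ≤ B, (1 + B : ℝ) ^ (-σ) := by
          refine Finset.sum_le_sum fun k hk => ?_
          rw [Finset.mem_filter] at hk
          refine Real.rpow_le_rpow_of_nonpos hB ?_ (by linarith)
          have : (B : ℝ) ≤ ((j - k).natAbs : ℝ) := by exact_mod_cast (not_le.1 hk.2).le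
          rw [Nat.cast_natAbs, Int.cast_abs] at this
          linarith
      _ ≤ (2 * B + 1) * (1 + B : ℝ) ^ (-σ) := by
          rw [Finset.sum_const, nsmul_eq_mul]
          gcongr
          have : (S.filter fun k => ¬ (j - k).natAbs ≤ B).card ≤ 2 * B + 1 :=
            (Finset.card_filter_le _ _).trans (by rw [hS, Int.card_Icc]; omega)
          exact_mod_cast this
      _ ≤ 3 * (1 + B) * (1 + B : ℝ) ^ (-σ) := by
          gcongr; linarith [(Nat.cast_nonneg B : (0 : ℝ) ≤ B)]
      _ = _ := by
          rw [mul_assoc, sub_eq_add_neg, Real.rpow_add hB, Real.rpow_one]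
  rw [Nat.cast_succ, add_comm (B : ℝ) 1] at hA
  linarith

theorem sum_box_prod_rpow_neg_le (d : ℕ) {σ : ℝ} (h0 : 0 ≤ σ) (h1 : σ < 1) (B : ℕ)
    (j : Fin d → ℤ) :
    ∑ k ∈ Fintype.piFinset (fun _ : Fin d => Finset.Icc (-(B : ℤ)) B),
      ∏ l, (1 + |((j l - k l : ℤ) : ℝ)|) ^ (-σ) ≤
      (3 + 2 * (1 - σ)⁻¹) ^ d * (1 + B : ℝ) ^ (d * (1 - σ)) := by
  rw [Finset.sum_prod_piFinset (Finset.Icc (-(B : ℤ)) B)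
    (fun l k => (1 + |((j l - k : ℤ) : ℝ)|) ^ (-σ))]
  calc _ ≤ ∏ l : Fin d, (3 + 2 * (1 - σ)⁻¹) * (1 + B : ℝ) ^ (1 - σ) :=
        Finset.prod_le_prod (fun l _ => Finset.sum_nonneg fun _ _ => by positivity)
          fun l _ => sum_Icc_rpow_neg_le h0 h1 B (j l)
    _ = _ := by
        rw [Finset.prod_const, mul_pow, Finset.card_univ, Fintype.card_fin, mul_comm (d : ℝ),
          Real.rpow_mul_natCast (by positivity)]

/-! ### Lattice points in unit shells -/

theorem latticeNorm_nonneg {n : ℕ} (j : Fin n → ℤ) : 0 ≤ latticeNorm j := Real.sqrt_nonneg _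

theorem latticeNorm_sq {n : ℕ} (j : Fin n → ℤ) :
    latticeNorm j ^ 2 = ((∑ i, j i ^ 2 : ℤ) : ℝ) := by
  rw [latticeNorm, Real.sq_sqrt (Finset.sum_nonneg fun _ _ => sq_nonneg _)]
  push_cast; rfl

theorem abs_coord_le_latticeNorm {n : ℕ} (j : Fin n → ℤ) (i : Fin n) :
    |(j i : ℝ)| ≤ latticeNorm j := by
  refine Real.le_sqrt_of_sq_le ?_
  rw [sq_abs]
  exact Finset.single_le_sum (f := fun i => (j i : ℝ) ^ 2) (fun _ _ => sq_nonneg _)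
    (Finset.mem_univ i)

theorem natAbs_coord_le_floor {n : ℕ} (j : Fin n → ℤ) (i : Fin n) :
    (j i).natAbs ≤ ⌊latticeNorm j⌋₊ := by
  refine Nat.le_floor ?_
  rw [Nat.cast_natAbs, Int.cast_abs]
  exact abs_coord_le_latticeNorm j i

/-- The lattice points whose length has integer part `β`. -/
noncomputable def shell (n β : ℕ) : Finset (Fin n → ℤ) :=
  (Fintype.piFinset fun _ => Finset.Icc (-(β : ℤ)) β).filter fun k => ⌊latticeNorm k⌋₊ = β

theorem mem_shell {n β : ℕ} {k : Fin n → ℤ} : k ∈ shell n β ↔ ⌊latticeNorm k⌋₊ = β := by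
  rw [shell, Finset.mem_filter, and_iff_right_iff_imp, Fintype.mem_piFinset]
  intro h i
  have := natAbs_coord_le_floor k i
  rw [Finset.mem_Icc]
  omega

theorem sum_sq_bounds_of_mem_shell {n β : ℕ} {k : Fin n → ℤ} (h : k ∈ shell n β) :
    (β : ℤ) ^ 2 ≤ ∑ i, k i ^ 2 ∧ ∑ i, k i ^ 2 < ((β : ℤ) + 1) ^ 2 := by
  rw [mem_shell, Nat.floor_eq_iff (latticeNorm_nonneg k)] at h
  have hs := latticeNorm_sq k
  constructor
  · have : (β : ℝ) ^ 2 ≤ latticeNorm k ^ 2 := by gcongr; exact h.1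
    rw [hs] at this
    exact_mod_cast this
  · have : latticeNorm k ^ 2 < ((β : ℝ) + 1) ^ 2 := by
      have := latticeNorm_nonneg k
      gcongr; exact h.2
    rw [hs] at this
    exact_mod_cast this

/-- Given the other coordinates, few lattice points of a shell have a prescribed
coordinate of maximal size. -/
theorem card_shell_fiber_le (d β : ℕ) (i : Fin (d + 1)) (y : Fin d → ℤ) :
    (((shell (d + 1) β).filter fun k => ∀ l, k l ^ 2 ≤ k i ^ 2).filter
      fun k => i.removeNth k = y).card ≤ 2 * (d + 1) := by
  classical
  set F := ((shell (d + 1) β).filter fun k => ∀ l, k l ^ 2 ≤ k i ^ 2).filter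
      fun k => i.removeNth k = y with hF
  have hsum : ∀ k ∈ F, (β : ℤ) ^ 2 ≤ k i ^ 2 + ∑ l, y l ^ 2 ∧
      k i ^ 2 + ∑ l, y l ^ 2 < ((β : ℤ) + 1) ^ 2 ∧ (β : ℤ) ^ 2 ≤ (d + 1) * k i ^ 2 := by
    intro k hk
    simp only [hF, Finset.mem_filter] at hk
    have hb := sum_sq_bounds_of_mem_shell hk.1.1
    have he : ∑ l, k l ^ 2 = k i ^ 2 + ∑ l, y l ^ 2 := by
      rw [Fin.sum_univ_succAbove _ i, ← hk.2]; rfl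
    refine ⟨he ▸ hb.1, he ▸ hb.2, hb.1.trans ?_⟩
    calc ∑ l, k l ^ 2 ≤ ∑ _l : Fin (d + 1), k i ^ 2 := Finset.sum_le_sum fun l _ => hk.1.2 l
      _ = _ := by simp
  -- With the other coordinates fixed, the shell confines `k i ^ 2` to a half-open interval of
  -- length `2β + 1`. Maximality gives `β ≤ (d+1)|k' i|`, so raising `|k' i|` by `d + 1` would raise
  -- its square by at least `2β + 1`.
  have hclose : ∀ k ∈ F, ∀ k' ∈ F, (k i).natAbs < (k' i).natAbs + (d + 1) := by
    intro k hk k' hk'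
    obtain ⟨-, h2, -⟩ := hsum k hk
    obtain ⟨h1', -, h3'⟩ := hsum k' hk'
    by_contra hcon
    push Not at hcon
    rw [← Int.natAbs_sq (k i)] at h2
    rw [← Int.natAbs_sq (k' i)] at h1' h3'
    generalize (k i).natAbs = x at *
    generalize (k' i).natAbs = x' at *
    have hx : (x' : ℤ) + (d + 1) ≤ x := by exact_mod_cast hcon
    have hx2 : ((x' : ℤ) + (d + 1)) ^ 2 ≤ (x : ℤ) ^ 2 := by gcongr
    have hβ : (β : ℤ) ≤ (d + 1) * x' := by
      refine abs_le_of_sq_le_sq' (a := (β : ℤ)) (b := (d + 1) * x') ?_ (by positivity) |>.2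
      calc (β : ℤ) ^ 2 ≤ (d + 1) * (x' : ℤ) ^ 2 := h3'
        _ ≤ ((d : ℤ) + 1) ^ 2 * (x' : ℤ) ^ 2 := by
            gcongr; nlinarith [(Nat.cast_nonneg d : (0 : ℤ) ≤ d)]
        _ = _ := by ring
    nlinarith [(Nat.cast_nonneg d : (0 : ℤ) ≤ d)]
  -- Two absolute values less than `d + 1` apart and congruent modulo `d + 1` coincide, so sign and
  -- residue determine `k i`, and with it `k`.
  have hinj : Set.InjOn (fun k : Fin (d + 1) → ℤ =>
      ((decide (0 ≤ k i), (k i).natAbs % (d + 1)) : Bool × ℕ)) F := by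
    intro k hk k' hk' h
    simp only [Prod.mk.injEq, decide_eq_decide] at h
    have h1 := hclose k hk k' hk'
    have h2 := hclose k' hk' k hk
    have habs : (k i).natAbs = (k' i).natAbs := by
      have hm : (k i).natAbs ≡ (k' i).natAbs [MOD (d + 1)] := h.2
      rcases le_total (k i).natAbs (k' i).natAbs with hle | hle
      · refine Nat.le_antisymm hle ?_
        have := Nat.ModEq.add_le_of_lt hm
        by_contra hc
        have := this (by omega)
        omega
      · refine Nat.le_antisymm ?_ hle
        have := Nat.ModEq.add_le_of_lt hm.symm
        by_contra hc
        have := this (by omega)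
        omega
    have hi : k i = k' i := by
      have := h.1
      omega
    simp only [hF, Finset.coe_filter, Finset.mem_filter, Set.mem_ofPred_eq] at hk hk'
    rw [← Fin.insertNth_self_removeNth i k, ← Fin.insertNth_self_removeNth i k', hk.2, hk'.2, hi]
  calc F.card ≤ ((Finset.univ : Finset Bool) ×ˢ Finset.range (d + 1)).card := by
        refine Finset.card_le_card_of_injOn _ (fun k _ => ?_) hinj
        exact Finset.mem_product.2
          ⟨Finset.mem_univ _, Finset.mem_range.2 (Nat.mod_lt _ d.succ_pos)⟩
    _ = _ := by simp [Finset.card_product]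

/-- Deleting a coordinate of maximal size projects the shell to a `d`-dimensional box with fibres of
bounded size. Since `|j-k|` dominates each remaining coordinate difference, the weight splits into
`d` one-dimensional factors of exponent `-σ`. The case `σ = 0` counts the shell. -/
theorem sum_shell_rpow_neg_le (d : ℕ) {σ : ℝ} (h0 : 0 ≤ σ) (h1 : σ < 1) :
    ∃ C : ℝ, 0 < C ∧ ∀ (β : ℕ) (j : Fin (d + 1) → ℤ),
      ∑ k ∈ shell (d + 1) β, (1 + latticeNorm (j - k)) ^ (-(d * σ)) ≤
        C * (1 + β : ℝ) ^ (d * (1 - σ)) := by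
  classical
  have h1' : 0 < 1 - σ := by linarith
  refine ⟨(d + 1) * ((2 * (d + 1)) * (3 + 2 * (1 - σ)⁻¹) ^ d), by positivity, fun β j => ?_⟩
  set W : Fin (d + 1) → (Fin d → ℤ) → ℝ := fun i y =>
    ∏ l, (1 + |((i.removeNth j l - y l : ℤ) : ℝ)|) ^ (-σ) with hW
  have hWnn : ∀ i y, 0 ≤ W i y := fun i y => Finset.prod_nonneg fun _ _ => by positivity
  have hle : ∀ (i : Fin (d + 1)) (k : Fin (d + 1) → ℤ),
      (1 + latticeNorm (j - k)) ^ (-(d * σ)) ≤ W i (i.removeNth k) := by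
    intro i k
    have hnn := latticeNorm_nonneg (j - k)
    calc _ = ∏ _l : Fin d, (1 + latticeNorm (j - k)) ^ (-σ) := by
          rw [Finset.prod_const, Finset.card_univ, Fintype.card_fin,
            ← Real.rpow_mul_natCast (by positivity)]
          congr 1; ring
      _ ≤ _ := by
          refine Finset.prod_le_prod (fun _ _ => by positivity) fun l _ => ?_
          refine Real.rpow_le_rpow_of_nonpos (by positivity) ?_ (by linarith)
          have := abs_coord_le_latticeNorm (j - k) (i.succAbove l)
          simp only [Fin.removeNth, Pi.sub_apply] at this ⊢
          linarith
  have hcover : ∑ k ∈ shell (d + 1) β, (1 + latticeNorm (j - k)) ^ (-(d * σ)) ≤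
      ∑ i, ∑ k ∈ (shell (d + 1) β).filter (fun k => ∀ l, k l ^ 2 ≤ k i ^ 2),
        (1 + latticeNorm (j - k)) ^ (-(d * σ)) := by
    have hnn : ∀ k : Fin (d + 1) → ℤ, 0 ≤ (1 + latticeNorm (j - k)) ^ (-(d * σ)) := fun k => by
      have := latticeNorm_nonneg (j - k)
      positivity
    simp_rw [Finset.sum_filter]
    rw [Finset.sum_comm]
    refine Finset.sum_le_sum fun k _ => ?_
    obtain ⟨i, -, hi⟩ := Finset.exists_max_image Finset.univ (fun l => k l ^ 2)
      Finset.univ_nonempty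
    refine le_trans ?_ (Finset.single_le_sum (fun i _ => ?_) (Finset.mem_univ i))
    · rw [if_pos fun l => hi l (Finset.mem_univ l)]
    · split_ifs <;> simp [hnn]
  refine hcover.trans ?_
  calc _ ≤ ∑ _i : Fin (d + 1), (2 * (d + 1)) *
        ((3 + 2 * (1 - σ)⁻¹) ^ d * (1 + β : ℝ) ^ (d * (1 - σ))) := by
        refine Finset.sum_le_sum fun i _ => ?_
        set T := (shell (d + 1) β).filter (fun k => ∀ l, k l ^ 2 ≤ k i ^ 2) with hT
        have hmaps : ∀ k ∈ T, i.removeNth k ∈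
            Fintype.piFinset (fun _ : Fin d => Finset.Icc (-(β : ℤ)) β) := by
          intro k hk
          rw [hT, Finset.mem_filter, shell, Finset.mem_filter, Fintype.mem_piFinset] at hk
          exact Fintype.mem_piFinset.2 fun l => hk.1.1 _
        calc _ ≤ ∑ k ∈ T, W i (i.removeNth k) := Finset.sum_le_sum fun k _ => hle i k
          _ = _ := (Finset.sum_fiberwise_of_maps_to hmaps _).symm
          _ ≤ ∑ y ∈ Fintype.piFinset (fun _ : Fin d => Finset.Icc (-(β : ℤ)) β),
                (2 * (d + 1)) * W i y := by
              refine Finset.sum_le_sum fun y _ => ?_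
              rw [Finset.sum_congr rfl (g := fun _ => W i y)
                (fun k hk => by rw [(Finset.mem_filter.1 hk).2]), Finset.sum_const, nsmul_eq_mul]
              refine mul_le_mul_of_nonneg_right ?_ (hWnn i y)
              exact_mod_cast card_shell_fiber_le d β i y
          _ ≤ _ := by
              rw [← Finset.mul_sum]
              gcongr
              exact sum_box_prod_rpow_neg_le d h0 h1 β _
    _ = _ := by
        rw [Finset.sum_const, Finset.card_univ, Fintype.card_fin, nsmul_eq_mul]
        push_cast; ring

end TorusWeyl

/-! ### Sums over pairs of shells -/

namespace TorusWeyl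

theorem latticeNorm_sub_comm {n : ℕ} (j k : Fin n → ℤ) :
    latticeNorm (j - k) = latticeNorm (k - j) := by
  unfold latticeNorm
  congr 1
  refine Finset.sum_congr rfl fun i _ => ?_
  simp only [Pi.sub_apply, Int.cast_sub]
  ring

theorem tsum_lattice_eq_tsum_shell {n : ℕ} (f : (Fin n → ℤ) → ENNReal) :
    ∑' k, f k = ∑' β : ℕ, ∑ k ∈ shell n β, f k := by
  classical
  calc ∑' k, f k = ∑' k, ∑' β : ℕ, if β = ⌊latticeNorm k⌋₊ then f k else 0 := by
        refine tsum_congr fun k => ?_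
        rw [tsum_ite_eq]
    _ = ∑' β : ℕ, ∑' k, if β = ⌊latticeNorm k⌋₊ then f k else 0 := ENNReal.tsum_comm
    _ = _ := by
        refine tsum_congr fun β => ?_
        rw [tsum_eq_sum (s := shell n β)]
        · exact Finset.sum_congr rfl fun k hk => if_pos (mem_shell.1 hk).symm
        · intro k hk
          rw [mem_shell] at hk
          exact if_neg fun h => hk h.symm

/-- The weighted sum over pairs of shells that controls sums over pairs of lattice points. -/
noncomputable def shellPairSum (d : ℕ) (η : ℝ) (A : ℕ → ℕ → ℝ) : ENNReal :=
  ∑' α : ℕ, ∑' e : ℕ, ENNReal.ofReal ((1 + α : ℝ) ^ d * A α (α + e) * (1 + e : ℝ) ^ (-1 - η))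

/-- A bound for the quotient `(h(a) - h(b)) / (a² - b²)` on a pair of shells. -/
noncomputable def shellWeight (A : ℕ → ℕ → ℝ) (α β : ℕ) : ℝ :=
  A (min α β) (max α β) / ((1 + (max α β - min α β : ℕ)) * (1 + (max α β : ℕ)))

theorem shellWeight_comm (A : ℕ → ℕ → ℝ) (α β : ℕ) : shellWeight A α β = shellWeight A β α := by
  rw [shellWeight, shellWeight, min_comm, max_comm]

theorem shellWeight_of_le (A : ℕ → ℕ → ℝ) {α β : ℕ} (h : α ≤ β) :
    shellWeight A α β = A α β / ((1 + (β - α : ℕ)) * (1 + (β : ℕ))) := by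
  rw [shellWeight, min_eq_left h, max_eq_right h]

theorem shellWeight_nonneg {A : ℕ → ℕ → ℝ} (hA : ∀ α β, 0 ≤ A α β) (α β : ℕ) :
    0 ≤ shellWeight A α β := by
  have := hA (min α β) (max α β)
  rw [shellWeight]; positivity

/-- Reduces a sum over pairs of lattice points, with a weight depending only on shells, to a double
sum over shells. By symmetry the case of `j` in the lower shell suffices, which is the factor 2. -/
theorem tsum_shellWeight_le {d : ℕ} (hd : 1 ≤ d) {η : ℝ} (h0 : 0 < η) (h1 : η < 1) :
    ∃ C : ℝ, 0 < C ∧ ∀ A : ℕ → ℕ → ℝ, (∀ α β, 0 ≤ A α β) →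
      ∑' p : (Fin (d + 1) → ℤ) × (Fin (d + 1) → ℤ),
        ENNReal.ofReal (shellWeight A ⌊latticeNorm p.1⌋₊ ⌊latticeNorm p.2⌋₊ *
          (1 + latticeNorm (p.1 - p.2)) ^ (-(d - 1 + η))) ≤
      ENNReal.ofReal C * shellPairSum d η A := by
  classical
  have hd0 : (1 : ℝ) ≤ d := by exact_mod_cast hd
  have hdp : (0 : ℝ) < d := by linarith
  obtain ⟨C₁, hC₁, hcard⟩ := sum_shell_rpow_neg_le d le_rfl zero_lt_one
  -- This `σ` makes `dσ = d - 1 + η`, the decay exponent of the coefficients; a shell sum then has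
  -- size `(1+β)^{1-η}`.
  obtain ⟨C₂, hC₂, hsum⟩ := sum_shell_rpow_neg_le d (σ := (d - 1 + η) / d)
    (by apply div_nonneg <;> linarith) (by rw [div_lt_one hdp]; linarith)
  have e1 : d * ((d - 1 + η) / d) = d - 1 + η := by field_simp
  have e2 : d * (1 - (d - 1 + η) / d) = 1 - η := by field_simp; ring
  rw [e1, e2] at hsum
  simp only [mul_zero, neg_zero, Real.rpow_zero, sub_zero, mul_one, Finset.sum_const,
    nsmul_eq_mul, Real.rpow_natCast] at hcard
  refine ⟨2 * (C₁ * C₂), by positivity, fun A hA => ?_⟩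
  have hU : ∀ m : Fin (d + 1) → ℤ, 0 ≤ (1 + latticeNorm m) ^ (-(d - 1 + η)) := fun m => by
    have := latticeNorm_nonneg m
    positivity
  have half : ∑' j : Fin (d + 1) → ℤ, ∑' k : Fin (d + 1) → ℤ,
      (if ⌊latticeNorm j⌋₊ ≤ ⌊latticeNorm k⌋₊ then
        ENNReal.ofReal (shellWeight A ⌊latticeNorm j⌋₊ ⌊latticeNorm k⌋₊ *
          (1 + latticeNorm (j - k)) ^ (-(d - 1 + η))) else 0) ≤
      ENNReal.ofReal (C₁ * C₂) * shellPairSum d η A := by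
    have inner : ∀ j : Fin (d + 1) → ℤ, ∑' k : Fin (d + 1) → ℤ,
        (if ⌊latticeNorm j⌋₊ ≤ ⌊latticeNorm k⌋₊ then
          ENNReal.ofReal (shellWeight A ⌊latticeNorm j⌋₊ ⌊latticeNorm k⌋₊ *
            (1 + latticeNorm (j - k)) ^ (-(d - 1 + η))) else 0) ≤
        ∑' e : ℕ, ENNReal.ofReal (C₂ * (A ⌊latticeNorm j⌋₊ (⌊latticeNorm j⌋₊ + e) *
          (1 + e : ℝ) ^ (-1 - η))) := by
      intro j
      rw [tsum_lattice_eq_tsum_shell]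
      set α := ⌊latticeNorm j⌋₊
      have hb : ∀ β, ∑ k ∈ shell (d + 1) β, (if α ≤ ⌊latticeNorm k⌋₊ then
          ENNReal.ofReal (shellWeight A α ⌊latticeNorm k⌋₊ *
            (1 + latticeNorm (j - k)) ^ (-(d - 1 + η))) else 0) ≤
          if α ≤ β then ENNReal.ofReal (C₂ * (A α β * (1 + (β - α : ℕ) : ℝ) ^ (-1 - η))) else 0 := by
        intro β
        split_ifs with hαβ
        · calc _ = ∑ k ∈ shell (d + 1) β, ENNReal.ofReal (shellWeight A α β *
                (1 + latticeNorm (j - k)) ^ (-(d - 1 + η))) := by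
                refine Finset.sum_congr rfl fun k hk => ?_
                rw [mem_shell.1 hk, if_pos hαβ]
            _ = ENNReal.ofReal (shellWeight A α β * ∑ k ∈ shell (d + 1) β,
                  (1 + latticeNorm (j - k)) ^ (-(d - 1 + η))) := by
                rw [Finset.mul_sum, ENNReal.ofReal_sum_of_nonneg]
                exact fun k _ => mul_nonneg (shellWeight_nonneg hA _ _) (hU _)
            _ ≤ _ := by
                refine ENNReal.ofReal_le_ofReal ?_
                calc _ ≤ shellWeight A α β * (C₂ * (1 + β : ℝ) ^ (1 - η)) := by
                      gcongr
                      · exact shellWeight_nonneg hA _ _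
                      · exact hsum β j
                  _ ≤ _ := by
                      rw [shellWeight_of_le A hαβ]
                      have hβ : (0 : ℝ) < 1 + β := by positivity
                      have he : (0 : ℝ) < 1 + (β - α : ℕ) := by positivity
                      have hle : (1 + (β - α : ℕ) : ℝ) ≤ 1 + β := by
                        have : β - α ≤ β := Nat.sub_le _ _
                        have : ((β - α : ℕ) : ℝ) ≤ β := by exact_mod_cast this
                        linarith
                      -- After the denominator `1 + β` is cancelled, the surplus `(1+β)^{-η}` is
                      -- weakened to `(1+β-α)^{-η}`; this makes the sum over `β` converge.
                      have h3 : (1 + β : ℝ) ^ (-η) ≤ (1 + (β - α : ℕ) : ℝ) ^ (-η) :=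
                        Real.rpow_le_rpow_of_nonpos he hle (by linarith)
                      have h4 : (1 + β : ℝ) ^ (1 - η) = (1 + β) * (1 + β : ℝ) ^ (-η) := by
                        rw [sub_eq_add_neg, Real.rpow_add hβ, Real.rpow_one]
                      have h5 : (1 + (β - α : ℕ) : ℝ) ^ (-1 - η) =
                          (1 + (β - α : ℕ) : ℝ)⁻¹ * (1 + (β - α : ℕ) : ℝ) ^ (-η) := by
                        rw [sub_eq_add_neg, Real.rpow_add he, Real.rpow_neg_one]
                      rw [h4, h5]
                      have hAn := hA α β
                      calc _ = C₂ * (A α β * ((1 + (β - α : ℕ) : ℝ)⁻¹ * (1 + β : ℝ) ^ (-η))) := by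
                            field_simp
                        _ ≤ _ := by gcongr
        · refine (Finset.sum_eq_zero fun k hk => ?_).le
          rw [mem_shell.1 hk, if_neg hαβ]
      refine (ENNReal.tsum_le_tsum hb).trans ?_
      rw [← Summable.sum_add_tsum_nat_add' (k := α) ENNReal.summable, Finset.sum_eq_zero, zero_add]
      · refine ENNReal.tsum_le_tsum fun e => ?_
        rw [if_pos (by omega), add_comm e α, Nat.add_sub_cancel_left]
      · intro β hβ
        rw [Finset.mem_range] at hβ
        exact if_neg (by omega)
    refine (ENNReal.tsum_le_tsum inner).trans ?_
    rw [tsum_lattice_eq_tsum_shell, shellPairSum, ← ENNReal.tsum_mul_left]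
    refine ENNReal.tsum_le_tsum fun α => ?_
    calc _ = ∑ k ∈ shell (d + 1) α, ∑' e : ℕ, ENNReal.ofReal (C₂ * (A α (α + e) *
          (1 + e : ℝ) ^ (-1 - η))) := by
          refine Finset.sum_congr rfl fun k hk => ?_
          rw [mem_shell.1 hk]
      _ ≤ ENNReal.ofReal (C₁ * (1 + α : ℝ) ^ d) * ∑' e : ℕ, ENNReal.ofReal (C₂ * (A α (α + e) *
          (1 + e : ℝ) ^ (-1 - η))) := by
          rw [Finset.sum_const, nsmul_eq_mul]
          gcongr
          rw [← ENNReal.ofReal_natCast]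
          exact ENNReal.ofReal_le_ofReal (hcard α 0)
      _ = _ := by
          rw [← ENNReal.tsum_mul_left, ← ENNReal.tsum_mul_left]
          refine tsum_congr fun e => ?_
          rw [← ENNReal.ofReal_mul (by positivity), ← ENNReal.ofReal_mul (by positivity)]
          congr 1; ring
  calc _ = ∑' j : Fin (d + 1) → ℤ, ∑' k : Fin (d + 1) → ℤ,
        ENNReal.ofReal (shellWeight A ⌊latticeNorm j⌋₊ ⌊latticeNorm k⌋₊ *
          (1 + latticeNorm (j - k)) ^ (-(d - 1 + η))) := ENNReal.tsum_prod'
    _ ≤ ∑' j : Fin (d + 1) → ℤ, ∑' k : Fin (d + 1) → ℤ,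
      ((if ⌊latticeNorm j⌋₊ ≤ ⌊latticeNorm k⌋₊ then
        ENNReal.ofReal (shellWeight A ⌊latticeNorm j⌋₊ ⌊latticeNorm k⌋₊ *
          (1 + latticeNorm (j - k)) ^ (-(d - 1 + η))) else 0) +
       (if ⌊latticeNorm k⌋₊ ≤ ⌊latticeNorm j⌋₊ then
        ENNReal.ofReal (shellWeight A ⌊latticeNorm k⌋₊ ⌊latticeNorm j⌋₊ *
          (1 + latticeNorm (k - j)) ^ (-(d - 1 + η))) else 0)) := by
        refine ENNReal.tsum_le_tsum fun j => ENNReal.tsum_le_tsum fun k => ?_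
        rcases le_total ⌊latticeNorm j⌋₊ ⌊latticeNorm k⌋₊ with h | h
        · rw [if_pos h]; exact le_self_add
        · rw [if_pos h, shellWeight_comm A ⌊latticeNorm k⌋₊, latticeNorm_sub_comm k j]
          exact le_add_self
    _ ≤ ENNReal.ofReal (C₁ * C₂) * shellPairSum d η A +
        ENNReal.ofReal (C₁ * C₂) * shellPairSum d η A := by
        simp_rw [ENNReal.tsum_add]
        refine add_le_add half ?_
        rw [ENNReal.tsum_comm]
        exact half
    _ = _ := by
        rw [← two_mul, ← mul_assoc, ENNReal.ofReal_mul zero_le_two, ENNReal.ofReal_ofNat]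

theorem tsum_rpow_neg_zero_le {η : ℝ} (h0 : 0 < η) (h1 : η < 1) :
    ∑' e : ℕ, ENNReal.ofReal ((1 + e : ℝ) ^ (-1 - η)) ≤ ENNReal.ofReal (1 + η⁻¹) := by
  simpa using tsum_rpow_neg_le h0 h1 0

/-- If `A α β` is bounded by a function of `α`. -/
theorem shellPairSum_le_of_le_left {d : ℕ} {η : ℝ} (h0 : 0 < η) (h1 : η < 1)
    {A : ℕ → ℕ → ℝ} {F : ℕ → ℝ} (hF : ∀ α, 0 ≤ F α) (hA : ∀ α e, A α (α + e) ≤ F α) :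
    shellPairSum d η A ≤ ENNReal.ofReal (1 + η⁻¹) *
      ∑' α : ℕ, ENNReal.ofReal ((1 + α : ℝ) ^ d * F α) := by
  rw [← ENNReal.tsum_mul_left, shellPairSum]
  refine ENNReal.tsum_le_tsum fun α => ?_
  calc _ ≤ ∑' e : ℕ, ENNReal.ofReal ((1 + α : ℝ) ^ d * F α) *
        ENNReal.ofReal ((1 + e : ℝ) ^ (-1 - η)) := by
        refine ENNReal.tsum_le_tsum fun e => ?_
        rw [← ENNReal.ofReal_mul (mul_nonneg (by positivity) (hF α))]
        refine ENNReal.ofReal_le_ofReal ?_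
        gcongr
        exact hA α e
    _ ≤ _ := by
        rw [ENNReal.tsum_mul_left, mul_comm]
        gcongr
        exact tsum_rpow_neg_zero_le h0 h1

/-- If `A α β` is bounded by a function of `β`. -/
theorem shellPairSum_le_of_le_right {d : ℕ} {η : ℝ} (h0 : 0 < η) (h1 : η < 1)
    {A : ℕ → ℕ → ℝ} {F : ℕ → ℝ} (hF : ∀ α, 0 ≤ F α) (hA : ∀ α e, A α (α + e) ≤ F (α + e)) :
    shellPairSum d η A ≤ ENNReal.ofReal (1 + η⁻¹) *
      ∑' α : ℕ, ENNReal.ofReal ((1 + α : ℝ) ^ d * F α) := by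
  rw [shellPairSum, ENNReal.tsum_comm]
  calc _ ≤ ∑' e : ℕ, ENNReal.ofReal ((1 + e : ℝ) ^ (-1 - η)) *
        ∑' α : ℕ, ENNReal.ofReal ((1 + α : ℝ) ^ d * F α) := by
        refine ENNReal.tsum_le_tsum fun e => ?_
        calc _ ≤ ∑' α : ℕ, ENNReal.ofReal ((1 + e : ℝ) ^ (-1 - η)) *
              ENNReal.ofReal ((1 + (α + e : ℕ) : ℝ) ^ d * F (α + e)) := by
              refine ENNReal.tsum_le_tsum fun α => ?_
              rw [← ENNReal.ofReal_mul (by positivity)]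
              refine ENNReal.ofReal_le_ofReal ?_
              rw [mul_comm]
              have := hF (α + e)
              have hle : (1 + α : ℝ) ^ d ≤ (1 + (α + e : ℕ) : ℝ) ^ d := by
                push_cast
                gcongr
                linarith [(Nat.cast_nonneg e : (0 : ℝ) ≤ e)]
              refine mul_le_mul_of_nonneg_left ?_ (by positivity)
              calc _ ≤ (1 + α : ℝ) ^ d * F (α + e) := by gcongr; exact hA α e
                _ ≤ _ := by gcongr
          _ ≤ _ := by
              rw [ENNReal.tsum_mul_left]
              exact mul_le_mul' le_rfl
                (ENNReal.tsum_comp_le_tsum_of_injective (add_left_injective e)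
                  (fun α : ℕ => ENNReal.ofReal ((1 + α : ℝ) ^ d * F α)))
    _ ≤ _ := by
        rw [ENNReal.tsum_mul_right]
        gcongr
        exact tsum_rpow_neg_zero_le h0 h1

/-- The source of the exponent `n - η`: summing over the upper shell leaves `(1+L-α)^{-η}`, and
summing this over `α ≤ L` yields a further `(1+L)^{1-η}`. -/
theorem shellPairSum_straddle_le {d : ℕ} {η : ℝ} (h0 : 0 < η) (h1 : η < 1) (L : ℕ) :
    shellPairSum d η (fun α β => if α ≤ L ∧ L ≤ β then 1 else 0) ≤
      ENNReal.ofReal ((1 + η⁻¹) * (1 - η)⁻¹ * (1 + L : ℝ) ^ (d + 1 - η)) := by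
  have h1' : 0 < 1 - η := by linarith
  have hin : ∀ α : ℕ, ∑' e : ℕ, ENNReal.ofReal ((1 + α : ℝ) ^ d *
      (if α ≤ L ∧ L ≤ α + e then 1 else 0) * (1 + e : ℝ) ^ (-1 - η)) ≤
      if α ≤ L then ENNReal.ofReal ((1 + L : ℝ) ^ d * ((1 + η⁻¹) * (1 + (L - α : ℕ) : ℝ) ^ (-η)))
        else 0 := by
    intro α
    split_ifs with hα
    · rw [← Summable.sum_add_tsum_nat_add' (k := L - α) ENNReal.summable, Finset.sum_eq_zero,
        zero_add]
      · calc _ ≤ ∑' e : ℕ, ENNReal.ofReal ((1 + L : ℝ) ^ d) *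
              ENNReal.ofReal ((1 + (L - α : ℕ) + e : ℝ) ^ (-1 - η)) := by
              refine ENNReal.tsum_le_tsum fun e => ?_
              rw [← ENNReal.ofReal_mul (by positivity), if_pos ⟨hα, by omega⟩, mul_one]
              refine ENNReal.ofReal_le_ofReal ?_
              have : (α : ℝ) ≤ L := by exact_mod_cast hα
              have e1 : (1 + (e + (L - α) : ℕ) : ℝ) = 1 + (L - α : ℕ) + e := by push_cast; ring
              rw [e1]
              gcongr
          _ ≤ _ := by
              rw [ENNReal.tsum_mul_left, ENNReal.ofReal_mul (by positivity)]
              gcongr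
              exact tsum_rpow_neg_le h0 h1 _
      · intro e he
        rw [Finset.mem_range] at he
        rw [if_neg (by omega)]
        simp
    · simp [hα]
  refine (ENNReal.tsum_le_tsum hin).trans ?_
  rw [tsum_eq_sum (s := Finset.range (L + 1))
    (fun α hα => if_neg (by rw [Finset.mem_range] at hα; omega)),
    ← Finset.sum_range_reflect]
  calc _ = ∑ e ∈ Finset.range (L + 1), ENNReal.ofReal ((1 + L : ℝ) ^ d *
        ((1 + η⁻¹) * (1 + e : ℝ) ^ (-η))) := by
        refine Finset.sum_congr rfl fun e he => ?_
        rw [Finset.mem_range] at he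
        rw [if_pos (by omega)]
        have : L - (L + 1 - 1 - e) = e := by omega
        rw [this]
    _ = ENNReal.ofReal ((1 + L : ℝ) ^ d * ((1 + η⁻¹) *
        ∑ e ∈ Finset.range (L + 1), (1 + e : ℝ) ^ (-η))) := by
        rw [Finset.mul_sum, Finset.mul_sum, ENNReal.ofReal_sum_of_nonneg]
        intros; positivity
    _ ≤ _ := by
        refine ENNReal.ofReal_le_ofReal ?_
        have hs := sum_range_rpow_neg_le h0.le h1 (L + 1)
        have hL : (0 : ℝ) < 1 + L := by positivity
        have e2 : (1 + L : ℝ) ^ (d + 1 - η) = (1 + L : ℝ) ^ d * (1 + L : ℝ) ^ (1 - η) := by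
          rw [add_sub_assoc, Real.rpow_add hL, Real.rpow_natCast]
        rw [e2]
        push_cast at hs
        rw [add_comm (L : ℝ) 1] at hs
        calc _ ≤ (1 + L : ℝ) ^ d * ((1 + η⁻¹) * ((1 - η)⁻¹ * (1 + L : ℝ) ^ (1 - η))) := by gcongr
          _ = _ := by ring

/-- Only `M + 1` lower shells contribute, so no power beyond `(1+L)^d` appears. This handles
straddling pairs of bounded difference. -/
theorem shellPairSum_window_le {d : ℕ} {η : ℝ} (h0 : 0 < η) (h1 : η < 1) (L M : ℕ) :
    shellPairSum d η (fun α _ => if α ≤ L ∧ L ≤ α + M then 1 else 0) ≤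
      ENNReal.ofReal ((1 + η⁻¹) * ((M + 1) * (1 + L : ℝ) ^ d)) := by
  refine (shellPairSum_le_of_le_left h0 h1 (F := fun α => if α ≤ L ∧ L ≤ α + M then 1 else 0)
    (fun α => by split_ifs <;> norm_num) (fun _ _ => le_rfl)).trans ?_
  rw [ENNReal.ofReal_mul (by positivity)]
  gcongr
  rw [tsum_eq_sum (s := Finset.Icc (L - M) L) (fun α hα => by
    rw [Finset.mem_Icc] at hα
    rw [if_neg (by omega)]; simp)]
  calc _ ≤ ∑ _α ∈ Finset.Icc (L - M) L, ENNReal.ofReal ((1 + L : ℝ) ^ d) := by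
        refine Finset.sum_le_sum fun α hα => ENNReal.ofReal_le_ofReal ?_
        rw [Finset.mem_Icc] at hα
        have : (α : ℝ) ≤ L := by exact_mod_cast hα.2
        calc _ ≤ (1 + α : ℝ) ^ d * 1 := by gcongr; split_ifs <;> norm_num
          _ ≤ _ := by rw [mul_one]; gcongr
    _ ≤ _ := by
        rw [Finset.sum_const, nsmul_eq_mul, ENNReal.ofReal_mul (by positivity),
          ← ENNReal.ofReal_natCast]
        gcongr
        rw [Nat.card_Icc]
        have : L + 1 - (L - M) ≤ M + 1 := by omega
        exact_mod_cast this

/-- The decay profile of a spectral cutoff at `lam` of width `w`. -/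
noncomputable def decay (N : ℕ) (w lam τ : ℝ) : ℝ := ((1 + |τ - lam| / w) ^ N)⁻¹

theorem decay_nonneg (N : ℕ) {w : ℝ} (hw : 0 ≤ w) (lam τ : ℝ) : 0 ≤ decay N w lam τ := by
  rw [decay]; positivity

theorem tsum_inv_sq_le {w : ℝ} (hw : 1 ≤ w) :
    ∑' e : ℕ, ENNReal.ofReal (((1 + e / w) ^ 2)⁻¹) ≤ ENNReal.ofReal (2 * w) := by
  have hw0 : 0 < w := by linarith
  refine ENNReal.tsum_le_of_sum_range_le fun M => ?_
  rw [← ENNReal.ofReal_sum_of_nonneg (fun _ _ => by positivity)]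
  refine ENNReal.ofReal_le_ofReal ?_
  -- Telescoping: `(w+e+1)^{-2}` is at most `1/((w+e)(w+e+1))`.
  have hterm : ∀ e : ℕ, ((1 + (e + 1 : ℕ) / w) ^ 2)⁻¹ ≤
      w ^ 2 * ((w + e)⁻¹ - (w + (e + 1 : ℕ))⁻¹) := by
    intro e
    have h1 : 0 < w + e := by positivity
    have : ((1 + (e + 1 : ℕ) / w) ^ 2)⁻¹ = w ^ 2 * ((w + (e + 1 : ℕ)) ^ 2)⁻¹ := by
      field_simp
    rw [this]
    gcongr
    push_cast
    rw [inv_sub_inv (by positivity) (by positivity), inv_eq_one_div]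
    gcongr <;> linarith
  cases M with
  | zero => simp; positivity
  | succ M =>
    rw [Finset.sum_range_succ']
    calc _ ≤ ∑ e ∈ Finset.range M, w ^ 2 * ((w + e)⁻¹ - (w + (e + 1 : ℕ))⁻¹) +
          ((1 + (0 : ℕ) / w) ^ 2)⁻¹ := by
          gcongr with e _
          exact hterm e
      _ ≤ w + 1 := by
          rw [← Finset.mul_sum, Finset.sum_range_sub' (fun e : ℕ => (w + e)⁻¹)]
          have : 0 ≤ (w + M)⁻¹ := by positivity
          have h2 : w ^ 2 * ((w + (0 : ℕ))⁻¹ - (w + M)⁻¹) ≤ w ^ 2 * w⁻¹ := by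
            gcongr; simpa using this
          have h3 : w ^ 2 * w⁻¹ = w := by field_simp
          simp only [Nat.cast_zero, zero_div, add_zero, one_pow, inv_one] at *
          linarith
      _ ≤ _ := by linarith

/-- Of the `d + 2` powers of decay, `d` absorb the growth of `(1+α)^d` away from `lam`; the other
two make the sum converge, with about `w` effective terms on each side of `lam`. -/
theorem tsum_pow_mul_decay_le (d : ℕ) {w lam : ℝ} (hw : 1 ≤ w) (hlam : w ≤ lam) :
    ∑' α : ℕ, ENNReal.ofReal ((1 + α : ℝ) ^ d * decay (d + 2) w lam α) ≤
      ENNReal.ofReal (2 ^ (d + 2) * (w * lam ^ d)) := by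
  have hw0 : 0 < w := by linarith
  have hl0 : 0 < lam := by linarith
  have hpt : ∀ α : ℕ, (1 + α : ℝ) ^ d * decay (d + 2) w lam α ≤
      (2 * lam) ^ d * ((1 + |α - lam| / w) ^ 2)⁻¹ := by
    intro α
    have hx : 0 ≤ |α - lam| / w := by positivity
    have hle : (1 + α : ℝ) ≤ 2 * lam * (1 + |α - lam| / w) := by
      have h1 : |α - lam| ≤ lam * (|α - lam| / w) := by
        calc |α - lam| = w * (|α - lam| / w) := by field_simp
          _ ≤ _ := by gcongr
      have h2 := le_abs_self (α - lam)
      nlinarith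
    calc _ ≤ (2 * lam * (1 + |α - lam| / w)) ^ d * decay (d + 2) w lam α := by
          gcongr; exact decay_nonneg _ hw0.le _ _
      _ = _ := by
          rw [decay, mul_pow, pow_add]
          field_simp
  have hsum : ∑' α : ℕ, ENNReal.ofReal (((1 + |α - lam| / w) ^ 2)⁻¹) ≤
      ENNReal.ofReal (2 * w) + ENNReal.ofReal (2 * w) := by
    set L := ⌊lam⌋₊
    have hL : (L : ℝ) ≤ lam := Nat.floor_le hl0.le
    have hL' : lam < L + 1 := Nat.lt_floor_add_one lam
    rw [← Summable.sum_add_tsum_nat_add' (k := L + 1) ENNReal.summable]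
    refine add_le_add ?_ ?_
    · rw [← Finset.sum_range_reflect]
      refine le_trans (Finset.sum_le_sum (g := fun e : ℕ => ENNReal.ofReal (((1 + e / w) ^ 2)⁻¹))
        fun e he => ?_) ((ENNReal.sum_le_tsum _).trans (tsum_inv_sq_le hw))
      rw [Finset.mem_range] at he
      have : (e : ℝ) ≤ |((L + 1 - 1 - e : ℕ) : ℝ) - lam| := by
        have : L + 1 - 1 - e = L - e := by omega
        rw [this, Nat.cast_sub (by omega), abs_sub_comm]
        refine le_trans ?_ (le_abs_self _)
        linarith
      refine ENNReal.ofReal_le_ofReal ?_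
      gcongr
    · refine le_trans (ENNReal.tsum_le_tsum fun e => ?_) (tsum_inv_sq_le hw)
      have : (e : ℝ) ≤ |((e + (L + 1) : ℕ) : ℝ) - lam| := by
        refine le_trans ?_ (le_abs_self _)
        push_cast
        linarith
      refine ENNReal.ofReal_le_ofReal ?_
      gcongr
  calc _ ≤ ∑' α : ℕ, ENNReal.ofReal ((2 * lam) ^ d) *
        ENNReal.ofReal (((1 + |α - lam| / w) ^ 2)⁻¹) := by
        refine ENNReal.tsum_le_tsum fun α => ?_
        rw [← ENNReal.ofReal_mul (by positivity)]
        exact ENNReal.ofReal_le_ofReal (hpt α)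
    _ ≤ ENNReal.ofReal ((2 * lam) ^ d) * (ENNReal.ofReal (2 * w) + ENNReal.ofReal (2 * w)) := by
        rw [ENNReal.tsum_mul_left]
        gcongr
    _ = _ := by
        rw [← ENNReal.ofReal_add (by positivity) (by positivity),
          ← ENNReal.ofReal_mul (by positivity)]
        congr 1
        rw [mul_pow, pow_add]; ring

end TorusWeyl

/-! ### The smoothed cutoff and its distance from the sharp one -/

namespace TorusWeyl

open scoped FourierTransform SchwartzMap

/-- The mollifier whose primitive is the smoothed spectral cutoff at unit scale. -/
noncomputable def cutoffKernel (φ : ℝ → ℝ) (u : ℝ) : ℝ := (2 * π)⁻¹ * ∫ s, φ s * cos (u * s)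

/-- The odd primitive of `cutoffKernel`. -/
noncomputable def cutoffPrimitive (φ : ℝ → ℝ) (u : ℝ) : ℝ := ∫ v in (0 : ℝ)..u, cutoffKernel φ v

/-- The kernel is a rescaled real part of the Fourier transform of `φ`, so it inherits Schwartz
decay; its total mass is read off from Fourier inversion at the origin. -/
theorem exists_schwartz_cutoffKernel {φ : ℝ → ℝ} (hφ : ContDiff ℝ ∞ φ)
    (hc : HasCompactSupport φ) :
    ∃ ψ : 𝓢(ℝ, ℂ), (∀ u, cutoffKernel φ u = (2 * π)⁻¹ * (ψ ((2 * π)⁻¹ * u)).re) ∧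
      ∫ u, ψ u = φ 0 := by
  have hc' : HasCompactSupport (fun s => (φ s : ℂ)) := hc.comp_left (g := Complex.ofReal) rfl
  have hs' : ContDiff ℝ ∞ (fun s => (φ s : ℂ)) := Complex.ofRealCLM.contDiff.comp hφ
  set Φ : 𝓢(ℝ, ℂ) := hc'.toSchwartzMap hs' with hΦ
  have hΦe : ∀ s, Φ s = φ s := fun s => rfl
  refine ⟨𝓕 Φ, fun u => ?_, ?_⟩
  · rw [cutoffKernel]
    congr 1
    rw [SchwartzMap.fourier_coe, Real.fourier_real_eq_integral_exp_smul]
    have hint : Integrable fun s : ℝ =>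
        Complex.exp ((-2 * π * s * ((2 * π)⁻¹ * u) : ℝ) * Complex.I) • Φ s := by
      refine (Φ.integrable (μ := volume)).norm.mono' ?_ (Filter.Eventually.of_forall fun s => ?_)
      · exact Continuous.aestronglyMeasurable (by fun_prop)
      · rw [norm_smul, Complex.norm_exp_ofReal_mul_I, one_mul]
    have := (integral_re hint)
    simp only [RCLike.re_to_complex] at this
    rw [← this]
    refine integral_congr_ae (Filter.Eventually.of_forall fun s => ?_)
    have e : -2 * π * s * ((2 * π)⁻¹ * u) = -(u * s) := by field_simp
    simp only [hΦe, e, smul_eq_mul]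
    rw [Complex.re_mul_ofReal, Complex.exp_ofReal_mul_I_re, Real.cos_neg, mul_comm]
  · have h1 : 𝓕⁻ (𝓕 Φ) = Φ := FourierTransform.fourierInv_fourier_eq Φ
    have h2 : (𝓕⁻ (𝓕 Φ)) 0 = (φ 0 : ℂ) := by rw [h1, hΦe]
    rw [← h2, SchwartzMap.fourierInv_coe, Real.fourierInv_eq]
    simp

theorem cutoffKernel_neg (φ : ℝ → ℝ) (u : ℝ) : cutoffKernel φ (-u) = cutoffKernel φ u := by
  simp [cutoffKernel]

section
variable {φ : ℝ → ℝ} (hφ : ContDiff ℝ ∞ φ) (hc : HasCompactSupport φ)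
include hφ hc

theorem contDiff_cutoffKernel : ContDiff ℝ ∞ (cutoffKernel φ) := by
  obtain ⟨ψ, h1, -⟩ := exists_schwartz_cutoffKernel hφ hc
  rw [show cutoffKernel φ = _ from funext h1]
  have := ψ.smooth ⊤
  exact contDiff_const.mul (Complex.reCLM.contDiff.comp (this.comp (contDiff_const.mul contDiff_id)))

theorem abs_cutoffKernel_le (N : ℕ) :
    ∃ C : ℝ, 0 < C ∧ ∀ u, |cutoffKernel φ u| ≤ C * ((1 + |u|) ^ N)⁻¹ := by
  obtain ⟨ψ, h1, -⟩ := exists_schwartz_cutoffKernel hφ hc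
  set D := 2 ^ N * ((Finset.Iic (N, 0)).sup fun m => SchwartzMap.seminorm ℝ m.1 m.2) ψ
  have hD : ∀ x, (1 + ‖x‖) ^ N * ‖ψ x‖ ≤ D := fun x => by
    have := SchwartzMap.one_add_le_sup_seminorm_apply (𝕜 := ℝ) (m := (N, 0)) (k := N) (n := 0)
      le_rfl le_rfl ψ x
    rwa [norm_iteratedFDeriv_zero] at this
  have hp : (1 : ℝ) ≤ 2 * π := by linarith [Real.two_le_pi]
  have hp0 : (0 : ℝ) < 2 * π := by linarith
  have hD0 : 0 ≤ D := le_trans (by positivity) (hD 0)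
  refine ⟨(2 * π) ^ N * D + 1, by positivity, fun u => ?_⟩
  rw [h1, ← div_eq_mul_inv, le_div_iff₀ (by positivity), abs_mul, abs_of_pos (inv_pos.2 hp0)]
  have hre := Complex.abs_re_le_norm (ψ ((2 * π)⁻¹ * u))
  have hu : (1 + |u|) ≤ 2 * π * (1 + ‖(2 * π)⁻¹ * u‖) := by
    rw [Real.norm_eq_abs, abs_mul, abs_of_pos (inv_pos.2 hp0)]
    have : 2 * π * (1 + (2 * π)⁻¹ * |u|) = 2 * π + |u| := by field_simp
    linarith
  calc (2 * π)⁻¹ * |(ψ ((2 * π)⁻¹ * u)).re| * (1 + |u|) ^ N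
      ≤ 1 * ‖ψ ((2 * π)⁻¹ * u)‖ * (2 * π * (1 + ‖(2 * π)⁻¹ * u‖)) ^ N := by
        gcongr
        exact inv_le_one_of_one_le₀ hp
    _ = (2 * π) ^ N * ((1 + ‖(2 * π)⁻¹ * u‖) ^ N * ‖ψ ((2 * π)⁻¹ * u)‖) := by
        rw [mul_pow]; ring
    _ ≤ (2 * π) ^ N * D := by gcongr; exact hD _
    _ ≤ _ := by linarith

theorem integrable_cutoffKernel : Integrable (cutoffKernel φ) := by
  obtain ⟨ψ, h1, -⟩ := exists_schwartz_cutoffKernel hφ hc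
  rw [show cutoffKernel φ = _ from funext h1]
  exact (((ψ.integrable (μ := volume)).comp_mul_left' (R := (2 * π)⁻¹) (by positivity)).re).const_mul _

theorem integral_cutoffKernel : ∫ u, cutoffKernel φ u = φ 0 := by
  obtain ⟨ψ, h1, h2⟩ := exists_schwartz_cutoffKernel hφ hc
  rw [show cutoffKernel φ = _ from funext h1, integral_const_mul,
    Measure.integral_comp_mul_left (fun x => (ψ x).re) ((2 * π)⁻¹)]
  have := integral_re (ψ.integrable (μ := volume))
  simp only [RCLike.re_to_complex] at this
  rw [this, h2, Complex.ofReal_re, inv_inv, abs_of_pos two_pi_pos, smul_eq_mul]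
  field_simp

omit hφ hc in
theorem cutoffPrimitive_neg (u : ℝ) : cutoffPrimitive φ (-u) = -cutoffPrimitive φ u := by
  rw [cutoffPrimitive, cutoffPrimitive, intervalIntegral.integral_symm]
  have := intervalIntegral.integral_comp_neg (a := 0) (b := u) (cutoffKernel φ)
  rw [neg_zero] at this
  rw [← this]
  simp_rw [cutoffKernel_neg]

theorem hasDerivAt_cutoffPrimitive (u : ℝ) :
    HasDerivAt (cutoffPrimitive φ) (cutoffKernel φ u) u :=
  have h := (contDiff_cutoffKernel hφ hc).continuous
  intervalIntegral.integral_hasDerivAt_right (h.intervalIntegrable _ _)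
    (h.stronglyMeasurableAtFilter _ _) h.continuousAt

/-- The even kernel has mass `φ 0 = 1`, hence mass `1/2` on the half line. The difference is a tail
integral, for which two spare powers of decay supply the integrable factor `1/(1+v²)`. -/
theorem abs_cutoffPrimitive_sub_le (h0 : φ 0 = 1) (N : ℕ) :
    ∃ C : ℝ, 0 < C ∧ ∀ u, 0 ≤ u → |cutoffPrimitive φ u - 1 / 2| ≤ C * ((1 + u) ^ N)⁻¹ := by
  obtain ⟨C, hC, hb⟩ := abs_cutoffKernel_le hφ hc (N + 2)
  have hint := integrable_cutoffKernel hφ hc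
  have hhalf : ∫ v in Set.Ioi 0, cutoffKernel φ v = 1 / 2 := by
    have h1 := integral_comp_abs (f := cutoffKernel φ)
    have h2 : (fun x => cutoffKernel φ |x|) = cutoffKernel φ := by
      funext x
      rcases abs_choice x with h | h <;> rw [h]
      rw [cutoffKernel_neg]
    rw [h2, integral_cutoffKernel hφ hc, h0] at h1
    linarith
  refine ⟨C * π, by positivity, fun u hu => ?_⟩
  have hsplit : cutoffPrimitive φ u - 1 / 2 = -∫ v in Set.Ioi u, cutoffKernel φ v := by
    rw [← hhalf, cutoffPrimitive,
      ← intervalIntegral.integral_interval_add_Ioi (hint.integrableOn) (hint.integrableOn)]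
    ring
  rw [hsplit, abs_neg]
  have hdom : Integrable fun v : ℝ => C * ((1 + u) ^ N)⁻¹ * (1 + v ^ 2)⁻¹ :=
    integrable_inv_one_add_sq.const_mul _
  calc |∫ v in Set.Ioi u, cutoffKernel φ v|
      ≤ ∫ v in Set.Ioi u, C * ((1 + u) ^ N)⁻¹ * (1 + v ^ 2)⁻¹ := by
        refine norm_integral_le_of_norm_le (f := cutoffKernel φ) hdom.integrableOn ?_
        filter_upwards [ae_restrict_mem measurableSet_Ioi] with v hv
        have hv' : u < v := hv
        have hv0 : 0 < v := by linarith
        refine (hb v).trans ?_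
        rw [mul_assoc, ← mul_inv, abs_of_pos hv0, pow_add]
        gcongr
        nlinarith
    _ ≤ ∫ v : ℝ, C * ((1 + u) ^ N)⁻¹ * (1 + v ^ 2)⁻¹ :=
        setIntegral_le_integral hdom (Filter.Eventually.of_forall fun v => by positivity)
    _ = _ := by
        rw [integral_const_mul, integral_univ_inv_one_add_sq]; ring

/-- Fubini, with `sin(us)/s` written as the integral of `cos(vs)` over `v` from `0` to `u`. -/
theorem integral_mul_sin_div (u : ℝ) :
    ∫ s, φ s * (sin (u * s) / s) = 2 * π * cutoffPrimitive φ u := by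
  have hi : Integrable φ := hφ.continuous.integrable_of_hasCompactSupport hc
  have hswap := intervalIntegral_integral_swap (a := 0) (b := u) (μ := (volume : Measure ℝ))
    (f := fun v s => φ s * cos (v * s)) (by
      have hfin : IsFiniteMeasure (volume.restrict (Set.uIoc 0 u)) := by
        rw [Set.uIoc]; infer_instance
      have : Integrable (fun p : ℝ × ℝ => (1 : ℝ) * φ p.2)
          ((volume.restrict (Set.uIoc 0 u)).prod volume) :=
        Integrable.mul_prod (integrable_const _) hi
      refine this.norm.mono' ?_ (Filter.Eventually.of_forall fun p => ?_)
      · have := hφ.continuous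
        exact Continuous.aestronglyMeasurable (by fun_prop)
      · simp only [Function.uncurry, norm_mul, one_mul]
        exact mul_le_of_le_one_right (norm_nonneg _) (abs_cos_le_one _))
  have h1 : ∫ v in (0 : ℝ)..u, ∫ s, φ s * cos (v * s) = 2 * π * cutoffPrimitive φ u := by
    rw [cutoffPrimitive, ← intervalIntegral.integral_const_mul]
    refine intervalIntegral.integral_congr fun v _ => ?_
    simp only [cutoffKernel]
    field_simp
  rw [← h1, hswap]
  refine integral_congr_ae ?_
  have hne : ∀ᵐ s : ℝ, s ≠ 0 := by
    simp [ae_iff]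
  filter_upwards [hne] with s hs
  rw [intervalIntegral.integral_const_mul, intervalIntegral.integral_comp_mul_right cos hs]
  simp [div_eq_inv_mul]

theorem integrable_mul_sin_div (u : ℝ) : Integrable fun s => φ s * (sin (u * s) / s) := by
  have hi : Integrable φ := hφ.continuous.integrable_of_hasCompactSupport hc
  refine (hi.norm.const_mul |u|).mono' ?_ (Filter.Eventually.of_forall fun s => ?_)
  · have := hφ.continuous.measurable
    exact Measurable.aestronglyMeasurable (by fun_prop)
  · rw [norm_mul, mul_comm]
    gcongr
    rw [norm_div, Real.norm_eq_abs, Real.norm_eq_abs]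
    refine div_le_of_le_mul₀ (abs_nonneg _) (abs_nonneg _) ?_
    rw [← abs_mul]
    exact Real.abs_sin_le_abs

/-- The product-to-sum formula for `sin(λt) cos(tτ)` exhibits the cutoff as two smoothed steps at
`∓λ`, at the scale `w = λ^{1-η-ε}`. -/
theorem cutoff_eq (η ε lam τ : ℝ) (hw : 0 < lam ^ (1 - η - ε)) :
    cutoff φ η ε lam τ = cutoffPrimitive φ ((lam + τ) / lam ^ (1 - η - ε)) +
      cutoffPrimitive φ ((lam - τ) / lam ^ (1 - η - ε)) := by
  rw [cutoff]
  set w := lam ^ (1 - η - ε)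
  have hscale : ∀ a : ℝ, Integrable (fun t => φ (t * w) * (sin (a * t) / t)) ∧
      ∫ t, φ (t * w) * (sin (a * t) / t) = 2 * π * cutoffPrimitive φ (a / w) := by
    intro a
    have he : ∀ t, φ (t * w) * (sin (a * t) / t) =
        w * (fun s => φ s * (sin (a / w * s) / s)) (t * w) := by
      intro t
      have : a / w * (t * w) = a * t := by field_simp
      simp only [this]
      -- At `t = 0` both sides vanish, because division by zero returns zero.
      rcases eq_or_ne t 0 with rfl | ht
      · simp
      · field_simp
    simp_rw [he]
    refine ⟨((integrable_mul_sin_div hφ hc (a / w)).comp_mul_right' hw.ne').const_mul _, ?_⟩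
    rw [integral_const_mul, Measure.integral_comp_mul_right (fun s => φ s * (sin (a / w * s) / s)),
      integral_mul_sin_div hφ hc, abs_of_pos (inv_pos.2 hw), smul_eq_mul]
    field_simp
  have hpt : ∀ t, φ (t * w) * (sin (lam * t) / t) * cos (t * τ) =
      1 / 2 * (φ (t * w) * (sin ((lam + τ) * t) / t) + φ (t * w) * (sin ((lam - τ) * t) / t)) := by
    intro t
    have : sin ((lam + τ) * t) + sin ((lam - τ) * t) = 2 * (sin (lam * t) * cos (t * τ)) := by
      rw [add_mul, sub_mul, sin_add, sin_sub, mul_comm t τ]; ring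
    rw [← mul_add, ← add_div, this]; ring
  simp_rw [hpt]
  rw [integral_const_mul, integral_add (hscale _).1 (hscale _).1, (hscale _).2, (hscale _).2]
  field_simp

theorem hasDerivAt_cutoff (η ε lam τ : ℝ) (hw : 0 < lam ^ (1 - η - ε)) :
    HasDerivAt (cutoff φ η ε lam)
      ((cutoffKernel φ ((lam + τ) / lam ^ (1 - η - ε)) -
        cutoffKernel φ ((lam - τ) / lam ^ (1 - η - ε))) / lam ^ (1 - η - ε)) τ := by
  rw [show cutoff φ η ε lam = _ from funext fun τ => cutoff_eq hφ hc η ε lam τ hw]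
  set w := lam ^ (1 - η - ε)
  have h1 : HasDerivAt (fun τ => (lam + τ) / w) (1 / w) τ :=
    ((hasDerivAt_id τ).const_add lam).div_const w
  have h2 : HasDerivAt (fun τ => (lam - τ) / w) (-1 / w) τ :=
    ((hasDerivAt_id τ).const_sub lam).div_const w
  exact (((hasDerivAt_cutoffPrimitive hφ hc _).comp τ h1).add
    ((hasDerivAt_cutoffPrimitive hφ hc _).comp τ h2)).congr_deriv (by ring)

/-- The constant depends on `φ` and `N` only. Each derivative of the cutoff brings a factor `1/w ≤
1`, which is discarded. -/
theorem exists_cutoff_bounds (h0 : φ 0 = 1) (N : ℕ) : ∃ C : ℝ, 0 < C ∧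
    ∀ η ε lam : ℝ, 0 ≤ lam → 1 ≤ lam ^ (1 - η - ε) →
      (∀ τ, 0 ≤ τ → |cutoff φ η ε lam τ - if τ ≤ lam then 1 else 0| ≤
        C * decay N (lam ^ (1 - η - ε)) lam τ) ∧
      Differentiable ℝ (cutoff φ η ε lam) ∧
      (∀ τ, 0 ≤ τ → |deriv (cutoff φ η ε lam) τ| ≤ C * decay N (lam ^ (1 - η - ε)) lam τ) ∧
      |iteratedDeriv 2 (cutoff φ η ε lam) 0| ≤ C := by
  obtain ⟨C₁, hC₁, hG⟩ := abs_cutoffPrimitive_sub_le hφ hc h0 N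
  obtain ⟨C₂, hC₂, hg⟩ := abs_cutoffKernel_le hφ hc N
  obtain ⟨C₃, hC₃⟩ : ∃ C, ∀ u, |deriv (cutoffKernel φ) u| ≤ C := by
    obtain ⟨ψ, h1, -⟩ := exists_schwartz_cutoffKernel hφ hc
    obtain ⟨D, -, hD⟩ := ψ.decay 0 1
    refine ⟨(2 * π)⁻¹ * ((2 * π)⁻¹ * D), fun u => ?_⟩
    have hd : HasDerivAt (fun u => ψ ((2 * π)⁻¹ * u)) ((2 * π)⁻¹ • deriv ψ ((2 * π)⁻¹ * u)) u := by
      have := HasDerivAt.scomp u (ψ.differentiableAt.hasDerivAt (x := (2 * π)⁻¹ * u))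
        ((hasDerivAt_id u).const_mul (2 * π)⁻¹)
      rw [mul_one] at this
      exact this
    have hd2 := (Complex.reCLM.hasFDerivAt.comp_hasDerivAt u hd).const_mul (2 * π)⁻¹
    have hfun : cutoffKernel φ = fun u => (2 * π)⁻¹ * (ψ ((2 * π)⁻¹ * u)).re := funext h1
    have hd3 := hd2
    change HasDerivAt (fun u => (2 * π)⁻¹ * (ψ ((2 * π)⁻¹ * u)).re) _ u at hd3
    rw [← hfun] at hd3
    have hp := two_pi_pos
    rw [hd3.deriv, abs_mul, abs_of_pos (inv_pos.2 hp)]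
    gcongr
    refine (Complex.abs_re_le_norm _).trans ?_
    rw [norm_smul, Real.norm_eq_abs, abs_of_pos (inv_pos.2 hp)]
    gcongr
    have := hD ((2 * π)⁻¹ * u)
    rwa [pow_zero, one_mul, norm_iteratedFDeriv_eq_norm_iteratedDeriv, iteratedDeriv_one] at this
  have hC₃0 : 0 ≤ C₃ := le_trans (abs_nonneg _) (hC₃ 0)
  refine ⟨2 * C₁ + 2 * C₂ + 2 * C₃, by positivity, fun η ε lam hlam hw => ?_⟩
  have hw0 : 0 < lam ^ (1 - η - ε) := by linarith
  have hder := fun τ => hasDerivAt_cutoff hφ hc η ε lam τ hw0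
  have hval := fun τ => cutoff_eq hφ hc η ε lam τ hw0
  set w := lam ^ (1 - η - ε)
  have hdec : ∀ τ, 0 ≤ decay N w lam τ := fun τ => decay_nonneg N hw0.le lam τ
  have hplus : ∀ τ, 0 ≤ τ → ((1 + (lam + τ) / w) ^ N)⁻¹ ≤ decay N w lam τ := by
    intro τ hτ
    rw [decay]
    gcongr
    rw [abs_le]
    constructor <;> linarith
  -- By oddness the primitive approaches `±1/2` on both sides. The `1/2` from the step at `-λ` turns
  -- this into the values 1 and 0.
  have hG' : ∀ u, |cutoffPrimitive φ u - if 0 ≤ u then 1 / 2 else -(1 / 2)| ≤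
      C₁ * ((1 + |u|) ^ N)⁻¹ := by
    intro u
    split_ifs with hu
    · rw [abs_of_nonneg hu]; exact hG u hu
    · push Not at hu
      have := hG (-u) (by linarith)
      rw [abs_of_neg hu]
      rw [cutoffPrimitive_neg, ← abs_neg] at this
      convert this using 2
      ring
  refine ⟨fun τ hτ => ?_, fun τ => (hder τ).differentiableAt, fun τ hτ => ?_, ?_⟩
  · rw [hval]
    have h1 := hG ((lam + τ) / w) (by positivity)
    have h2 := hG' ((lam - τ) / w)
    have hE : ((1 + |(lam - τ) / w|) ^ N)⁻¹ = decay N w lam τ := by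
      rw [decay, abs_div, abs_of_pos hw0, abs_sub_comm]
    rw [hE] at h2
    have h3 := hplus τ hτ
    have h4 : |cutoffPrimitive φ ((lam + τ) / w) - 1 / 2| ≤ C₁ * decay N w lam τ :=
      h1.trans (by gcongr)
    have hiff : (0 ≤ (lam - τ) / w) ↔ τ ≤ lam := by
      rw [le_div_iff₀ hw0]; constructor <;> intro h <;> linarith
    simp only [hiff] at h2
    have hd := hdec τ
    calc _ ≤ C₁ * decay N w lam τ + C₁ * decay N w lam τ := by
          refine le_trans ?_ ((abs_add_le _ _).trans (add_le_add h4 h2))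
          apply le_of_eq
          congr 1
          split_ifs <;> ring
      _ ≤ _ := by nlinarith [mul_nonneg hC₂.le hd, mul_nonneg hC₃0 hd]
  · rw [(hder τ).deriv, abs_div, abs_of_pos hw0]
    refine (div_le_self (abs_nonneg _) hw).trans ?_
    have h1 := hg ((lam + τ) / w)
    have h2 := hg ((lam - τ) / w)
    rw [abs_of_nonneg (by positivity : 0 ≤ (lam + τ) / w)] at h1
    have hE : ((1 + |(lam - τ) / w|) ^ N)⁻¹ = decay N w lam τ := by
      rw [decay, abs_div, abs_of_pos hw0, abs_sub_comm]
    rw [hE] at h2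
    have h4 : |cutoffKernel φ ((lam + τ) / w)| ≤ C₂ * decay N w lam τ :=
      h1.trans (by gcongr; exact hplus τ hτ)
    have hd := hdec τ
    calc _ ≤ C₂ * decay N w lam τ + C₂ * decay N w lam τ :=
          (abs_sub _ _).trans (add_le_add h4 h2)
      _ ≤ _ := by nlinarith [mul_nonneg hC₁.le hd, mul_nonneg hC₃0 hd]
  · rw [iteratedDeriv_succ, iteratedDeriv_one, show deriv (cutoff φ η ε lam) = _ from
      funext fun τ => (hder τ).deriv]
    have hk : Differentiable ℝ (cutoffKernel φ) :=
      (contDiff_cutoffKernel hφ hc).differentiable (by simp)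
    have h1 : HasDerivAt (fun τ => (lam + τ) / w) (1 / w) 0 :=
      ((hasDerivAt_id (0 : ℝ)).const_add lam).div_const w
    have h2 : HasDerivAt (fun τ => (lam - τ) / w) (-1 / w) 0 :=
      ((hasDerivAt_id (0 : ℝ)).const_sub lam).div_const w
    have h3 := ((((hk _).hasDerivAt.comp 0 h1).sub ((hk _).hasDerivAt.comp 0 h2)).div_const w).deriv
    simp only [Function.comp_def] at h3
    have h4 : deriv (fun τ => (cutoffKernel φ ((lam + τ) / w) -
      cutoffKernel φ ((lam - τ) / w)) / w) 0 = _ := h3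
    rw [h4, abs_div, abs_of_pos hw0]
    refine (div_le_self (abs_nonneg _) hw).trans ((abs_sub _ _).trans ?_)
    have hw1 : |1 / w| ≤ 1 := by
      rw [abs_of_pos (by positivity), div_le_one hw0]; exact hw
    have hw2 : |-1 / w| ≤ 1 := by rw [neg_div, abs_neg]; exact hw1
    rw [abs_mul, abs_mul]
    have h5 : |deriv (cutoffKernel φ) ((lam + 0) / w)| * |1 / w| ≤ C₃ * 1 := by
      gcongr; exact hC₃ _
    have h6 : |deriv (cutoffKernel φ) ((lam - 0) / w)| * |-1 / w| ≤ C₃ * 1 := by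
      gcongr; exact hC₃ _
    linarith

end

end TorusWeyl

/-! ### Finite differences of a cut-off radial power -/

namespace TorusWeyl

open scoped FourierTransform

/-- Induction through the mean value inequality. Working with a whole chain `g k` of successive
derivatives lets the hypothesis pass to the differenced chain, on an interval shorter by `h`. -/
theorem abs_fwdDiff_iter_le (n : ℕ) : ∀ {g : ℕ → ℝ → ℝ} {a b h M : ℝ}, 0 ≤ h → a + n * h ≤ b →
    (∀ k, ∀ t ∈ Set.Icc a b, HasDerivAt (g k) (g (k + 1) t) t) →
    (∀ t ∈ Set.Icc a b, |g n t| ≤ M) → |(fwdDiff h)^[n] (g 0) a| ≤ h ^ n * M := by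
  induction n with
  | zero =>
    intro g a b h M _ hb _ hM
    simpa using hM a ⟨le_rfl, by simpa using hb⟩
  | succ n ih =>
    intro g a b h M hh hb hd hM
    push_cast at hb
    rw [Function.iterate_succ_apply]
    have hsub : ∀ t ∈ Set.Icc a (b - h), t ∈ Set.Icc a b ∧ t + h ∈ Set.Icc a b := by
      intro t ht
      exact ⟨⟨ht.1, by linarith [ht.2]⟩, ⟨by linarith [ht.1], by linarith [ht.2]⟩⟩
    have := ih (g := fun k => fwdDiff h (g k)) (a := a) (b := b - h) (M := h * M) hh (by linarith)
      (fun k t ht => by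
        have h1 := (hd k (t + h) (hsub t ht).2).comp_add_const t h
        exact h1.sub (hd k t (hsub t ht).1))
      (fun t ht => by
        have hmv := Convex.norm_image_sub_le_of_norm_hasDerivWithin_le (f := g n)
          (f' := g (n + 1)) (C := M) (s := Set.Icc a b) (x := t) (y := t + h)
          (fun x hx => (hd n x hx).hasDerivWithinAt) (fun x hx => hM x hx) (convex_Icc a b)
          (hsub t ht).1 (hsub t ht).2
        rw [Real.norm_eq_abs, Real.norm_eq_abs, add_sub_cancel_left, abs_of_nonneg hh] at hmv
        rw [fwdDiff, mul_comm]
        exact hmv)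
    rwa [← mul_assoc, ← pow_succ] at this

/-- Iterated derivatives with respect to the last of three variables. -/
noncomputable def lastDeriv (F : ℝ × ℝ × ℝ → ℝ) : ℕ → ℝ × ℝ × ℝ → ℝ
  | 0 => F
  | k + 1 => fun q => fderiv ℝ (lastDeriv F k) q (0, 0, 1)

theorem contDiffOn_lastDeriv {F : ℝ × ℝ × ℝ → ℝ} {U : Set (ℝ × ℝ × ℝ)} (hU : IsOpen U)
    (hF : ContDiffOn ℝ ∞ F U) (k : ℕ) : ContDiffOn ℝ ∞ (lastDeriv F k) U := by
  induction k with
  | zero => exact hF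
  | succ k ih => exact (ih.fderiv_of_isOpen hU (by simp)).clm_apply contDiffOn_const

theorem hasDerivAt_lastDeriv {F : ℝ × ℝ × ℝ → ℝ} {U : Set (ℝ × ℝ × ℝ)} (hU : IsOpen U)
    (hF : ContDiffOn ℝ ∞ F U) (k : ℕ) {κ a t : ℝ} (h : (κ, a, t) ∈ U) :
    HasDerivAt (fun t => lastDeriv F k (κ, a, t)) (lastDeriv F (k + 1) (κ, a, t)) t := by
  have h1 : DifferentiableAt ℝ (lastDeriv F k) (κ, a, t) :=
    ((contDiffOn_lastDeriv hU hF k).contDiffAt (hU.mem_nhds h)).differentiableAt (by simp)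
  have h2 : HasDerivAt (fun t : ℝ => ((κ, a, t) : ℝ × ℝ × ℝ)) (0, 0, 1) t :=
    (hasDerivAt_const t κ).prodMk ((hasDerivAt_const t a).prodMk (hasDerivAt_id t))
  exact h1.hasFDerivAt.comp_hasDerivAt t h2

/-- A rescaled radial profile along a line: distance `√(1 + 2at + t²)` from the origin. -/
noncomputable def lineProfile (ρ : ℝ → ℝ) (p : ℝ) (q : ℝ × ℝ × ℝ) : ℝ :=
  ρ (q.1 * √(1 + 2 * q.2.1 * q.2.2 + q.2.2 ^ 2)) *
    (1 + 2 * q.2.1 * q.2.2 + q.2.2 ^ 2) ^ (-p / 2)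

theorem contDiffOn_lineProfile {ρ : ℝ → ℝ} (hρ : ContDiff ℝ ∞ ρ) (p : ℝ) :
    ContDiffOn ℝ ∞ (lineProfile ρ p) {q | 0 < 1 + 2 * q.2.1 * q.2.2 + q.2.2 ^ 2} := by
  intro q hq
  have hq' : 0 < 1 + 2 * q.2.1 * q.2.2 + q.2.2 ^ 2 := hq
  have h1 : ContDiffAt ℝ ∞ (fun q : ℝ × ℝ × ℝ => 1 + 2 * q.2.1 * q.2.2 + q.2.2 ^ 2) q := by
    fun_prop
  have h2 : ContDiffAt ℝ ∞ (fun q : ℝ × ℝ × ℝ => q.1) q := by fun_prop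
  exact ((hρ.contDiffAt.comp q (h2.mul (h1.sqrt hq'.ne'))).mul
    (h1.rpow_const_of_ne hq'.ne')).contDiffWithinAt

/-- Uniformity in `κ` and `a` comes from compactness of the parameter box: the `n`-th derivative in
`t` is continuous there. -/
theorem exists_fwdDiff_lineProfile_le {ρ : ℝ → ℝ} (hρ : ContDiff ℝ ∞ ρ) (p : ℝ) (n : ℕ) :
    ∃ C : ℝ, 0 < C ∧ ∀ κ ∈ Set.Icc 0 (2 * π), ∀ a ∈ Set.Icc (-1 : ℝ) 1, ∀ h : ℝ, 0 ≤ h →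
      n * h ≤ 1 / 4 → |(fwdDiff h)^[n] (fun t => lineProfile ρ p (κ, a, t)) 0| ≤ h ^ n * C := by
  set U : Set (ℝ × ℝ × ℝ) := {q | 0 < 1 + 2 * q.2.1 * q.2.2 + q.2.2 ^ 2} with hUdef
  have hU : IsOpen U := isOpen_lt continuous_const (by fun_prop)
  have hF := contDiffOn_lineProfile hρ p
  set K : Set (ℝ × ℝ × ℝ) := Set.Icc 0 (2 * π) ×ˢ Set.Icc (-1 : ℝ) 1 ×ˢ Set.Icc (0 : ℝ) (1 / 4)
  have hK : IsCompact K := isCompact_Icc.prod (isCompact_Icc.prod isCompact_Icc)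
  have hKU : K ⊆ U := by
    rintro ⟨κ, a, t⟩ ⟨-, ha, ht⟩
    simp only [hUdef, Set.mem_ofPred_eq]
    simp only [Set.mem_Icc] at ha ht
    -- For `a ≥ -1` and `t ≥ 0` the expression is at least `(1-t)²`, positive since `t ≤ 1/4`.
    nlinarith [mul_nonneg ht.1 (by linarith [ha.1] : 0 ≤ a + 1), sq_nonneg (1 - t)]
  obtain ⟨C, hC⟩ := hK.exists_bound_of_continuousOn
    ((contDiffOn_lastDeriv hU hF n).continuousOn.mono hKU)
  refine ⟨|C| + 1, by positivity, fun κ hκ a ha h hh hn => ?_⟩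
  refine abs_fwdDiff_iter_le n (g := fun k t => lastDeriv (lineProfile ρ p) k (κ, a, t))
    (b := 1 / 4) hh (by linarith) (fun k t ht => ?_) (fun t ht => ?_)
  · exact hasDerivAt_lastDeriv hU hF k (hKU ⟨hκ, ha, ht⟩)
  · exact (hC _ ⟨hκ, ha, ht⟩).trans ((le_abs_self C).trans (by linarith))

section
variable {V : Type*} [NormedAddCommGroup V]

/-- The radial function `ρ(δ|x|) |x|^{-p}`. -/
noncomputable def radialPow (ρ : ℝ → ℝ) (p δ : ℝ) (x : V) : ℂ :=
  ((ρ (δ * ‖x‖) * ‖x‖ ^ (-p) : ℝ) : ℂ)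

variable [InnerProductSpace ℝ V]

theorem norm_add_smul_eq {x e : V} (hx : x ≠ 0) (he : ‖e‖ = 1) (c : ℝ) :
    ‖x + c • e‖ = ‖x‖ * √(1 + 2 * (inner ℝ x e / ‖x‖) * (c / ‖x‖) + (c / ‖x‖) ^ 2) := by
  have hR : 0 < ‖x‖ := norm_pos_iff.2 hx
  rw [← Real.sqrt_sq (norm_nonneg (x + c • e)), norm_add_sq_real, inner_smul_right, norm_smul, he,
    ← Real.sqrt_sq hR.le, ← Real.sqrt_mul (sq_nonneg _), Real.sqrt_sq hR.le, mul_one,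
    Real.norm_eq_abs, sq_abs]
  congr 1
  field_simp

/-- Scaling by `‖x‖` turns steps of length `1/2` into steps `1/(2‖x‖)` along a profile that is
smooth uniformly in direction and in `δ`. Each difference therefore gains a power of `‖x‖`. -/
theorem norm_fwdDiff_radialPow_le {ρ : ℝ → ℝ} (hρ : ContDiff ℝ ∞ ρ) (hs : ∀ r, π ≤ r → ρ r = 0)
    (p : ℝ) (n : ℕ) : ∃ C : ℝ, 0 < C ∧ ∀ δ : ℝ, 0 ≤ δ → ∀ e x : V, ‖e‖ = 1 →
      2 * n ≤ ‖x‖ → 1 ≤ ‖x‖ →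
      ‖(fwdDiff ((1 / 2 : ℝ) • e))^[n] (radialPow ρ p δ) x‖ ≤ C * ‖x‖ ^ (-(p + n)) := by
  obtain ⟨C, hC, hb⟩ := exists_fwdDiff_lineProfile_le hρ p n
  refine ⟨C, hC, fun δ hδ e x he hx hx1 => ?_⟩
  have hR : 0 < ‖x‖ := by linarith
  have hx0 : x ≠ 0 := norm_pos_iff.1 hR
  have hn0 : (0 : ℝ) ≤ n := Nat.cast_nonneg n
  by_cases hκ : δ * ‖x‖ ≤ 2 * π
  · set a := inner ℝ x e / ‖x‖ with ha
    have ha1 : a ∈ Set.Icc (-1 : ℝ) 1 := by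
      rw [Set.mem_Icc, ← abs_le, ha, abs_div, abs_norm, div_le_one hR]
      simpa [he] using abs_real_inner_le_norm x e
    have hval : ∀ k : ℕ, radialPow ρ p δ (x + k • (1 / 2 : ℝ) • e) =
        ((‖x‖ ^ (-p) * lineProfile ρ p (δ * ‖x‖, a, 0 + k • (1 / (2 * ‖x‖))) : ℝ) : ℂ) := by
      intro k
      have e1 : x + k • (1 / 2 : ℝ) • e = x + ((k : ℝ) * (1 / 2)) • e := by
        rw [mul_smul, Nat.cast_smul_eq_nsmul]
      have e2 : (0 : ℝ) + k • (1 / (2 * ‖x‖)) = (k : ℝ) * (1 / 2) / ‖x‖ := by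
        rw [zero_add, nsmul_eq_mul]; field_simp
      have hnn : 0 ≤ 1 + 2 * a * ((k : ℝ) * (1 / 2) / ‖x‖) + ((k : ℝ) * (1 / 2) / ‖x‖) ^ 2 := by
        have h1 := ha1.1
        have h2 := ha1.2
        nlinarith [sq_nonneg (a + (k : ℝ) * (1 / 2) / ‖x‖)]
      rw [e1, e2, radialPow, norm_add_smul_eq hx0 he, lineProfile]
      congr 1
      rw [Real.mul_rpow hR.le (Real.sqrt_nonneg _), Real.sqrt_eq_rpow, ← Real.rpow_mul hnn]
      have e3 : (1 / 2 : ℝ) * -p = -p / 2 := by ring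
      rw [e3, ← Real.sqrt_eq_rpow]
      ring_nf
    have heq : (fwdDiff ((1 / 2 : ℝ) • e))^[n] (radialPow ρ p δ) x =
        ((‖x‖ ^ (-p) * (fwdDiff (1 / (2 * ‖x‖)))^[n]
          (fun t => lineProfile ρ p (δ * ‖x‖, a, t)) 0 : ℝ) : ℂ) := by
      rw [fwdDiff_iter_eq_sum_shift, fwdDiff_iter_eq_sum_shift, Finset.mul_sum, Complex.ofReal_sum]
      refine Finset.sum_congr rfl fun k _ => ?_
      rw [hval, zsmul_eq_mul, zsmul_eq_mul]
      push_cast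
      ring
    rw [heq, Complex.norm_real, Real.norm_eq_abs, abs_mul, abs_of_nonneg (by positivity)]
    have h := hb (δ * ‖x‖) ⟨by positivity, hκ⟩ a ha1 (1 / (2 * ‖x‖)) (by positivity) (by
      rw [mul_one_div, div_le_div_iff₀ (by positivity) (by norm_num)]; linarith)
    calc _ ≤ ‖x‖ ^ (-p) * ((1 / (2 * ‖x‖)) ^ n * C) := by gcongr
      _ ≤ ‖x‖ ^ (-p) * ((1 / ‖x‖) ^ n * C) := by gcongr; linarith
      _ = _ := by
          rw [neg_add, Real.rpow_add hR, Real.rpow_neg hR.le n, Real.rpow_natCast, one_div, inv_pow]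
          ring
  -- Here every point used satisfies `‖x + k e/2‖ ≥ ‖x‖/2`, hence lies where `ρ` has been cut off.
  · push Not at hκ
    have hzero : (fwdDiff ((1 / 2 : ℝ) • e))^[n] (radialPow ρ p δ) x = 0 := by
      rw [fwdDiff_iter_eq_sum_shift]
      refine Finset.sum_eq_zero fun k hk => ?_
      have hk' : (k : ℝ) ≤ n := by exact_mod_cast Nat.lt_succ_iff.1 (Finset.mem_range.1 hk)
      have e1 : ‖k • (1 / 2 : ℝ) • e‖ = k / 2 := by
        rw [← Nat.cast_smul_eq_nsmul ℝ, norm_smul, norm_smul, he]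
        simp; ring
      have h1 : ‖x‖ - k / 2 ≤ ‖x + k • (1 / 2 : ℝ) • e‖ := by
        rw [← e1]
        have := norm_sub_le (x + k • (1 / 2 : ℝ) • e) (k • (1 / 2 : ℝ) • e)
        rw [add_sub_cancel_right] at this
        linarith
      have h2 : π ≤ δ * ‖x + k • (1 / 2 : ℝ) • e‖ := by
        have : ‖x‖ / 2 ≤ ‖x + k • (1 / 2 : ℝ) • e‖ := by linarith
        calc π ≤ δ * ‖x‖ / 2 := by linarith
          _ = δ * (‖x‖ / 2) := by ring
          _ ≤ _ := by gcongr
      rw [radialPow, hs _ h2]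
      simp
    rw [hzero, norm_zero]
    positivity

end

end TorusWeyl

/-! ### Fourier asymptotics of a cut-off radial power -/

namespace TorusWeyl

open scoped FourierTransform
open Filter Topology

section
variable {V : Type*} [NormedAddCommGroup V] [InnerProductSpace ℝ V] [FiniteDimensional ℝ V]
  [MeasurableSpace V] [BorelSpace V]

theorem integrableOn_ball_norm_rpow_neg [Nontrivial V] {q : ℝ}
    (hq : q < Module.finrank ℝ V) (r : ℝ) :
    IntegrableOn (fun x : V => ‖x‖ ^ (-q)) (Metric.ball 0 r) := by
  rw [integrableOn_fun_norm_addHaar volume (f := fun t : ℝ => t ^ (-q))]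
  rcases le_or_gt r 0 with hr | hr
  · rw [Set.Ioo_eq_empty (not_lt.2 hr)]; exact integrableOn_empty
  have hn : 1 ≤ Module.finrank ℝ V := Module.finrank_pos
  have h := (intervalIntegral.integrableOn_Ioo_rpow_iff (s := (Module.finrank ℝ V : ℝ) - 1 - q) hr).2
    (by linarith)
  refine h.congr_fun (fun t ht => ?_) measurableSet_Ioo
  have ht0 : 0 < t := ht.1
  simp only [smul_eq_mul]
  rw [← Real.rpow_natCast, ← Real.rpow_add ht0, Nat.cast_sub hn]
  simp [sub_eq_add_neg]

/-- The function `|x|^{-q}` cut off to a ball. -/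
noncomputable def ballPow (q r : ℝ) (x : V) : ℝ :=
  (Metric.ball (0 : V) r).indicator (fun x => ‖x‖ ^ (-q)) x

omit [InnerProductSpace ℝ V] [FiniteDimensional ℝ V] [MeasurableSpace V] [BorelSpace V] in
theorem ballPow_nonneg (q r : ℝ) (x : V) : 0 ≤ ballPow q r x :=
  Set.indicator_nonneg (fun _ _ => by positivity) x

omit [InnerProductSpace ℝ V] [FiniteDimensional ℝ V] [MeasurableSpace V] [BorelSpace V] in
theorem ballPow_of_lt (q : ℝ) {r : ℝ} {x : V} (h : ‖x‖ < r) : ballPow q r x = ‖x‖ ^ (-q) :=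
  Set.indicator_of_mem (by simpa using h) _

theorem integrable_ballPow [Nontrivial V] {q : ℝ} (hq : q < Module.finrank ℝ V) (r : ℝ) :
    Integrable (ballPow q r : V → ℝ) :=
  (integrable_indicator_iff measurableSet_ball).2 (integrableOn_ball_norm_rpow_neg hq r)

/-- Translation by half a unit vector `e` multiplies the transform at `e` by `e^{iπ} = -1`.
Differencing thus improves decay in `x` at the price of a nonzero constant factor. -/
theorem fourier_fwdDiff {f : V → ℂ} (hf : Integrable f) {e : V} (he : ‖e‖ = 1) :
    Integrable (fwdDiff ((1 / 2 : ℝ) • e) f) ∧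
      𝓕 (fwdDiff ((1 / 2 : ℝ) • e) f) e = -2 * 𝓕 f e := by
  set u := (1 / 2 : ℝ) • e with hu
  have hs : Integrable (fun x => f (x + u)) := hf.comp_add_right u
  refine ⟨hs.sub hf, ?_⟩
  have h1 : 𝓕 (fun x => f (x + u)) e = -𝓕 f e := by
    have := congrFun (VectorFourier.fourierIntegral_comp_add_right 𝐞 volume (innerₗ V) f u) e
    change 𝓕 (f ∘ fun v => v + u) e = 𝐞 (inner ℝ u e) • 𝓕 f e at this
    have hi : inner ℝ u e = 1 / 2 := by
      rw [hu, real_inner_smul_left, real_inner_self_eq_norm_sq, he]; norm_num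
    have hc : (𝐞 (1 / 2) : ℂ) = -1 := by
      rw [Real.fourierChar_apply]
      have : ((2 * π * (1 / 2) : ℝ) : ℂ) * Complex.I = π * Complex.I := by push_cast; ring
      rw [this, Complex.exp_pi_mul_I]
    rw [hi, Circle.smul_def, hc, neg_one_smul] at this
    exact this
  have h2 : 𝓕 (fwdDiff u f) e = 𝓕 (fun x => f (x + u)) e - 𝓕 f e := by
    simp only [Real.fourier_eq]
    rw [← integral_sub]
    · refine integral_congr_ae (Eventually.of_forall fun x => ?_)
      simp only [fwdDiff, smul_sub]
    · exact (Real.fourierIntegral_convergent_iff e).2 hs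
    · exact (Real.fourierIntegral_convergent_iff e).2 hf
  rw [h2, h1]; ring

theorem fourier_fwdDiff_iter {f : V → ℂ} (hf : Integrable f) {e : V} (he : ‖e‖ = 1) (n : ℕ) :
    Integrable ((fwdDiff ((1 / 2 : ℝ) • e))^[n] f) ∧
      𝓕 ((fwdDiff ((1 / 2 : ℝ) • e))^[n] f) e = (-2) ^ n * 𝓕 f e := by
  induction n with
  | zero => simpa using hf
  | succ n ih =>
    rw [Function.iterate_succ_apply']
    have := fourier_fwdDiff ih.1 he
    refine ⟨this.1, ?_⟩
    rw [this.2, ih.2, pow_succ]; ring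

variable {ρ : ℝ → ℝ} {p : ℝ}

omit [InnerProductSpace ℝ V] [FiniteDimensional ℝ V] in
theorem measurable_radialPow (hρ : Continuous ρ) (p δ : ℝ) :
    Measurable (radialPow ρ p δ : V → ℂ) := by
  have := hρ.measurable
  unfold radialPow
  fun_prop

omit [InnerProductSpace ℝ V] [FiniteDimensional ℝ V] [MeasurableSpace V] [BorelSpace V] in
theorem norm_radialPow_le {B : ℝ} (hB : ∀ r, |ρ r| ≤ B) (p δ : ℝ) (x : V) :
    ‖radialPow ρ p δ x‖ ≤ B * ‖x‖ ^ (-p) := by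
  rw [radialPow, Complex.norm_real, Real.norm_eq_abs, abs_mul,
    abs_of_nonneg (by positivity : 0 ≤ ‖x‖ ^ (-p))]
  gcongr
  exact hB _

theorem integrable_radialPow [Nontrivial V] (hρ : Continuous ρ) (hs : ∀ r, π ≤ r → ρ r = 0)
    {B : ℝ} (hB : ∀ r, |ρ r| ≤ B) (hp : p < Module.finrank ℝ V) {δ : ℝ} (hδ : 0 < δ) :
    Integrable (radialPow ρ p δ : V → ℂ) := by
  have hB0 : 0 ≤ B := (abs_nonneg _).trans (hB 0)
  refine ((integrable_ballPow (V := V) hp (π / δ)).const_mul B).mono'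
    (measurable_radialPow hρ p δ).aestronglyMeasurable (Eventually.of_forall fun x => ?_)
  by_cases hx : ‖x‖ < π / δ
  · rw [ballPow_of_lt _ hx]
    exact norm_radialPow_le hB p δ x
  · push Not at hx
    rw [radialPow, hs]
    · simpa using mul_nonneg hB0 (ballPow_nonneg p (π / δ) x)
    · rwa [div_le_iff₀' hδ] at hx

/-- The Fourier transform of `ρ(δ|x|) |x|^{-p}` at a unit vector is bounded and has a limit as
`δ → 0`. -/
theorem exists_tendsto_fourier_radialPow [Nontrivial V] (hρ : ContDiff ℝ ∞ ρ)
    (hs : ∀ r, π ≤ r → ρ r = 0) {B : ℝ} (hB : ∀ r, |ρ r| ≤ B) (hp0 : 0 < p)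
    (hp : p < Module.finrank ℝ V) {e : V} (he : ‖e‖ = 1) :
    ∃ (L : ℂ) (C : ℝ), (∀ δ > 0, ‖𝓕 (radialPow ρ p δ : V → ℂ) e‖ ≤ C) ∧
      Tendsto (fun δ => 𝓕 (radialPow ρ p δ : V → ℂ) e) (𝓝[>] 0) (𝓝 L) := by
  set n := Module.finrank ℝ V with hn
  set u := (1 / 2 : ℝ) • e with hu
  have hn1 : (1 : ℝ) ≤ n := by exact_mod_cast (Module.finrank_pos : 0 < Module.finrank ℝ V)
  have hB0 : 0 ≤ B := (abs_nonneg _).trans (hB 0)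
  obtain ⟨C, hC, hdiff⟩ := norm_fwdDiff_radialPow_le (V := V) hρ hs p n
  -- A majorant independent of `δ`. The sum covers the shifted singularities, integrable since `p <
  -- n`; the last term covers large `x`, where `n` differences give decay of order `p + n`, beyond
  -- the dimension `n`.
  set D : V → ℝ := fun x => (∑ k ∈ Finset.range (n + 1),
    (n.choose k : ℝ) * (B * ballPow p (3 * n) (x + k • u))) +
      C * (2 ^ (p + n) * (1 + ‖x‖) ^ (-(p + n))) with hD
  have hDint : Integrable D := by
    refine Integrable.add (integrable_finsetSum _ fun k _ => ?_) ?_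
    · exact (((integrable_ballPow hp _).comp_add_right (k • u)).const_mul B).const_mul _
    · exact ((integrable_one_add_norm (by linarith)).const_mul _).const_mul _
  have hbound : ∀ δ, 0 ≤ δ → ∀ x, ‖(fwdDiff u)^[n] (radialPow ρ p δ) x‖ ≤ D x := by
    intro δ hδ x
    have h1 : 0 ≤ ∑ k ∈ Finset.range (n + 1),
        (n.choose k : ℝ) * (B * ballPow p (3 * n) (x + k • u)) :=
      Finset.sum_nonneg fun k _ => mul_nonneg (by positivity)
        (mul_nonneg hB0 (ballPow_nonneg _ _ _))
    have h2 : 0 ≤ C * (2 ^ (p + n) * (1 + ‖x‖) ^ (-(p + n))) := by positivity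
    by_cases hx : 2 * n ≤ ‖x‖
    · have hx1 : 1 ≤ ‖x‖ := by linarith
      have hx0 : 0 < ‖x‖ := by linarith
      refine (hdiff δ hδ e x he hx hx1).trans ?_
      have h3 : ‖x‖ ^ (-(p + n)) ≤ 2 ^ (p + n) * (1 + ‖x‖) ^ (-(p + n)) := by
        calc ‖x‖ ^ (-(p + n)) ≤ ((1 + ‖x‖) / 2) ^ (-(p + n)) :=
              Real.rpow_le_rpow_of_nonpos (by positivity) (by linarith) (by linarith)
          _ = _ := by
              rw [Real.div_rpow (by positivity) zero_le_two, Real.rpow_neg zero_le_two, div_inv_eq_mul,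
                mul_comm]
      have h4 := mul_le_mul_of_nonneg_left h3 hC.le
      simp only [hD]
      linarith
    · push Not at hx
      rw [fwdDiff_iter_eq_sum_shift]
      refine (norm_sum_le _ _).trans (le_trans (Finset.sum_le_sum fun k hk => ?_)
        (le_add_of_nonneg_right h2))
      have hk' : (k : ℝ) ≤ n := by exact_mod_cast Nat.lt_succ_iff.1 (Finset.mem_range.1 hk)
      have hku : ‖x + k • u‖ < 3 * n := by
        have e1 : ‖k • u‖ = k / 2 := by
          rw [← Nat.cast_smul_eq_nsmul ℝ, hu, norm_smul, norm_smul, he]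
          simp; ring
        refine (norm_add_le _ _).trans_lt ?_
        rw [e1]; linarith
      rw [ballPow_of_lt _ hku, zsmul_eq_mul, norm_mul]
      have e2 : ‖(((-1 : ℤ) ^ (n - k) * n.choose k : ℤ) : ℂ)‖ = n.choose k := by
        push_cast
        rw [norm_mul, norm_pow, norm_neg, norm_one, one_pow, one_mul, Complex.norm_natCast]
      rw [e2]
      gcongr
      exact norm_radialPow_le hB p δ _
  have hint : ∀ δ > 0, Integrable (radialPow ρ p δ : V → ℂ) :=
    fun δ hδ => integrable_radialPow hρ.continuous hs hB hp hδ
  have hF : ∀ δ > 0, 𝓕 (radialPow ρ p δ : V → ℂ) e =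
      ((-2) ^ n)⁻¹ * ∫ x, 𝐞 (-inner ℝ x e) • (fwdDiff u)^[n] (radialPow ρ p δ) x := by
    intro δ hδ
    have := (fourier_fwdDiff_iter (hint δ hδ) he n).2
    rw [Real.fourier_eq] at this
    rw [this, ← mul_assoc, inv_mul_cancel₀ (by simp), one_mul]
  have hlim : Tendsto (fun δ => ∫ x, 𝐞 (-inner ℝ x e) • (fwdDiff u)^[n] (radialPow ρ p δ) x)
      (𝓝[>] 0) (𝓝 (∫ x, 𝐞 (-inner ℝ x e) • (fwdDiff u)^[n] (radialPow ρ p 0) x)) := by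
    refine tendsto_integral_filter_of_dominated_convergence D ?_ ?_ hDint ?_
    · filter_upwards [self_mem_nhdsWithin] with δ hδ
      exact ((Real.fourierIntegral_convergent_iff e).2
        (fourier_fwdDiff_iter (hint δ hδ) he n).1).aestronglyMeasurable
    · filter_upwards [self_mem_nhdsWithin] with δ hδ
      refine Eventually.of_forall fun x => ?_
      rw [Circle.norm_smul]
      exact hbound δ (le_of_lt hδ) x
    · refine Eventually.of_forall fun x => Tendsto.const_smul ?_ _
      refine tendsto_nhdsWithin_of_tendsto_nhds ?_
      simp only [fwdDiff_iter_eq_sum_shift]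
      refine tendsto_finsetSum _ fun k _ => Tendsto.const_smul ?_ _
      have hc : Continuous fun δ => radialPow ρ p δ (x + k • u) := by
        have := hρ.continuous
        unfold radialPow
        fun_prop
      exact hc.tendsto 0
  refine ⟨((-2) ^ n)⁻¹ * ∫ x, 𝐞 (-inner ℝ x e) • (fwdDiff u)^[n] (radialPow ρ p 0) x,
    ‖(((-2 : ℂ)) ^ n)⁻¹‖ * ∫ x, D x, fun δ hδ => ?_, ?_⟩
  · rw [hF δ hδ, norm_mul]
    gcongr
    refine norm_integral_le_of_norm_le hDint (Eventually.of_forall fun x => ?_)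
    rw [Circle.norm_smul]
    exact hbound δ (le_of_lt hδ) x
  · refine (hlim.const_mul _).congr' ?_
    filter_upwards [self_mem_nhdsWithin] with δ hδ
    exact (hF δ hδ).symm

/-- A reflection exchanges the two vectors and preserves the radial function. -/
theorem fourier_radialPow_eq_of_norm_eq (p δ : ℝ) {e e' : V} (h : ‖e‖ = ‖e'‖) :
    𝓕 (radialPow ρ p δ : V → ℂ) e = 𝓕 (radialPow ρ p δ : V → ℂ) e' := by
  set A := (Submodule.span ℝ {e - e'})ᗮ.reflection with hA
  have hAe : A e = e' := Submodule.reflection_sub h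
  have hcomp : (radialPow ρ p δ : V → ℂ) ∘ A = radialPow ρ p δ := by
    funext x
    simp [radialPow]
  have := Real.fourier_comp_linearIsometry A (radialPow ρ p δ : V → ℂ) e
  rwa [hcomp, hAe] at this

/-- The substitution `y = ‖ξ‖x`: homogeneity gives the power of `‖ξ‖`, and the cutoff parameter
becomes `δ/‖ξ‖`. -/
theorem fourier_radialPow_eq_smul (p δ : ℝ) {ξ : V} (hξ : ξ ≠ 0) :
    𝓕 (radialPow ρ p δ : V → ℂ) ξ = ((‖ξ‖ ^ (p - Module.finrank ℝ V) : ℝ) : ℂ) *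
      𝓕 (radialPow ρ p (δ / ‖ξ‖) : V → ℂ) (‖ξ‖⁻¹ • ξ) := by
  set r := ‖ξ‖
  have hr : 0 < r := norm_pos_iff.2 hξ
  have h := Measure.integral_comp_smul (volume : Measure V)
    (fun y => 𝐞 (-inner ℝ y (r⁻¹ • ξ)) • (radialPow ρ p (δ / r) y)) r
  have hpt : ∀ x : V, 𝐞 (-inner ℝ (r • x) (r⁻¹ • ξ)) • radialPow ρ p (δ / r) (r • x) =
      ((r ^ (-p) : ℝ) : ℂ) * (𝐞 (-inner ℝ x ξ) • radialPow ρ p δ x) := by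
    intro x
    have e1 : inner ℝ (r • x) (r⁻¹ • ξ) = inner ℝ x ξ := by
      rw [real_inner_smul_left, real_inner_smul_right, ← mul_assoc, mul_inv_cancel₀ hr.ne', one_mul]
    have e2 : δ / r * ‖r • x‖ = δ * ‖x‖ := by
      rw [norm_smul, Real.norm_eq_abs, abs_of_pos hr]; field_simp
    rw [e1, radialPow, e2, radialPow, norm_smul, Real.norm_eq_abs, abs_of_pos hr,
      Real.mul_rpow hr.le (norm_nonneg _), Circle.smul_def, Circle.smul_def, smul_eq_mul, smul_eq_mul]
    push_cast
    ring
  simp_rw [hpt] at h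
  rw [integral_const_mul, abs_of_pos (by positivity), ← Real.fourier_eq, ← Real.fourier_eq] at h
  have hrp : ((r ^ (-p) : ℝ) : ℂ) ≠ 0 := by
    exact_mod_cast (Real.rpow_pos_of_pos hr _).ne'
  have e3 : r ^ (p - Module.finrank ℝ V) = (r ^ (-p))⁻¹ * (r ^ Module.finrank ℝ V)⁻¹ := by
    rw [Real.rpow_sub hr, Real.rpow_natCast, Real.rpow_neg hr.le, inv_inv, div_eq_mul_inv]
  rw [e3, Complex.ofReal_mul, mul_assoc]
  rw [Complex.real_smul] at h
  rw [← h, ← mul_assoc, Complex.ofReal_inv, inv_mul_cancel₀ hrp, one_mul]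

theorem integrable_norm_rpow_mul_gaussian [Nontrivial V] {q : ℝ} (hq0 : 0 < q)
    (hq : q < Module.finrank ℝ V) :
    Integrable fun x : V => ‖x‖ ^ (-q) * exp (-π * ‖x‖ ^ 2) := by
  have hg : Integrable fun x : V => exp (-π * ‖x‖ ^ 2) := by
    have := GaussianFourier.integrable_cexp_neg_mul_sq_norm_add (V := V) (b := (π : ℂ))
      (by simpa using pi_pos) 0 0
    refine this.norm.congr (Eventually.of_forall fun x => ?_)
    simp only [Complex.norm_exp]
    congr 1
    simp [← Complex.ofReal_pow, ← Complex.ofReal_mul, ← Complex.ofReal_neg]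
  refine ((integrable_ballPow (V := V) hq 1).add hg).mono' ?_ (Eventually.of_forall fun x => ?_)
  · exact Measurable.aestronglyMeasurable (by fun_prop)
  · have hexp : exp (-π * ‖x‖ ^ 2) ≤ 1 := Real.exp_le_one_iff.2 (by
      have := pi_pos
      nlinarith [mul_nonneg pi_pos.le (sq_nonneg ‖x‖)])
    rw [norm_of_nonneg (by positivity)]
    rcases lt_or_ge ‖x‖ 1 with hx | hx
    · simp only [Pi.add_apply, ballPow_of_lt q hx]
      have : 0 ≤ ‖x‖ ^ (-q) := by positivity
      nlinarith [Real.exp_pos (-π * ‖x‖ ^ 2)]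
    · have h1 : ‖x‖ ^ (-q) ≤ 1 := Real.rpow_le_one_of_one_le_of_nonpos hx (by linarith)
      have h2 := ballPow_nonneg q 1 x
      simp only [Pi.add_apply]
      nlinarith [Real.exp_pos (-π * ‖x‖ ^ 2)]

theorem integral_norm_rpow_mul_gaussian_pos [Nontrivial V] {q : ℝ} (hq0 : 0 < q)
    (hq : q < Module.finrank ℝ V) :
    0 < ∫ x : V, ‖x‖ ^ (-q) * exp (-π * ‖x‖ ^ 2) := by
  rw [integral_pos_iff_support_of_nonneg (fun x => by positivity)
    (integrable_norm_rpow_mul_gaussian hq0 hq)]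
  refine lt_of_lt_of_le (?_ : 0 < volume (Metric.ball (0 : V) 1 \ {0})) (measure_mono ?_)
  · rw [measure_sdiff_null (by simp)]
    exact Metric.measure_ball_pos _ _ one_pos
  · intro x hx
    have hx0 : 0 < ‖x‖ := norm_pos_iff.2 hx.2
    exact (by positivity : 0 < ‖x‖ ^ (-q) * exp (-π * ‖x‖ ^ 2)).ne'

theorem fourier_unit_gaussian (w : V) :
    𝓕 (fun v : V => ((exp (-π * ‖v‖ ^ 2) : ℝ) : ℂ)) w = ((exp (-π * ‖w‖ ^ 2) : ℝ) : ℂ) := by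
  have h := fourier_gaussian_innerProductSpace (V := V) (b := (π : ℂ)) (by simpa using pi_pos) w
  have hpi : (π : ℂ) ≠ 0 := by exact_mod_cast pi_ne_zero
  rw [div_self hpi, Complex.one_cpow, one_mul] at h
  push_cast
  rw [h]
  congr 1
  field_simp

/-- Asymptotics of the Fourier transform of `ρ(|x|) |x|^{-p}` at infinity. -/
theorem tendsto_fourier_radialPow [Nontrivial V] (hρ : ContDiff ℝ ∞ ρ)
    (hs : ∀ r, π ≤ r → ρ r = 0) {B : ℝ} (hB : ∀ r, |ρ r| ≤ B) (hp0 : 0 < p)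
    (hp : p < Module.finrank ℝ V) :
    ∃ c : ℝ, 0 < c ∧ Tendsto (fun ξ : V => ((‖ξ‖ ^ (Module.finrank ℝ V - p) : ℝ) : ℂ) *
      𝓕 (radialPow ρ p 1 : V → ℂ) ξ) (Bornology.cobounded V) (𝓝 ((ρ 0 * c : ℝ) : ℂ)) := by
  obtain ⟨v, hv⟩ := exists_ne (0 : V)
  obtain ⟨e, he⟩ : ∃ e : V, ‖e‖ = 1 := ⟨‖v‖⁻¹ • v, by
    rw [norm_smul, norm_inv, norm_norm, inv_mul_cancel₀ (norm_ne_zero_iff.2 hv)]⟩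
  have hB0 : 0 ≤ B := (abs_nonneg _).trans (hB 0)
  obtain ⟨L, C, hC, hL⟩ := exists_tendsto_fourier_radialPow hρ hs hB hp0 hp he
  set I : ℝ → ℂ := fun δ => 𝓕 (radialPow ρ p δ : V → ℂ) e with hI
  have hscale : ∀ δ : ℝ, ∀ ξ : V, ξ ≠ 0 → 𝓕 (radialPow ρ p δ : V → ℂ) ξ =
      ((‖ξ‖ ^ (p - Module.finrank ℝ V) : ℝ) : ℂ) * I (δ / ‖ξ‖) := by
    intro δ ξ hξ
    rw [fourier_radialPow_eq_smul p δ hξ]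
    congr 1
    refine fourier_radialPow_eq_of_norm_eq p _ ?_
    rw [he, norm_smul, norm_inv, norm_norm, inv_mul_cancel₀ (norm_ne_zero_iff.2 hξ)]
  set n : ℝ := (Module.finrank ℝ V : ℝ)
  have hq0 : 0 < n - p := by linarith
  have hqn : n - p < n := by linarith
  have hA1 := integrable_norm_rpow_mul_gaussian (V := V) hp0 hp
  have hA2 := integrable_norm_rpow_mul_gaussian (V := V) hq0 hqn
  have hA1p := integral_norm_rpow_mul_gaussian_pos (V := V) hp0 hp
  have hA2p := integral_norm_rpow_mul_gaussian_pos (V := V) hq0 hqn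
  set A1 := ∫ x : V, ‖x‖ ^ (-p) * exp (-π * ‖x‖ ^ 2)
  set A2 := ∫ x : V, ‖x‖ ^ (-(n - p)) * exp (-π * ‖x‖ ^ 2)
  have hae : ∀ᵐ ξ : V, ξ ≠ 0 := by simp [ae_iff]
  have hg : Integrable fun x : V => ((exp (-π * ‖x‖ ^ 2) : ℝ) : ℂ) := by
    have := GaussianFourier.integrable_cexp_neg_mul_sq_norm_add (V := V) (b := (π : ℂ))
      (by simpa using pi_pos) 0 0
    refine this.congr (Eventually.of_forall fun x => ?_)
    simp
  -- Duality of the Fourier transform tested against the self-dual Gaussian. Letting `δ → 0` on both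
  -- sides gives `A2 · L = ρ(0) · A1`, so the limit is `ρ(0)` times the positive ratio `A1/A2`.
  have hflip : ∀ δ > 0, ∫ ξ : V, ((‖ξ‖ ^ (-(n - p)) * exp (-π * ‖ξ‖ ^ 2) : ℝ) : ℂ) * I (δ / ‖ξ‖) =
      ∫ x : V, ((ρ (δ * ‖x‖) * (‖x‖ ^ (-p) * exp (-π * ‖x‖ ^ 2)) : ℝ) : ℂ) := by
    intro δ hδ
    have h := VectorFourier.integral_fourierIntegral_smul_eq_flip (μ := volume) (ν := volume)
      (L := innerₗ V) (e := 𝐞) (f := (radialPow ρ p δ : V → ℂ))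
      (g := fun x : V => ((exp (-π * ‖x‖ ^ 2) : ℝ) : ℂ)) Real.continuous_fourierChar
      (by exact continuous_inner) (integrable_radialPow hρ.continuous hs hB hp hδ) hg
    rw [flip_innerₗ] at h
    change ∫ ξ : V, 𝓕 (radialPow ρ p δ : V → ℂ) ξ • _ = ∫ x : V, radialPow ρ p δ x •
      𝓕 (fun x : V => ((exp (-π * ‖x‖ ^ 2) : ℝ) : ℂ)) x at h
    simp_rw [fourier_unit_gaussian] at h
    refine Eq.trans ?_ (h.trans ?_)
    · refine integral_congr_ae ?_
      filter_upwards [hae] with ξ hξ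
      rw [hscale δ ξ hξ, neg_sub, smul_eq_mul]
      push_cast
      ring
    · refine integral_congr_ae (Eventually.of_forall fun x => ?_)
      simp only [radialPow, smul_eq_mul]
      push_cast
      ring
  have hlim1 : Tendsto (fun δ => ∫ ξ : V,
      ((‖ξ‖ ^ (-(n - p)) * exp (-π * ‖ξ‖ ^ 2) : ℝ) : ℂ) * I (δ / ‖ξ‖)) (𝓝[>] 0)
      (𝓝 (∫ ξ : V, ((‖ξ‖ ^ (-(n - p)) * exp (-π * ‖ξ‖ ^ 2) : ℝ) : ℂ) * L)) := by
    refine tendsto_integral_filter_of_dominated_convergence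
      (fun ξ : V => ‖ξ‖ ^ (-(n - p)) * exp (-π * ‖ξ‖ ^ 2) * C) ?_ ?_ (hA2.mul_const C) ?_
    · filter_upwards [self_mem_nhdsWithin] with δ hδ
      have hcont : Continuous (𝓕 (radialPow ρ p δ : V → ℂ)) :=
        VectorFourier.fourierIntegral_continuous Real.continuous_fourierChar
          (by exact continuous_inner) (integrable_radialPow hρ.continuous hs hB hp hδ)
      have : AEStronglyMeasurable (fun ξ : V => 𝓕 (radialPow ρ p δ : V → ℂ) ξ *
          ((exp (-π * ‖ξ‖ ^ 2) : ℝ) : ℂ)) volume :=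
        Continuous.aestronglyMeasurable (by fun_prop)
      refine this.congr ?_
      filter_upwards [hae] with ξ hξ
      rw [hscale δ ξ hξ, neg_sub]
      push_cast
      ring
    · filter_upwards [self_mem_nhdsWithin] with δ hδ
      filter_upwards [hae] with ξ hξ
      rw [norm_mul, Complex.norm_real, norm_of_nonneg (by positivity)]
      gcongr
      exact hC _ (div_pos hδ (norm_pos_iff.2 hξ))
    · filter_upwards [hae] with ξ hξ
      have hξ0 : 0 < ‖ξ‖ := norm_pos_iff.2 hξ
      refine (hL.comp ?_).const_mul _
      refine tendsto_nhdsWithin_iff.2 ⟨?_, ?_⟩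
      · refine tendsto_nhdsWithin_of_tendsto_nhds ?_
        exact (continuous_id.div_const ‖ξ‖).tendsto' 0 0 (by simp)
      · filter_upwards [self_mem_nhdsWithin] with δ hδ
        exact div_pos hδ hξ0
  have hlim2 : Tendsto (fun δ => ∫ x : V,
      ((ρ (δ * ‖x‖) * (‖x‖ ^ (-p) * exp (-π * ‖x‖ ^ 2)) : ℝ) : ℂ)) (𝓝[>] 0)
      (𝓝 (∫ x : V, ((ρ 0 * (‖x‖ ^ (-p) * exp (-π * ‖x‖ ^ 2)) : ℝ) : ℂ))) := by
    have hm := hρ.continuous.measurable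
    refine tendsto_integral_filter_of_dominated_convergence
      (fun x : V => B * (‖x‖ ^ (-p) * exp (-π * ‖x‖ ^ 2))) ?_ ?_ (hA1.const_mul B) ?_
    · exact Eventually.of_forall fun δ => Measurable.aestronglyMeasurable (by fun_prop)
    · refine Eventually.of_forall fun δ => Eventually.of_forall fun x => ?_
      rw [Complex.norm_real, norm_mul, norm_of_nonneg
        (by positivity : 0 ≤ ‖x‖ ^ (-p) * exp (-π * ‖x‖ ^ 2))]
      gcongr
      exact hB _
    · refine Eventually.of_forall fun x => tendsto_nhdsWithin_of_tendsto_nhds ?_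
      have hc := hρ.continuous
      have : Continuous fun δ => ((ρ (δ * ‖x‖) * (‖x‖ ^ (-p) * exp (-π * ‖x‖ ^ 2)) : ℝ) : ℂ) := by
        fun_prop
      exact this.tendsto' 0 _ (by simp)
  have heq := tendsto_nhds_unique (hlim1.congr' (by
    filter_upwards [self_mem_nhdsWithin] with δ hδ using hflip δ hδ)) hlim2
  rw [integral_mul_const, integral_complex_ofReal, integral_complex_ofReal, integral_const_mul] at heq
  have hLval : L = ((ρ 0 * (A1 / A2) : ℝ) : ℂ) := by
    have hA2c : (A2 : ℂ) ≠ 0 := by exact_mod_cast hA2p.ne'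
    have : (A2 : ℂ) * L = ((ρ 0 * A1 : ℝ) : ℂ) := heq
    rw [← mul_div_assoc, Complex.ofReal_div, eq_div_iff hA2c, ← this, mul_comm]
  refine ⟨A1 / A2, by positivity, ?_⟩
  rw [← hLval]
  have hnorm : Tendsto (fun ξ : V => 1 / ‖ξ‖) (Bornology.cobounded V) (𝓝[>] 0) := by
    simp_rw [one_div]
    exact tendsto_inv_atTop_nhdsGT_zero.comp tendsto_norm_cobounded_atTop
  refine (hL.comp hnorm).congr' ?_
  filter_upwards [Bornology.eventually_ne_cobounded (0 : V)] with ξ hξ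
  have hξ0 : 0 < ‖ξ‖ := norm_pos_iff.2 hξ
  rw [hscale 1 ξ hξ, ← mul_assoc, ← Complex.ofReal_mul, ← Real.rpow_add hξ0]
  simp

end

end TorusWeyl

/-! ### Torus coefficients as Euclidean Fourier transforms -/

namespace TorusWeyl

open scoped FourierTransform

section
variable {n : ℕ}

theorem eigenfun_mul_conj (j k : Fin n → ℤ) (x : Torus n) :
    eigenfun j x * conj (eigenfun k x) = eigenfun (j - k) x := by
  simp only [eigenfun, map_prod, ← Finset.prod_mul_distrib]
  refine Finset.prod_congr rfl fun i _ => ?_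
  rw [← fourier_neg, ← fourier_add, Pi.sub_apply, sub_eq_add_neg]

theorem conj_eigenfun (j : Fin n → ℤ) (x : Torus n) :
    conj (eigenfun j x) = eigenfun (-j) x := by
  simp only [eigenfun, map_prod]
  refine Finset.prod_congr rfl fun i _ => ?_
  rw [← fourier_neg, Pi.neg_apply]

theorem eigenfun_add (j : Fin n → ℤ) (x y : Torus n) :
    eigenfun j (x + y) = eigenfun j x * eigenfun j y := by
  simp only [eigenfun, ← Finset.prod_mul_distrib]
  refine Finset.prod_congr rfl fun i _ => ?_
  rw [Pi.add_apply, fourier_apply, fourier_apply, fourier_apply, smul_add,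
    AddCircle.toCircle_add, Circle.coe_mul]

theorem norm_eigenfun (j : Fin n → ℤ) (x : Torus n) : ‖eigenfun j x‖ = 1 := by
  rw [eigenfun, norm_prod]
  refine Finset.prod_eq_one fun i _ => ?_
  rw [fourier_apply, Circle.norm_coe]

theorem continuous_eigenfun (j : Fin n → ℤ) : Continuous (eigenfun j : Torus n → ℂ) := by
  unfold eigenfun
  exact continuous_finsetProd _ fun i _ => (fourier (j i)).continuous.comp (continuous_apply i)

theorem continuous_geodDist (x₀ : Torus n) : Continuous fun x => geodDist x x₀ := by
  unfold geodDist
  fun_prop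

theorem measurable_potential {ρ : ℝ → ℝ} (hρ : Continuous ρ) (η : ℝ) (x₀ : Torus n) :
    Measurable (potential ρ η x₀) := by
  have h1 := (continuous_geodDist x₀).measurable
  have h2 := hρ.measurable
  unfold potential
  fun_prop

theorem geodDist_add_right (z x₀ : Torus n) : geodDist (z + x₀) x₀ = geodDist z 0 := by
  simp [geodDist, dist_eq_norm]

theorem integral_torus (F : Torus n → ℂ) (hF : Measurable F) :
    ∫ z, F z = ∫ x in Set.univ.pi fun _ : Fin n => Set.Ioc (-π) π, F (fun i => (x i : AddCircle (2 * π))) := by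
  have h := measurePreserving_pi _ _
    (fun _ : Fin n => AddCircle.measurePreserving_mk (2 * π) (-π))
  have hT : -π + 2 * π = π := by ring
  rw [hT] at h
  rw [volume_pi (α := fun _ : Fin n => AddCircle (2 * π)), ← h.map_eq,
    integral_map h.measurable.aemeasurable hF.aestronglyMeasurable,
    ← Measure.restrict_pi_pi, ← volume_pi]

/-- The frequency in `ℝⁿ` of the exponential `e_m`. -/
noncomputable def freq (m : Fin n → ℤ) : EuclideanSpace ℝ (Fin n) :=
  WithLp.toLp 2 fun i => (2 * π)⁻¹ * m i

theorem norm_freq (m : Fin n → ℤ) : ‖freq m‖ = (2 * π)⁻¹ * latticeNorm m := by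
  have : freq m = (2 * π)⁻¹ • WithLp.toLp 2 (fun i => (m i : ℝ)) := rfl
  rw [this, norm_smul, norm_of_nonneg (by positivity), EuclideanSpace.norm_eq, latticeNorm]
  simp

/-- After translating `x₀` to the origin, geodesic distance on the cell `(-π, π]ⁿ` equals the
Euclidean norm. As `ρ` vanishes from `π` on, the integral over the cell is one over all of `ℝⁿ`,
with no error term. -/
theorem integral_eigenfun_potential {ρ : ℝ → ℝ} (hρ : Continuous ρ) (hs : ∀ r, π ≤ r → ρ r = 0)
    (η : ℝ) (x₀ : Torus n) (m : Fin n → ℤ) :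
    ∫ z, conj (eigenfun m z) * (potential ρ η x₀ z : ℂ) = conj (eigenfun m x₀) *
      𝓕 (radialPow ρ (2 - η) 1 : EuclideanSpace ℝ (Fin n) → ℂ) (freq m) := by
  have hmeas : Measurable fun z : Torus n =>
      conj (eigenfun m z) * (potential ρ η 0 z : ℂ) := by
    have h1 := (continuous_eigenfun m).measurable
    have h2 := measurable_potential hρ η (0 : Torus n)
    fun_prop
  rw [← integral_add_right_eq_self _ x₀]
  have hpt : ∀ z : Torus n, conj (eigenfun m (z + x₀)) * (potential ρ η x₀ (z + x₀) : ℂ) =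
      conj (eigenfun m x₀) * (conj (eigenfun m z) * (potential ρ η 0 z : ℂ)) := by
    intro z
    rw [eigenfun_add, map_mul, potential, geodDist_add_right, potential]
    ring
  simp_rw [hpt]
  rw [integral_const_mul, integral_torus _ hmeas, Real.fourier_eq,
    ← (PiLp.volume_preserving_toLp (Fin n)).integral_comp
      (MeasurableEquiv.toLp 2 (Fin n → ℝ)).measurableEmbedding]
  congr 1
  have hbox : ∀ x ∈ Set.univ.pi fun _ : Fin n => Set.Ioc (-π) π,
      conj (eigenfun m (fun i => (x i : AddCircle (2 * π)))) *
        (potential ρ η 0 (fun i => (x i : AddCircle (2 * π))) : ℂ) =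
      𝐞 (-inner ℝ (WithLp.toLp 2 x) (freq m)) • radialPow ρ (2 - η) 1 (WithLp.toLp 2 x) := by
    intro x hx
    have hx' : ∀ i, |x i| ≤ π := fun i => abs_le.2 ⟨(hx i trivial).1.le, (hx i trivial).2⟩
    have hd : geodDist (fun i => (x i : AddCircle (2 * π))) 0 = ‖WithLp.toLp 2 x‖ := by
      rw [geodDist, EuclideanSpace.norm_eq]
      congr 1
      refine Finset.sum_congr rfl fun i _ => ?_
      rw [Pi.zero_apply, dist_zero_right,
        (AddCircle.norm_coe_eq_abs_iff (2 * π) two_pi_pos.ne').2, Real.norm_eq_abs]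
      rw [abs_of_pos two_pi_pos]
      linarith [hx' i]
    rw [potential, hd, radialPow, one_mul, Circle.smul_def, smul_eq_mul, neg_sub,
      show (-2 + η) = η - 2 by ring]
    congr 1
    rw [conj_eigenfun, eigenfun, Real.fourierChar_apply]
    simp only [fourier_coe_apply, ← Complex.exp_sum]
    congr 1
    rw [PiLp.inner_apply]
    simp only [freq, RCLike.inner_apply, conj_trivial, Pi.neg_apply]
    rw [← Finset.sum_neg_distrib, Finset.mul_sum]
    push_cast
    rw [Finset.sum_mul]
    refine Finset.sum_congr rfl fun i _ => ?_
    have : (π : ℂ) ≠ 0 := by exact_mod_cast pi_ne_zero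
    field_simp
  rw [setIntegral_congr_fun (MeasurableSet.univ_pi fun _ => measurableSet_Ioc) hbox]
  refine setIntegral_eq_integral_of_forall_compl_eq_zero fun x hx => ?_
  have : ∃ i, π ≤ |x i| := by
    by_contra hcon
    push Not at hcon
    exact hx fun i _ => ⟨(abs_lt.1 (hcon i)).1, (abs_lt.1 (hcon i)).2.le⟩
  obtain ⟨i, hi⟩ := this
  have hn : π ≤ 1 * ‖WithLp.toLp 2 x‖ := by
    rw [one_mul]
    refine hi.trans ?_
    have := PiLp.norm_apply_le (WithLp.toLp 2 x) i
    rwa [Real.norm_eq_abs] at this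
  rw [radialPow, hs _ hn]
  simp

theorem duhamelTerm_eq {ρ : ℝ → ℝ} (hρ : Continuous ρ) (hs : ∀ r, π ≤ r → ρ r = 0)
    (h : ℝ → ℝ) (η : ℝ) (x₀ x : Torus n) (p : (Fin n → ℤ) × (Fin n → ℤ)) :
    duhamelTerm h (potential ρ η x₀) x p =
      (sqDiffQuot h (latticeNorm p.1) (latticeNorm p.2) : ℂ) *
        𝓕 (radialPow ρ (2 - η) 1 : EuclideanSpace ℝ (Fin n) → ℂ) (freq (p.1 - p.2)) *
        (eigenfun (p.1 - p.2) x * conj (eigenfun (p.1 - p.2) x₀)) := by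
  have hc : coeff (potential ρ η x₀) p.1 p.2 = conj (eigenfun (p.1 - p.2) x₀) *
      𝓕 (radialPow ρ (2 - η) 1 : EuclideanSpace ℝ (Fin n) → ℂ) (freq (p.1 - p.2)) := by
    rw [← integral_eigenfun_potential hρ hs, coeff]
    refine integral_congr_ae (Filter.Eventually.of_forall fun z => ?_)
    simp only
    rw [← eigenfun_mul_conj p.1 p.2 z, map_mul, Complex.conj_conj]
  rw [duhamelTerm, hc, ← eigenfun_mul_conj p.1 p.2 x]
  ring

end

end TorusWeyl

/-! ### Coefficient bounds and comparison with the sharp cutoff -/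

namespace TorusWeyl

open scoped FourierTransform

/-- Far out the Fourier asymptotics apply; the finitely many remaining modes are covered by the `L¹`
norm. Dividing by `ρ 0` makes the leading coefficient positive whatever the sign of `ρ 0`. -/
theorem exists_coefficient_bounds {n : ℕ} (hn : 2 ≤ n) {ρ : ℝ → ℝ} (hρ : ContDiff ℝ ∞ ρ)
    (hs : ∀ r, π ≤ r → ρ r = 0) {B : ℝ} (hB : ∀ r, |ρ r| ≤ B) (hρ0 : ρ 0 ≠ 0) {η : ℝ}
    (h0 : 0 < η) (h1 : η < 1) :
    ∃ C c M : ℝ, 0 < C ∧ 0 < c ∧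
      (∀ m : Fin n → ℤ,
        ‖𝓕 (radialPow ρ (2 - η) 1 : EuclideanSpace ℝ (Fin n) → ℂ) (freq m)‖ ≤
          C * (1 + latticeNorm m) ^ (-(n - 2 + η))) ∧
      (∀ m : Fin n → ℤ, M ≤ latticeNorm m → c * (1 + latticeNorm m) ^ (-(n - 2 + η)) ≤
        (𝓕 (radialPow ρ (2 - η) 1 : EuclideanSpace ℝ (Fin n) → ℂ) (freq m) / ρ 0).re) := by
  have hn' : (2 : ℝ) ≤ n := by exact_mod_cast hn
  have : Nonempty (Fin n) := ⟨⟨0, by omega⟩⟩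
  have hfr : Module.finrank ℝ (EuclideanSpace ℝ (Fin n)) = n := finrank_euclideanSpace_fin
  obtain ⟨c, hc, ht⟩ := tendsto_fourier_radialPow (V := EuclideanSpace ℝ (Fin n)) hρ hs hB
    (p := 2 - η) (by linarith) (by rw [hfr]; linarith)
  rw [hfr, show (n : ℝ) - (2 - η) = n - 2 + η by ring] at ht
  set s : ℝ := n - 2 + η with hsdef
  have hs0 : 0 < s := by linarith
  set v : (Fin n → ℤ) → ℂ := fun m =>
    𝓕 (radialPow ρ (2 - η) 1 : EuclideanSpace ℝ (Fin n) → ℂ) (freq m) with hv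
  have hρa : 0 < |ρ 0| := abs_pos.2 hρ0
  -- The tolerance is half of the limit's modulus, so the real part keeps at least half of its
  -- limiting value.
  obtain ⟨R, hR⟩ : ∃ R : ℝ, ∀ ξ : EuclideanSpace ℝ (Fin n), R ≤ ‖ξ‖ →
      ‖((‖ξ‖ ^ s : ℝ) : ℂ) * 𝓕 (radialPow ρ (2 - η) 1 : EuclideanSpace ℝ (Fin n) → ℂ) ξ -
        ((ρ 0 * c : ℝ) : ℂ)‖ < |ρ 0| * (c / 2) := by
    have h := (Metric.tendsto_nhds.1 ht) (|ρ 0| * (c / 2)) (by positivity)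
    rw [← comap_norm_atTop, Filter.eventually_comap] at h
    obtain ⟨R, hR⟩ := Filter.eventually_atTop.1 h
    exact ⟨R, fun ξ hξ => by simpa [dist_eq_norm] using hR _ hξ ξ rfl⟩
  set M : ℝ := max 1 (2 * π * R) with hM
  have hM1 : 1 ≤ M := le_max_left _ _
  have hbig : ∀ m : Fin n → ℤ, M ≤ latticeNorm m →
      (c / 2 * (2 * π) ^ s * latticeNorm m ^ (-s) ≤ (v m / ρ 0).re) ∧
      ‖v m‖ ≤ 2 * |ρ 0| * c * (2 * π) ^ s * latticeNorm m ^ (-s) := by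
    intro m hm
    have hm0 : 0 < latticeNorm m := by linarith
    have hξ : R ≤ ‖freq m‖ := by
      rw [norm_freq, inv_mul_eq_div, le_div_iff₀ two_pi_pos, mul_comm]
      exact (le_max_right _ _).trans hm
    have h := hR _ hξ
    have hX : ‖freq m‖ ^ s = ((2 * π) ^ s * latticeNorm m ^ (-s))⁻¹ := by
      rw [norm_freq, Real.mul_rpow (by positivity) hm0.le, Real.inv_rpow (by positivity),
        Real.rpow_neg hm0.le, mul_inv, inv_inv]
    set Y := (2 * π) ^ s * latticeNorm m ^ (-s) with hY
    have hY0 : 0 < Y := by positivity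
    rw [hX] at h
    change ‖((Y⁻¹ : ℝ) : ℂ) * v m - _‖ < _ at h
    have hYc : (Y : ℂ) ≠ 0 := by exact_mod_cast hY0.ne'
    have hρc : (ρ 0 : ℂ) ≠ 0 := by exact_mod_cast hρ0
    have hvm : ‖v m - Y * ((ρ 0 * c : ℝ) : ℂ)‖ ≤ Y * (|ρ 0| * (c / 2)) := by
      have e : v m - Y * ((ρ 0 * c : ℝ) : ℂ) =
          Y * (((Y⁻¹ : ℝ) : ℂ) * v m - ((ρ 0 * c : ℝ) : ℂ)) := by
        push_cast; field_simp
      rw [e, norm_mul, Complex.norm_real, norm_of_nonneg hY0.le]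
      gcongr
    constructor
    · have e : v m / ρ 0 = ((Y * c : ℝ) : ℂ) + (v m - Y * ((ρ 0 * c : ℝ) : ℂ)) / ρ 0 := by
        push_cast; field_simp; ring
      have h2 : ‖(v m - Y * ((ρ 0 * c : ℝ) : ℂ)) / ρ 0‖ ≤ Y * (c / 2) := by
        rw [norm_div, Complex.norm_real, Real.norm_eq_abs, div_le_iff₀ hρa]
        linarith
      have h3 := (abs_le.1 ((Complex.abs_re_le_norm _).trans h2)).1
      rw [e, Complex.add_re, Complex.ofReal_re]
      rw [mul_assoc, ← hY]
      linarith
    · have h2 : ‖v m‖ ≤ ‖v m - Y * ((ρ 0 * c : ℝ) : ℂ)‖ + ‖(Y : ℂ) * ((ρ 0 * c : ℝ) : ℂ)‖ := by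
        simpa using norm_add_le (v m - Y * ((ρ 0 * c : ℝ) : ℂ)) (Y * ((ρ 0 * c : ℝ) : ℂ))
      rw [norm_mul, Complex.norm_real, Complex.norm_real, norm_of_nonneg hY0.le, norm_mul,
        norm_of_nonneg hc.le, Real.norm_eq_abs] at h2
      rw [mul_assoc _ ((2 * π) ^ s), ← hY]
      nlinarith [mul_pos hY0 (mul_pos hρa hc)]
  set D := ∫ x, ‖(radialPow ρ (2 - η) 1 : EuclideanSpace ℝ (Fin n) → ℂ) x‖ with hD
  have hD0 : 0 ≤ D := integral_nonneg fun _ => norm_nonneg _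
  have hsmall : ∀ m, ‖v m‖ ≤ D := fun m => by
    refine (norm_integral_le_integral_norm _).trans (le_of_eq ?_)
    simp_rw [Circle.norm_smul]
    rfl
  refine ⟨2 * |ρ 0| * c * (2 * π) ^ s * 2 ^ s + D * (1 + M) ^ s, c / 2 * (2 * π) ^ s, M,
    by positivity, by positivity, fun m => ?_, fun m hm => ?_⟩
  · have hnn := latticeNorm_nonneg m
    rcases le_or_gt M (latticeNorm m) with hm | hm
    · have hm0 : 0 < latticeNorm m := by linarith
      refine (hbig m hm).2.trans ?_
      have h2 : latticeNorm m ^ (-s) ≤ 2 ^ s * (1 + latticeNorm m) ^ (-s) := by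
        calc latticeNorm m ^ (-s) ≤ ((1 + latticeNorm m) / 2) ^ (-s) :=
              Real.rpow_le_rpow_of_nonpos (by positivity) (by linarith) (by linarith)
          _ = _ := by
              rw [Real.div_rpow (by positivity) zero_le_two, Real.rpow_neg zero_le_two,
                div_inv_eq_mul, mul_comm]
      calc _ ≤ 2 * |ρ 0| * c * (2 * π) ^ s * (2 ^ s * (1 + latticeNorm m) ^ (-s)) := by gcongr
        _ ≤ _ := by
            rw [add_mul, ← mul_assoc]
            exact le_add_of_nonneg_right (by positivity)
    · refine (hsmall m).trans ?_
      have h2 : 1 ≤ (1 + M) ^ s * (1 + latticeNorm m) ^ (-s) := by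
        rw [Real.rpow_neg (by positivity), ← div_eq_mul_inv, le_div_iff₀ (by positivity), one_mul]
        gcongr
      calc D = D * 1 := (mul_one D).symm
        _ ≤ D * ((1 + M) ^ s * (1 + latticeNorm m) ^ (-s)) := by gcongr
        _ ≤ _ := by
            rw [add_mul, ← mul_assoc]
            exact le_add_of_nonneg_left (by positivity)
  · have hm0 : 0 < latticeNorm m := by linarith
    refine le_trans ?_ (hbig m hm).1
    gcongr ?_ * ?_
    exact Real.rpow_le_rpow_of_nonpos hm0 (by linarith) (by linarith)

/-- The part of `(h(a) - h(b)) / (a² - b²)` that remains when `h` is replaced by the sharp cutoff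
at `lam` and `a`, `b` are not close. -/
noncomputable def sharpQuot (lam a b : ℝ) : ℝ :=
  if ⌊min a b⌋₊ + 2 ≤ ⌊max a b⌋₊ ∧ min a b ≤ lam ∧ lam < max a b then
    -(1 / (max a b ^ 2 - min a b ^ 2)) else 0

theorem sharpQuot_comm (lam a b : ℝ) : sharpQuot lam a b = sharpQuot lam b a := by
  rw [sharpQuot, sharpQuot, min_comm, max_comm]

theorem sqDiffQuot_comm (h : ℝ → ℝ) (a b : ℝ) : sqDiffQuot h a b = sqDiffQuot h b a := by
  unfold sqDiffQuot
  by_cases hab : a = b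
  · subst hab; rfl
  · rw [if_neg hab, if_neg (Ne.symm hab), ← neg_sub (h b), ← neg_sub (b ^ 2), neg_div_neg_eq]

/-- A gap of two in the integer parts makes `b - a` comparable to `1 + β - α`, where `α = ⌊a⌋` and
`β = ⌊b⌋`, with factor 3, and `b + a` to `1 + β`, with factor `3/2`. This fails for adjacent shells,
where `b - a` may be tiny. -/
theorem sq_sub_sq_ge {a b : ℝ} (ha : 0 ≤ a) (hb : 0 ≤ b) (h : ⌊a⌋₊ + 2 ≤ ⌊b⌋₊) :
    (1 + (⌊b⌋₊ - ⌊a⌋₊ : ℕ)) * (1 + (⌊b⌋₊ : ℝ)) ≤ 5 * (b ^ 2 - a ^ 2) := by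
  have h1 := Nat.floor_le hb
  have h2 := Nat.lt_floor_add_one a
  have h3 : (⌊a⌋₊ : ℝ) + 2 ≤ ⌊b⌋₊ := by exact_mod_cast h
  have h4 : (0 : ℝ) ≤ ⌊a⌋₊ := Nat.cast_nonneg _
  rw [Nat.cast_sub (by omega)]
  have h5 : (⌊b⌋₊ : ℝ) - ⌊a⌋₊ - 1 ≤ b - a := by linarith
  have h6 : (1 + ((⌊b⌋₊ : ℝ) - ⌊a⌋₊)) ≤ 3 * (b - a) := by linarith
  have h7 : 1 + (⌊b⌋₊ : ℝ) ≤ 3 / 2 * (b + a) := by linarith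
  calc _ ≤ (3 * (b - a)) * (3 / 2 * (b + a)) := by gcongr; linarith
    _ ≤ _ := by nlinarith [mul_nonneg (by linarith : 0 ≤ b - a) (by linarith : 0 ≤ b + a)]

theorem abs_sharpQuot_le {lam a b : ℝ} (ha : 0 ≤ a) (hb : 0 ≤ b) {A : ℕ → ℕ → ℝ}
    (hA : ∀ α β, 0 ≤ A α β)
    (h : ⌊min a b⌋₊ ≤ ⌊lam⌋₊ → ⌊lam⌋₊ ≤ ⌊max a b⌋₊ → 5 ≤ A ⌊min a b⌋₊ ⌊max a b⌋₊) :
    |sharpQuot lam a b| ≤ shellWeight A ⌊a⌋₊ ⌊b⌋₊ := by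
  wlog hab : a ≤ b generalizing a b
  · rw [sharpQuot_comm, shellWeight_comm]
    exact this hb ha (by rwa [min_comm, max_comm]) (le_of_not_ge hab)
  rw [min_eq_left hab, max_eq_right hab] at h
  rw [sharpQuot, min_eq_left hab, max_eq_right hab]
  split_ifs with hc
  · have hg := sq_sub_sq_ge ha hb hc.1
    have h5 := h (Nat.floor_mono hc.2.1) (Nat.floor_mono hc.2.2.le)
    have hpos : (0 : ℝ) < (1 + (⌊b⌋₊ - ⌊a⌋₊ : ℕ)) * (1 + (⌊b⌋₊ : ℝ)) := by positivity
    have hpos' : 0 < b ^ 2 - a ^ 2 := by linarith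
    rw [abs_neg, abs_of_pos (by positivity), shellWeight_of_le A (by omega),
      div_le_div_iff₀ hpos' hpos, one_mul]
    nlinarith
  · rw [abs_zero]; exact shellWeight_nonneg hA _ _

theorem decay_le_mul_decay (N : ℕ) {w lam x y K : ℝ} (hw : 1 ≤ w) (hK : 0 ≤ K)
    (h : |y - x| ≤ K) : decay N w lam x ≤ (1 + K) ^ N * decay N w lam y := by
  have hw0 : 0 < w := by linarith
  rw [decay, decay, ← inv_inv ((1 + K) ^ N), ← mul_inv, inv_mul_eq_div]
  gcongr
  rw [div_le_iff₀ (by positivity), ← mul_pow]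
  gcongr
  have h1 : |y - lam| ≤ K + |x - lam| := by
    calc |y - lam| = |(y - x) + (x - lam)| := by ring_nf
      _ ≤ _ := (abs_add_le _ _).trans (by linarith)
  have h2 : |y - lam| / w ≤ K + |x - lam| / w := by
    calc |y - lam| / w ≤ (K + |x - lam|) / w := by gcongr
      _ = K / w + |x - lam| / w := add_div _ _ _
      _ ≤ _ := by gcongr; exact div_le_self hK hw
  have h3 : 0 ≤ |x - lam| / w := by positivity
  nlinarith [mul_nonneg hK h3]

theorem decay_le_one (N : ℕ) {w : ℝ} (hw : 1 ≤ w) (lam x : ℝ) : decay N w lam x ≤ 1 := by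
  have hw0 : 0 < w := by linarith
  rw [decay]
  refine inv_le_one_of_one_le₀ (one_le_pow₀ ?_)
  have : 0 ≤ |x - lam| / w := by positivity
  linarith

/-- Comparison of the difference quotient of a smoothed cutoff with that of the sharp cutoff. -/
theorem abs_sqDiffQuot_sub_sharpQuot_le {h : ℝ → ℝ} {N : ℕ} {w lam C : ℝ} (hw : 1 ≤ w)
    (hC : 0 < C)
    (hh : ∀ τ, 0 ≤ τ → |h τ - if τ ≤ lam then 1 else 0| ≤ C * decay N w lam τ)
    (hd : Differentiable ℝ h) (hh' : ∀ τ, 0 ≤ τ → |deriv h τ| ≤ C * decay N w lam τ)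
    (hh2 : |iteratedDeriv 2 h 0| ≤ C) {a b : ℝ} (ha : 0 ≤ a) (hb : 0 ≤ b)
    (ha2 : ∃ z : ℤ, a ^ 2 = z) (hb2 : ∃ z : ℤ, b ^ 2 = z) :
    |sqDiffQuot h a b - sharpQuot lam a b| ≤
      shellWeight (fun α β => 5 * 3 ^ N * (1 + 2 * C) *
        (decay N w lam α + decay N w lam β + if β ≤ 1 then 1 else 0)) ⌊a⌋₊ ⌊b⌋₊ := by
  wlog hab : a ≤ b generalizing a b
  · rw [sqDiffQuot_comm, sharpQuot_comm, shellWeight_comm]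
    exact this hb ha hb2 ha2 (le_of_not_ge hab)
  have hw0 : 0 < w := by linarith
  have hE : ∀ τ, 0 ≤ decay N w lam τ := decay_nonneg N hw0.le lam
  have hfl : ⌊a⌋₊ ≤ ⌊b⌋₊ := Nat.floor_mono hab
  have h3N : (1 : ℝ) ≤ 3 ^ N := one_le_pow₀ (by norm_num)
  have h23 : (2 : ℝ) ^ N ≤ 3 ^ N := by gcongr; norm_num
  have hfa := Nat.floor_le ha
  have hfa' := Nat.lt_floor_add_one a
  have hfb := Nat.floor_le hb
  have hfb' := Nat.lt_floor_add_one b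
  have hone : ∀ x : ℝ, 0 ≤ x → x ≠ 0 → (∃ z : ℤ, x ^ 2 = z) → 1 ≤ x := by
    rintro x hx hx0 ⟨z, hz⟩
    have h1 : (0 : ℝ) < z := by rw [← hz]; positivity
    have h2 : (1 : ℝ) ≤ z := by exact_mod_cast (by exact_mod_cast h1 : 0 < z)
    nlinarith
  rw [shellWeight_of_le _ hfl, sharpQuot, min_eq_left hab, max_eq_right hab]
  have hden : (0 : ℝ) < (1 + (⌊b⌋₊ - ⌊a⌋₊ : ℕ)) * (1 + (⌊b⌋₊ : ℝ)) := by positivity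
  -- Separated shells: the numerator error is bounded at the two endpoints. Otherwise `sharpQuot` is
  -- zero by definition, and the whole smoothed quotient is the error.
  by_cases hfar : ⌊a⌋₊ + 2 ≤ ⌊b⌋₊
  · have hne : a ≠ b := by rintro rfl; omega
    have hg := sq_sub_sq_ge ha hb hfar
    have hpos' : 0 < b ^ 2 - a ^ 2 := by linarith
    have hEa : decay N w lam a ≤ 2 ^ N * decay N w lam ⌊a⌋₊ := by
      have := decay_le_mul_decay N (lam := lam) (x := a) (y := ⌊a⌋₊) hw zero_le_one
        (by rw [abs_le]; constructor <;> linarith)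
      norm_num at this ⊢
      exact this
    have hEb : decay N w lam b ≤ 2 ^ N * decay N w lam ⌊b⌋₊ := by
      have := decay_le_mul_decay N (lam := lam) (x := b) (y := ⌊b⌋₊) hw zero_le_one
        (by rw [abs_le]; constructor <;> linarith)
      norm_num at this ⊢
      exact this
    have herr : |sqDiffQuot h a b - (if ⌊a⌋₊ + 2 ≤ ⌊b⌋₊ ∧ a ≤ lam ∧ lam < b then
        -(1 / (b ^ 2 - a ^ 2)) else 0)| ≤
        C * (decay N w lam a + decay N w lam b) / (b ^ 2 - a ^ 2) := by
      have e : sqDiffQuot h a b - (if ⌊a⌋₊ + 2 ≤ ⌊b⌋₊ ∧ a ≤ lam ∧ lam < b then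
          -(1 / (b ^ 2 - a ^ 2)) else 0) =
          ((h b - if b ≤ lam then 1 else 0) - (h a - if a ≤ lam then 1 else 0)) /
            (b ^ 2 - a ^ 2) := by
        rw [sqDiffQuot, if_neg hne, ← neg_sub (h b), ← neg_sub (b ^ 2), neg_div_neg_eq]
        by_cases h1 : a ≤ lam <;> by_cases h2 : b ≤ lam
        · rw [if_neg (fun hc => absurd h2 (not_le.2 hc.2.2)), if_pos h1, if_pos h2]; ring
        · rw [if_pos ⟨hfar, h1, not_le.1 h2⟩, if_pos h1, if_neg h2]; ring
        · exact absurd (hab.trans h2) h1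
        · rw [if_neg (fun hc => h1 hc.2.1), if_neg h1, if_neg h2]; ring
      rw [e, abs_div, abs_of_pos hpos']
      gcongr
      refine (abs_sub _ _).trans ?_
      have := hh a ha
      have := hh b hb
      linarith
    refine herr.trans ?_
    rw [div_le_div_iff₀ hpos' hden]
    have hnum : C * (decay N w lam a + decay N w lam b) * 5 ≤ 5 * 3 ^ N * (1 + 2 * C) *
        (decay N w lam ⌊a⌋₊ + decay N w lam ⌊b⌋₊ + if ⌊b⌋₊ ≤ 1 then 1 else 0) := by
      have h1 := hE ⌊a⌋₊
      have h2 := hE ⌊b⌋₊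
      calc _ ≤ C * (2 ^ N * decay N w lam ⌊a⌋₊ + 2 ^ N * decay N w lam ⌊b⌋₊) * 5 := by gcongr
        _ = 5 * 2 ^ N * C * (decay N w lam ⌊a⌋₊ + decay N w lam ⌊b⌋₊ + 0) := by ring
        _ ≤ _ := by
            gcongr
            · linarith
            · split_ifs <;> norm_num
    have hsum : 0 ≤ C * (decay N w lam a + decay N w lam b) :=
      mul_nonneg hC.le (add_nonneg (hE _) (hE _))
    nlinarith [mul_le_mul_of_nonneg_left hg hsum, mul_le_mul_of_nonneg_right hnum hpos'.le]
  · rw [if_neg (fun hc => hfar hc.1), sub_zero]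
    rw [le_div_iff₀ hden]
    have hβα : ((⌊b⌋₊ - ⌊a⌋₊ : ℕ) : ℝ) ≤ 1 := by
      have : ⌊b⌋₊ - ⌊a⌋₊ ≤ 1 := by omega
      exact_mod_cast this
    -- Near the origin `a + b` gives no help. Squared lengths are integers, so distinct ones differ
    -- by at least 1 and the quotient is bounded; the summand `if β ≤ 1` pays for it.
    by_cases hβ : ⌊b⌋₊ ≤ 1
    · have hβ' : (⌊b⌋₊ : ℝ) ≤ 1 := by exact_mod_cast hβ
      have hq : |sqDiffQuot h a b| ≤ 1 + 2 * C := by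
        rw [sqDiffQuot]
        split_ifs with h1 h2
        · rw [abs_div, abs_two]; linarith
        · have ha1 := hone a ha h2 ha2
          rw [abs_div, abs_of_pos (by linarith : 0 < 2 * a)]
          have h4 := (hh' a ha).trans (mul_le_of_le_one_right hC.le (decay_le_one N hw lam a))
          exact (div_le_self (abs_nonneg _) (by linarith)).trans (by linarith)
        · have h4 := (hh a ha).trans (mul_le_of_le_one_right hC.le (decay_le_one N hw lam a))
          have h5 := (hh b hb).trans (mul_le_of_le_one_right hC.le (decay_le_one N hw lam b))
          have h6 : 1 ≤ |a ^ 2 - b ^ 2| := by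
            obtain ⟨z, hz⟩ := ha2
            obtain ⟨z', hz'⟩ := hb2
            have hne : z - z' ≠ 0 := by
              intro h0
              have : a ^ 2 = b ^ 2 := by rw [hz, hz', sub_eq_zero.1 h0]
              exact h1 ((sq_eq_sq₀ ha hb).1 this)
            rw [hz, hz']
            exact_mod_cast Int.one_le_abs hne
          rw [abs_div]
          refine (div_le_self (abs_nonneg _) h6).trans ?_
          have h7 := abs_le.1 h4
          have h8 := abs_le.1 h5
          rw [abs_le]
          constructor <;> split_ifs at h7 h8 <;> linarith
      rw [if_pos hβ]
      have h1 := hE ⌊a⌋₊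
      have h2 := hE ⌊b⌋₊
      calc _ ≤ (1 + 2 * C) * ((1 + 1) * (1 + 1)) := by gcongr
        _ ≤ 5 * 1 * (1 + 2 * C) * (0 + 0 + 1) := by linarith
        _ ≤ _ := by gcongr
    · rw [if_neg hβ, add_zero]
      have hα1 : 1 ≤ ⌊a⌋₊ := by omega
      have hα1' : (1 : ℝ) ≤ ⌊a⌋₊ := by exact_mod_cast hα1
      have hβ2 : (2 : ℝ) ≤ ⌊b⌋₊ := by exact_mod_cast (by omega : 2 ≤ ⌊b⌋₊)
      have hba : (⌊b⌋₊ : ℝ) ≤ ⌊a⌋₊ + 1 := by exact_mod_cast (by omega : ⌊b⌋₊ ≤ ⌊a⌋₊ + 1)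
      -- All points between `a` and `b` lie within 2 of `⌊a⌋₊`, which accounts for `3 ^ N`. The mean
      -- value inequality then trades the small denominator `b - a` for `h'`, leaving `1/(a+b)`.
      have hder : ∀ c ∈ Set.Icc a b, |deriv h c| ≤ C * (3 ^ N * decay N w lam ⌊a⌋₊) := by
        intro c hc
        refine (hh' c (ha.trans hc.1)).trans ?_
        have := decay_le_mul_decay N (lam := lam) (x := c) (y := ⌊a⌋₊) hw zero_le_two
          (by rw [abs_le]; constructor <;> linarith [hc.1, hc.2])
        norm_num at this
        gcongr
      have hq : |sqDiffQuot h a b| ≤ C * (3 ^ N * decay N w lam ⌊a⌋₊) / (a + b) := by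
        rw [sqDiffQuot]
        split_ifs with h1 h2
        · linarith
        · rw [← h1, abs_div, abs_of_pos (by linarith : 0 < 2 * a), ← two_mul]
          gcongr
          exact hder a ⟨le_rfl, hab⟩
        · have hlt : a < b := lt_of_le_of_ne hab h1
          have hmv := Convex.norm_image_sub_le_of_norm_deriv_le (f := h) (s := Set.Icc a b)
            (fun x _ => hd x) hder (convex_Icc a b) ⟨le_rfl, hab⟩ ⟨hab, le_rfl⟩
          rw [Real.norm_eq_abs, Real.norm_eq_abs, abs_of_pos (by linarith : 0 < b - a)] at hmv
          rw [← neg_sub (h b), ← neg_sub (b ^ 2), neg_div_neg_eq, abs_div, sq_sub_sq, abs_mul,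
            abs_of_pos (by linarith : 0 < b + a), abs_of_pos (by linarith : 0 < b - a),
            add_comm b a, mul_comm (a + b), ← div_div]
          gcongr
          rw [div_le_iff₀ (by linarith)]
          exact hmv
      have h1 := hE ⌊a⌋₊
      have h2 := hE ⌊b⌋₊
      have hab2 : 1 + (⌊b⌋₊ : ℝ) ≤ 2 * (a + b) := by linarith
      have hab0 : 0 < a + b := by linarith
      calc _ ≤ C * (3 ^ N * decay N w lam ⌊a⌋₊) / (a + b) * ((1 + 1) * (2 * (a + b))) := by
            gcongr
        _ = 4 * 3 ^ N * C * (decay N w lam ⌊a⌋₊ + 0) := by field_simp; ring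
        _ ≤ _ := by
            gcongr
            · norm_num
            · linarith

end TorusWeyl

/-! ### Sizes of the lattice sums, and pairs of maximal contribution -/

namespace TorusWeyl

open scoped FourierTransform

theorem shellPairSum_const_mul (d : ℕ) (η : ℝ) {c : ℝ} (hc : 0 ≤ c) (A : ℕ → ℕ → ℝ) :
    shellPairSum d η (fun α β => c * A α β) = ENNReal.ofReal c * shellPairSum d η A := by
  simp only [shellPairSum, ← ENNReal.tsum_mul_left]
  refine tsum_congr fun α => tsum_congr fun e => ?_
  rw [← ENNReal.ofReal_mul hc]
  congr 1; ring

theorem shellPairSum_add (d : ℕ) (η : ℝ) {A B : ℕ → ℕ → ℝ} (hA : ∀ α β, 0 ≤ A α β)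
    (hB : ∀ α β, 0 ≤ B α β) :
    shellPairSum d η (fun α β => A α β + B α β) = shellPairSum d η A + shellPairSum d η B := by
  simp only [shellPairSum, ← ENNReal.tsum_add]
  refine tsum_congr fun α => tsum_congr fun e => ?_
  have h1 := hA α (α + e)
  have h2 := hB α (α + e)
  rw [← ENNReal.ofReal_add (by positivity) (by positivity)]
  congr 1; ring

/-- The smoothing error lives on about `w` shells near `lam` with `λ^d` points each, and `w λ^d =
λ^{d+1-η-ε}`. The width of the cutoff is what gains the factor `λ^{-ε}`. -/
theorem shellPairSum_decay_le (d : ℕ) {η ε : ℝ} (h0 : 0 < η) (h1 : η < 1) (hε : 0 < ε)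
    (hηε : η + ε < 1) {K : ℝ} (hK : 0 ≤ K) :
    ∃ C : ℝ, 0 < C ∧ ∀ lam : ℝ, 1 ≤ lam →
      shellPairSum d η (fun α β => K * (decay (d + 2) (lam ^ (1 - η - ε)) lam α +
        decay (d + 2) (lam ^ (1 - η - ε)) lam β + if β ≤ 1 then 1 else 0)) ≤
      ENNReal.ofReal (C * lam ^ (d + 1 - η - ε)) := by
  have hη : 0 < 1 + η⁻¹ := by positivity
  refine ⟨K * (2 * ((1 + η⁻¹) * 2 ^ (d + 2)) + (1 + η⁻¹) * (2 * 2 ^ d)) + 1, by positivity,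
    fun lam hlam => ?_⟩
  have hl0 : 0 < lam := by linarith
  set w := lam ^ (1 - η - ε)
  have hw : 1 ≤ w := Real.one_le_rpow hlam (by linarith)
  have hwl : w ≤ lam := by
    calc w ≤ lam ^ (1 : ℝ) := Real.rpow_le_rpow_of_exponent_le hlam (by linarith)
      _ = lam := Real.rpow_one _
  have hE : ∀ τ, 0 ≤ decay (d + 2) w lam τ := decay_nonneg _ (by linarith) lam
  have hwd : w * lam ^ d = lam ^ (d + 1 - η - ε) := by
    rw [← Real.rpow_natCast, ← Real.rpow_add hl0]; congr 1; ring
  have hS := tsum_pow_mul_decay_le d hw hwl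
  rw [hwd] at hS
  set X := lam ^ (d + 1 - η - ε)
  have hX : 1 ≤ X := Real.one_le_rpow hlam (by
    linarith [(Nat.cast_nonneg d : (0 : ℝ) ≤ d)])
  have hi : ∀ β : ℕ, (0 : ℝ) ≤ if β ≤ 1 then 1 else 0 := fun β => by split_ifs <;> norm_num
  rw [shellPairSum_const_mul d η hK,
    shellPairSum_add d η (A := fun α β => decay (d + 2) w lam α + decay (d + 2) w lam β)
      (B := fun _ β => if β ≤ 1 then 1 else 0)
      (fun α β => add_nonneg (hE _) (hE _)) (fun _ β => hi β),
    shellPairSum_add d η (A := fun α _ => decay (d + 2) w lam α)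
      (B := fun _ β => decay (d + 2) w lam β) (fun _ _ => hE _) (fun _ _ => hE _)]
  have hL := shellPairSum_le_of_le_left (d := d) h0 h1 (A := fun α _ => decay (d + 2) w lam α)
    (F := fun α => decay (d + 2) w lam α) (fun _ => hE _) (fun _ _ => le_rfl)
  have hR := shellPairSum_le_of_le_right (d := d) h0 h1 (A := fun _ β => decay (d + 2) w lam β)
    (F := fun α => decay (d + 2) w lam α) (fun _ => hE _) (fun _ _ => le_rfl)
  have hL' := hL.trans (mul_le_mul' le_rfl hS)
  have hR' := hR.trans (mul_le_mul' le_rfl hS)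
  rw [← ENNReal.ofReal_mul hη.le] at hL' hR'
  have hW : shellPairSum d η (fun _ β => if β ≤ 1 then 1 else 0) ≤
      ENNReal.ofReal ((1 + η⁻¹) * (2 * 2 ^ d)) := by
    have h2 := shellPairSum_le_of_le_left (d := d) h0 h1
      (A := fun α β => if β ≤ 1 then 1 else 0) (F := fun α => if α ≤ 1 then 1 else 0)
      (fun α => hi α) (fun α e => by split_ifs <;> first | omega | norm_num)
    refine h2.trans ?_
    rw [ENNReal.ofReal_mul hη.le]
    gcongr
    rw [tsum_eq_sum (s := Finset.range 2) (fun α hα => by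
      rw [Finset.mem_range] at hα
      rw [if_neg (by omega)]; simp)]
    rw [Finset.sum_range_succ, Finset.sum_range_one, ← ENNReal.ofReal_add (by positivity)
      (by positivity)]
    refine ENNReal.ofReal_le_ofReal ?_
    have : (1 : ℝ) ≤ 2 ^ d := one_le_pow₀ (by norm_num)
    norm_num
    linarith
  calc _ ≤ ENNReal.ofReal K * (ENNReal.ofReal ((1 + η⁻¹) * (2 ^ (d + 2) * X)) +
        ENNReal.ofReal ((1 + η⁻¹) * (2 ^ (d + 2) * X)) +
        ENNReal.ofReal ((1 + η⁻¹) * (2 * 2 ^ d))) := by gcongr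
    _ = ENNReal.ofReal (K * ((1 + η⁻¹) * (2 ^ (d + 2) * X) + (1 + η⁻¹) * (2 ^ (d + 2) * X) +
        (1 + η⁻¹) * (2 * 2 ^ d))) := by
        rw [ENNReal.ofReal_mul hK, ENNReal.ofReal_add (by positivity) (by positivity),
          ENNReal.ofReal_add (by positivity) (by positivity)]
    _ ≤ _ := by
        refine ENNReal.ofReal_le_ofReal ?_
        have h3 : (1 + η⁻¹) * (2 * 2 ^ d) ≤ (1 + η⁻¹) * (2 * 2 ^ d) * X :=
          le_mul_of_one_le_right (by positivity) hX
        calc _ ≤ K * ((1 + η⁻¹) * (2 ^ (d + 2) * X) + (1 + η⁻¹) * (2 ^ (d + 2) * X) +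
              (1 + η⁻¹) * (2 * 2 ^ d) * X) := by gcongr
          _ = K * (2 * ((1 + η⁻¹) * 2 ^ (d + 2)) + (1 + η⁻¹) * (2 * 2 ^ d)) * X := by ring
          _ ≤ _ := by gcongr; linarith

theorem one_add_floor_le {lam : ℝ} (h : 1 ≤ lam) : 1 + (⌊lam⌋₊ : ℝ) ≤ 2 * lam := by
  have := Nat.floor_le (by linarith : 0 ≤ lam)
  linarith

theorem summable_and_tsum_le_of_ofReal {ι : Type*} {f : ι → ℝ} {B : ℝ} (hf : ∀ i, 0 ≤ f i)
    (hB : 0 ≤ B) (h : ∑' i, ENNReal.ofReal (f i) ≤ ENNReal.ofReal B) :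
    Summable f ∧ ∑' i, f i ≤ B := by
  have hs : ∀ s : Finset ι, ∑ i ∈ s, f i ≤ B := fun s => by
    have := (ENNReal.sum_le_tsum s).trans h
    rwa [← ENNReal.ofReal_sum_of_nonneg (fun i _ => hf i), ENNReal.ofReal_le_ofReal_iff hB] at this
  exact ⟨summable_of_sum_le hf hs, Real.tsum_le_of_sum_le hf hs⟩

/-- The three lattice sums that control the first-order Duhamel term. -/
theorem exists_lattice_sum_bounds {d : ℕ} (hd : 1 ≤ d) {η ε : ℝ} (h0 : 0 < η) (h1 : η < 1)
    (hε : 0 < ε) (hηε : η + ε < 1) {K : ℝ} (hK : 0 ≤ K) (M : ℕ) :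
    ∃ C : ℝ, 0 < C ∧ ∀ lam : ℝ, 1 ≤ lam →
      ∀ A : ℕ → ℕ → ℝ, ∀ e : ℝ,
        ((A = fun α β : ℕ => K * (decay (d + 2) (lam ^ (1 - η - ε)) lam α +
          decay (d + 2) (lam ^ (1 - η - ε)) lam β + if β ≤ 1 then 1 else 0)) ∧
            e = d + 1 - η - ε ∨
          (A = fun α β => 5 * if α ≤ ⌊lam⌋₊ ∧ ⌊lam⌋₊ ≤ β then 1 else 0) ∧ e = d + 1 - η ∨
          (A = fun α _ => 5 * if α ≤ ⌊lam⌋₊ ∧ ⌊lam⌋₊ ≤ α + M then 1 else 0) ∧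
            e = d + 1 - η - ε) →
        (∀ α β, 0 ≤ A α β) ∧
        Summable (fun p : (Fin (d + 1) → ℤ) × (Fin (d + 1) → ℤ) =>
          shellWeight A ⌊latticeNorm p.1⌋₊ ⌊latticeNorm p.2⌋₊ *
            (1 + latticeNorm (p.1 - p.2)) ^ (-(d - 1 + η))) ∧
        ∑' p : (Fin (d + 1) → ℤ) × (Fin (d + 1) → ℤ),
          shellWeight A ⌊latticeNorm p.1⌋₊ ⌊latticeNorm p.2⌋₊ *
            (1 + latticeNorm (p.1 - p.2)) ^ (-(d - 1 + η)) ≤ C * lam ^ e := by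
  obtain ⟨C₀, hC₀, hmain⟩ := tsum_shellWeight_le hd h0 h1
  obtain ⟨C₁, hC₁, hdec⟩ := shellPairSum_decay_le d h0 h1 hε hηε hK
  have h1' : 0 < 1 - η := by linarith
  set C₂ : ℝ := 5 * ((1 + η⁻¹) * (1 - η)⁻¹ * 2 ^ (d + 1 - η)) with hC₂
  set C₃ : ℝ := 5 * ((1 + η⁻¹) * ((M + 1) * 2 ^ d)) with hC₃
  have hC₂p : 0 < C₂ := by positivity
  have hC₃p : 0 < C₃ := by positivity
  refine ⟨C₀ * (C₁ + C₂ + C₃), by positivity, fun lam hlam A e hcase => ?_⟩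
  have hl0 : 0 < lam := by linarith
  have hfl := one_add_floor_le hlam
  have hi : ∀ P : Prop, [Decidable P] → (0 : ℝ) ≤ if P then 1 else 0 := fun P _ => by
    split_ifs <;> norm_num
  have hA : (∀ α β, 0 ≤ A α β) ∧
      shellPairSum d η A ≤ ENNReal.ofReal ((C₁ + C₂ + C₃) * lam ^ e) := by
    rcases hcase with ⟨rfl, rfl⟩ | ⟨rfl, rfl⟩ | ⟨rfl, rfl⟩
    · refine ⟨fun α β => ?_, (hdec lam hlam).trans (ENNReal.ofReal_le_ofReal ?_)⟩
      · exact mul_nonneg hK (add_nonneg (add_nonneg (decay_nonneg _ (by positivity) _ _)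
          (decay_nonneg _ (by positivity) _ _)) (hi _))
      · gcongr; linarith
    · refine ⟨fun α β => mul_nonneg (by norm_num) (hi _), ?_⟩
      rw [shellPairSum_const_mul d η (by norm_num)]
      refine (mul_le_mul' le_rfl (shellPairSum_straddle_le h0 h1 _)).trans ?_
      rw [← ENNReal.ofReal_mul (by norm_num)]
      refine ENNReal.ofReal_le_ofReal ?_
      have hd0 : (0 : ℝ) ≤ d := Nat.cast_nonneg d
      calc _ ≤ 5 * ((1 + η⁻¹) * (1 - η)⁻¹ * (2 * lam) ^ (d + 1 - η)) := by
            gcongr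
            linarith
        _ = C₂ * lam ^ (d + 1 - η) := by
            rw [Real.mul_rpow zero_le_two hl0.le, hC₂]; ring
        _ ≤ _ := by gcongr; linarith
    · refine ⟨fun α β => mul_nonneg (by norm_num) (hi _), ?_⟩
      rw [shellPairSum_const_mul d η (by norm_num)]
      refine (mul_le_mul' le_rfl (shellPairSum_window_le h0 h1 _ _)).trans ?_
      rw [← ENNReal.ofReal_mul (by norm_num)]
      refine ENNReal.ofReal_le_ofReal ?_
      calc _ ≤ 5 * ((1 + η⁻¹) * ((M + 1) * (2 * lam) ^ d)) := by gcongr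
        _ = C₃ * lam ^ (d : ℝ) := by rw [mul_pow, hC₃, Real.rpow_natCast]; ring
        -- The exponent `d` is the smaller one because `η + ε < 1`.
        _ ≤ (C₁ + C₂ + C₃) * lam ^ (d + 1 - η - ε) := by
            gcongr
            · linarith
            · linarith
  refine ⟨hA.1, summable_and_tsum_le_of_ofReal (fun p => ?_) (by positivity) ?_⟩
  · have := latticeNorm_nonneg (p.1 - p.2)
    exact mul_nonneg (shellWeight_nonneg hA.1 _ _) (by positivity)
  · refine (hmain A hA.1).trans ((mul_le_mul' le_rfl hA.2).trans ?_)
    rw [← ENNReal.ofReal_mul hC₀.le, mul_assoc]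

theorem latticeNorm_le_of_abs_le {n : ℕ} {k : Fin n → ℤ} {B : ℝ} (hB : 0 ≤ B)
    (h : ∀ i, |(k i : ℝ)| ≤ B) : latticeNorm k ≤ n * B := by
  rw [latticeNorm, Real.sqrt_le_left (by positivity)]
  calc ∑ i, (k i : ℝ) ^ 2 ≤ ∑ _i : Fin n, B ^ 2 :=
        Finset.sum_le_sum fun i _ => sq_le_sq' (abs_le.1 (h i)).1 (abs_le.1 (h i)).2
    _ = n * B ^ 2 := by simp
    _ ≤ (n * B) ^ 2 := by
        rw [mul_pow]
        gcongr
        exact_mod_cast Nat.le_self_pow two_ne_zero n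

theorem latticeNorm_nsq_int {n : ℕ} (k : Fin n → ℤ) : ∃ z : ℤ, latticeNorm k ^ 2 = z :=
  ⟨_, latticeNorm_sq k⟩

theorem latticeNorm_triangle {n : ℕ} (j k : Fin n → ℤ) :
    latticeNorm k ≤ latticeNorm j + latticeNorm (j - k) := by
  have hN : ∀ m : Fin n → ℤ, latticeNorm m = ‖(WithLp.toLp 2 fun i => (m i : ℝ) :
      EuclideanSpace ℝ (Fin n))‖ := fun m => by
    rw [EuclideanSpace.norm_eq, latticeNorm]; simp
  rw [hN, hN, hN]
  have := norm_sub_le (WithLp.toLp 2 fun i => (j i : ℝ) : EuclideanSpace ℝ (Fin n))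
    (WithLp.toLp 2 fun i => ((j - k) i : ℝ))
  refine le_trans (le_of_eq ?_) this
  congr 1
  ext i
  simp

/-- Many pairs of lattice points, one well inside and one well outside the ball of radius `lam`. -/
theorem exists_core {d : ℕ} {lam : ℝ} (hlam : 8 ≤ lam) :
    ∃ S : Finset ((Fin (d + 1) → ℤ) × (Fin (d + 1) → ℤ)),
      (lam / (2 * (d + 1))) ^ (2 * (d + 1)) ≤ S.card ∧
      ∀ p ∈ S, lam ≤ latticeNorm (p.1 - p.2) ∧
        latticeNorm (p.1 - p.2) ≤ 4 * (d + 1) * lam ∧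
        1 / (16 * (d + 1) ^ 2 * lam ^ 2) ≤
          -sharpQuot lam (latticeNorm p.1) (latticeNorm p.2) := by
  have hl0 : 0 < lam := by linarith
  set n : ℝ := (d : ℝ) + 1 with hn
  have hn1 : 1 ≤ n := by linarith [(Nat.cast_nonneg d : (0 : ℝ) ≤ d)]
  -- A cube of side `t` at the origin stays in the ball of radius `lam/2`; a translate whose
  -- coordinates are all at least `2 lam` stays outside the ball of radius `2 lam`.
  set t : ℕ := ⌊lam / (2 * n)⌋₊ with ht
  set T : ℕ := ⌈2 * lam⌉₊ with hT
  have ht1 : (t : ℝ) ≤ lam / (2 * n) := Nat.floor_le (by positivity)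
  have ht2 : lam / (2 * n) < t + 1 := Nat.lt_floor_add_one _
  have hT1 : 2 * lam ≤ T := Nat.le_ceil _
  have hT2 : (T : ℝ) < 2 * lam + 1 := Nat.ceil_lt_add_one (by positivity)
  have htl : (t : ℝ) ≤ lam / 2 := ht1.trans (by
    rw [div_le_div_iff₀ (by positivity) (by norm_num)]; nlinarith)
  set J := Fintype.piFinset fun _ : Fin (d + 1) => Finset.Icc (0 : ℤ) t
  set Q := Fintype.piFinset fun _ : Fin (d + 1) => Finset.Icc (T : ℤ) (T + t)
  have hJ : J.card = (t + 1) ^ (d + 1) := by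
    rw [Fintype.card_piFinset_const, Int.card_Icc]; congr 1
  have hQ : Q.card = (t + 1) ^ (d + 1) := by
    rw [Fintype.card_piFinset_const, Int.card_Icc]; congr 1; omega
  refine ⟨J ×ˢ Q, ?_, fun p hp => ?_⟩
  · rw [Finset.card_product, hJ, hQ, ← pow_add]
    push_cast
    rw [two_mul (d + 1)]
    gcongr
  · rw [Finset.mem_product, Fintype.mem_piFinset, Fintype.mem_piFinset] at hp
    have hj : ∀ i, (0 : ℝ) ≤ p.1 i ∧ (p.1 i : ℝ) ≤ t := fun i => by
      have := Finset.mem_Icc.1 (hp.1 i)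
      exact ⟨by exact_mod_cast this.1, by exact_mod_cast this.2⟩
    have hk : ∀ i, (T : ℝ) ≤ p.2 i ∧ (p.2 i : ℝ) ≤ T + t := fun i => by
      have := Finset.mem_Icc.1 (hp.2 i)
      exact ⟨by exact_mod_cast this.1, by exact_mod_cast this.2⟩
    have hcast : ((d + 1 : ℕ) : ℝ) = n := by push_cast; rfl
    have hj1 : latticeNorm p.1 ≤ lam / 2 := by
      have := latticeNorm_le_of_abs_le (k := p.1) (Nat.cast_nonneg t) (fun i => by
        rw [abs_of_nonneg (hj i).1]; exact (hj i).2)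
      rw [hcast] at this
      refine this.trans ?_
      calc n * t ≤ n * (lam / (2 * n)) := by gcongr
        _ = lam / 2 := by field_simp
    have hk1 : 2 * lam ≤ latticeNorm p.2 := by
      refine hT1.trans ((hk 0).1.trans ((le_abs_self _).trans (abs_coord_le_latticeNorm p.2 0)))
    have hk2 : latticeNorm p.2 ≤ 4 * n * lam := by
      have := latticeNorm_le_of_abs_le (k := p.2) (B := 4 * lam) (by positivity) (fun i => by
        rw [abs_of_nonneg (le_trans (Nat.cast_nonneg T) (hk i).1)]
        linarith [(hk i).2])
      rw [hcast] at this
      linarith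
    have htri := latticeNorm_triangle p.1 p.2
    have hj0 := latticeNorm_nonneg p.1
    refine ⟨by linarith, ?_, ?_⟩
    · have := latticeNorm_le_of_abs_le (k := p.1 - p.2) (B := 4 * lam) (by positivity) (fun i => by
        simp only [Pi.sub_apply, Int.cast_sub]
        rw [abs_le]
        constructor <;> linarith [(hk i).1, (hk i).2, (hj i).1, (hj i).2])
      rw [hcast] at this
      linarith
    · have hle : latticeNorm p.1 ≤ latticeNorm p.2 := by linarith
      have hfl : ⌊latticeNorm p.1⌋₊ + 2 ≤ ⌊latticeNorm p.2⌋₊ := by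
        refine Nat.le_floor ?_
        push_cast
        linarith [Nat.floor_le hj0]
      rw [sharpQuot, min_eq_left hle, max_eq_right hle, if_pos ⟨hfl, by linarith, by linarith⟩,
        neg_neg]
      have hlt : latticeNorm p.1 < latticeNorm p.2 := by linarith
      have hpos : 0 < latticeNorm p.2 ^ 2 - latticeNorm p.1 ^ 2 := by nlinarith
      gcongr
      calc latticeNorm p.2 ^ 2 - latticeNorm p.1 ^ 2 ≤ latticeNorm p.2 ^ 2 := by
            linarith [sq_nonneg (latticeNorm p.1)]
        _ ≤ (4 * n * lam) ^ 2 := by gcongr; exact latticeNorm_nonneg p.2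
        _ = _ := by ring

end TorusWeyl

/-! ### Upper and lower bounds for the Duhamel term -/

namespace TorusWeyl

open scoped FourierTransform

theorem neg_sharpQuot_nonneg {lam a b : ℝ} (ha : 0 ≤ a) (hb : 0 ≤ b) : 0 ≤ -sharpQuot lam a b := by
  rw [sharpQuot]
  split_ifs with h
  · rw [neg_neg]
    have h1 : 0 ≤ min a b := le_min ha hb
    have h2 : min a b < max a b := h.2.1.trans_lt h.2.2
    have : 0 < max a b ^ 2 - min a b ^ 2 := by nlinarith
    positivity
  · simp

set_option maxHeartbeats 1000000 in
/-- Absolute convergence of the first-order Duhamel term, its upper bound, and its lower bound at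
`x₀` up to a term of lower order. -/
theorem duhamel_bounds {d : ℕ} (hd : 1 ≤ d) {x₀ : Torus (d + 1)} {η ε : ℝ} (h0 : 0 < η)
    (h1 : η < 1) (hε : 0 < ε) (hηε : η + ε < 1) {ρ φ : ℝ → ℝ} (hρ : ContDiff ℝ ∞ ρ)
    (hs : ∀ r, π ≤ r → ρ r = 0) {B : ℝ} (hB : ∀ r, |ρ r| ≤ B) (hρ0 : ρ 0 ≠ 0)
    (hφ : ContDiff ℝ ∞ φ) (hc : HasCompactSupport φ) (hφ0 : φ 0 = 1) :
    ∃ C c C' Λ : ℝ, 0 < C ∧ 0 < c ∧ 0 < C' ∧ 1 ≤ Λ ∧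
      (∀ lam : ℝ, 1 ≤ lam → ∀ x,
        Summable (duhamelTerm (cutoff φ η ε lam) (potential ρ η x₀) x) ∧
        ‖R₁ φ ρ η ε x₀ lam x‖ ≤ C * lam ^ (d + 1 - η)) ∧
      (∀ lam : ℝ, Λ ≤ lam →
        c * lam ^ (d + 1 - η) - C' * lam ^ (d + 1 - η - ε) ≤ ‖R₁ φ ρ η ε x₀ lam x₀‖) := by
  obtain ⟨Cq, hCq, hcut⟩ := exists_cutoff_bounds hφ hc hφ0 (d + 2)
  obtain ⟨Cv, cv, Mv, hCv, hcv, hv, hv'⟩ := exists_coefficient_bounds (n := d + 1) (by omega)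
    hρ hs hB hρ0 h0 h1
  have hse : -(((d + 1 : ℕ) : ℝ) - 2 + η) = -(d - 1 + η) := by push_cast; ring
  rw [hse] at hv hv'
  set K : ℝ := 5 * 3 ^ (d + 2) * (1 + 2 * Cq) with hK
  -- Lengths of two points closer than `Mv` have integer parts at most `M` apart.
  set M : ℕ := ⌈Mv⌉₊ + 1 with hM
  obtain ⟨Cs, hCs, hlat⟩ := exists_lattice_sum_bounds hd h0 h1 hε hηε (K := K) (by positivity) M
  have hd0 : (0 : ℝ) ≤ d := Nat.cast_nonneg d
  have hd1 : (1 : ℝ) ≤ d := by exact_mod_cast hd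
  have hρa : 0 < |ρ 0| := abs_pos.2 hρ0
  have hρc : (ρ 0 : ℂ) ≠ 0 := by exact_mod_cast hρ0
  set s : ℝ := d - 1 + η with hsdef
  have hs0 : 0 < s := by linarith
  set v : (Fin (d + 1) → ℤ) → ℂ := fun m =>
    𝓕 (radialPow ρ (2 - η) 1 : EuclideanSpace ℝ (Fin (d + 1)) → ℂ) (freq m) with hvdef
  set U : (Fin (d + 1) → ℤ) × (Fin (d + 1) → ℤ) → ℝ := fun p =>
    (1 + latticeNorm (p.1 - p.2)) ^ (-s) with hU
  have hUn : ∀ p, 0 ≤ U p := fun p => by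
    have := latticeNorm_nonneg (p.1 - p.2)
    positivity
  set κ : ℝ := 1 / (16 * ((d : ℝ) + 1) ^ 2) * cv * (5 * (d + 1)) ^ (-s) *
    (1 / (2 * (d + 1))) ^ (2 * (d + 1)) with hκ
  have hκp : 0 < κ := by positivity
  have key : ∀ lam : ℝ, 1 ≤ lam →
      (∀ x, Summable (duhamelTerm (cutoff φ η ε lam) (potential ρ η x₀) x) ∧
        ‖R₁ φ ρ η ε x₀ lam x‖ ≤ Cv * (2 * Cs) * lam ^ (d + 1 - η)) ∧
      (max 8 Mv ≤ lam → |ρ 0| * κ * lam ^ (d + 1 - η) -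
        Cv * (2 * Cs) * lam ^ (d + 1 - η - ε) ≤ ‖R₁ φ ρ η ε x₀ lam x₀‖) := by
    intro lam hlam
    have hl0 : 0 < lam := by linarith
    have hw : 1 ≤ lam ^ (1 - η - ε) := Real.one_le_rpow hlam (by linarith)
    obtain ⟨hh, hdiff, hh', hh2⟩ := hcut η ε lam hl0.le hw
    -- The three weights: smoothing error, straddling pairs, and straddling pairs close to the
    -- sphere. Only the second has the full order `λ^{d+1-η}`.
    have hA0 := hlat lam hlam _ _ (Or.inl ⟨rfl, rfl⟩)
    have hA1 := hlat lam hlam _ _ (Or.inr (Or.inl ⟨rfl, rfl⟩))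
    have hA2 := hlat lam hlam _ _ (Or.inr (Or.inr ⟨rfl, rfl⟩))
    set A0 : ℕ → ℕ → ℝ := fun α β => K * (decay (d + 2) (lam ^ (1 - η - ε)) lam α +
      decay (d + 2) (lam ^ (1 - η - ε)) lam β + if β ≤ 1 then 1 else 0) with hA0d
    set A1 : ℕ → ℕ → ℝ := fun α β => 5 * if α ≤ ⌊lam⌋₊ ∧ ⌊lam⌋₊ ≤ β then 1 else 0 with hA1d
    set A2 : ℕ → ℕ → ℝ := fun α _ => 5 * if α ≤ ⌊lam⌋₊ ∧ ⌊lam⌋₊ ≤ α + M then 1 else 0 with hA2d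
    obtain ⟨hA0n, hS0, hT0⟩ := hA0
    obtain ⟨hA1n, hS1, hT1⟩ := hA1
    obtain ⟨hA2n, hS2, hT2⟩ := hA2
    set h := cutoff φ η ε lam with hhdef
    set q : (Fin (d + 1) → ℤ) × (Fin (d + 1) → ℤ) → ℝ := fun p =>
      sqDiffQuot h (latticeNorm p.1) (latticeNorm p.2) with hq
    set qs : (Fin (d + 1) → ℤ) × (Fin (d + 1) → ℤ) → ℝ := fun p =>
      sharpQuot lam (latticeNorm p.1) (latticeNorm p.2) with hqs
    set W0 := fun p : (Fin (d + 1) → ℤ) × (Fin (d + 1) → ℤ) =>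
      shellWeight A0 ⌊latticeNorm p.1⌋₊ ⌊latticeNorm p.2⌋₊ * U p with hW0
    set W1 := fun p : (Fin (d + 1) → ℤ) × (Fin (d + 1) → ℤ) =>
      shellWeight A1 ⌊latticeNorm p.1⌋₊ ⌊latticeNorm p.2⌋₊ * U p with hW1
    set W2 := fun p : (Fin (d + 1) → ℤ) × (Fin (d + 1) → ℤ) =>
      shellWeight A2 ⌊latticeNorm p.1⌋₊ ⌊latticeNorm p.2⌋₊ * U p with hW2
    change Summable W0 at hS0
    change ∑' p, W0 p ≤ _ at hT0
    change Summable W1 at hS1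
    change ∑' p, W1 p ≤ _ at hT1
    change Summable W2 at hS2
    change ∑' p, W2 p ≤ _ at hT2
    have hr : ∀ p, |q p - qs p| ≤ shellWeight A0 ⌊latticeNorm p.1⌋₊ ⌊latticeNorm p.2⌋₊ := fun p =>
      abs_sqDiffQuot_sub_sharpQuot_le hw hCq hh hdiff hh' hh2 (latticeNorm_nonneg _)
        (latticeNorm_nonneg _) (latticeNorm_nsq_int _) (latticeNorm_nsq_int _)
    have hqs1 : ∀ p, |qs p| ≤ shellWeight A1 ⌊latticeNorm p.1⌋₊ ⌊latticeNorm p.2⌋₊ := fun p =>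
      abs_sharpQuot_le (latticeNorm_nonneg _) (latticeNorm_nonneg _) hA1n (fun ha hb => by
        simp only [hA1d, if_pos (And.intro ha hb)]; norm_num)
    have hterm : ∀ x p, duhamelTerm h (potential ρ η x₀) x p = (q p : ℂ) * v (p.1 - p.2) *
        (eigenfun (p.1 - p.2) x * conj (eigenfun (p.1 - p.2) x₀)) :=
      fun x p => duhamelTerm_eq hρ.continuous hs h η x₀ x p
    have hvU : ∀ p : (Fin (d + 1) → ℤ) × (Fin (d + 1) → ℤ), ‖v (p.1 - p.2)‖ ≤ Cv * U p :=
      fun p => hv _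
    have hnorm : ∀ x p, ‖duhamelTerm h (potential ρ η x₀) x p‖ ≤ Cv * (W0 p + W1 p) := by
      intro x p
      rw [hterm, norm_mul, norm_mul, norm_mul, RCLike.norm_conj, norm_eigenfun, norm_eigenfun,
        mul_one, mul_one, Complex.norm_real, Real.norm_eq_abs]
      have h3 : |q p| ≤ shellWeight A0 ⌊latticeNorm p.1⌋₊ ⌊latticeNorm p.2⌋₊ +
          shellWeight A1 ⌊latticeNorm p.1⌋₊ ⌊latticeNorm p.2⌋₊ := by
        have := abs_add_le (q p - qs p) (qs p)
        rw [sub_add_cancel] at this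
        linarith [hr p, hqs1 p]
      calc _ ≤ (shellWeight A0 ⌊latticeNorm p.1⌋₊ ⌊latticeNorm p.2⌋₊ +
            shellWeight A1 ⌊latticeNorm p.1⌋₊ ⌊latticeNorm p.2⌋₊) * (Cv * U p) :=
            mul_le_mul h3 (hvU p) (norm_nonneg _) ((abs_nonneg _).trans h3)
        _ = _ := by rw [hW0, hW1]; ring
    have hdom : Summable fun p => Cv * (W0 p + W1 p) := (hS0.add hS1).mul_left Cv
    have hsum : ∀ x, Summable (duhamelTerm h (potential ρ η x₀) x) := fun x =>
      Summable.of_norm_bounded hdom (hnorm x)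
    have hpow : lam ^ (d + 1 - η - ε) ≤ lam ^ (d + 1 - η) :=
      Real.rpow_le_rpow_of_exponent_le hlam (by linarith)
    refine ⟨fun x => ⟨hsum x, ?_⟩, fun hbig => ?_⟩
    · rw [R₁]
      refine (tsum_of_norm_bounded hdom.hasSum (hnorm x)).trans ?_
      rw [tsum_mul_left, hS0.tsum_add hS1]
      calc _ ≤ Cv * (Cs * lam ^ (d + 1 - η) + Cs * lam ^ (d + 1 - η)) := by
            gcongr
            exact hT0.trans (by gcongr)
        _ = _ := by ring
    · have hb8 : 8 ≤ lam := (le_max_left _ _).trans hbig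
      have hbM : Mv ≤ lam := (le_max_right _ _).trans hbig
      obtain ⟨S, hScard, hS⟩ := exists_core (d := d) hb8
      set u : (Fin (d + 1) → ℤ) × (Fin (d + 1) → ℤ) → ℝ := fun p =>
        (v (p.1 - p.2) / ρ 0).re with hu
      set D : ℝ := Cv / |ρ 0| with hD
      have hDp : 0 < D := by positivity
      have huU : ∀ p, |u p| ≤ D * U p := fun p => by
        refine (Complex.abs_re_le_norm _).trans ?_
        rw [norm_div, Complex.norm_real, Real.norm_eq_abs, hD, div_mul_eq_mul_div]
        gcongr
        exact hvU p
      -- At `x = x₀` the two exponentials cancel, so only the real part of the normalized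
      -- coefficient enters.
      have hF : ∀ p, (duhamelTerm h (potential ρ η x₀) x₀ p / ρ 0).re = q p * u p := by
        intro p
        rw [hterm, Complex.mul_conj, Complex.normSq_eq_norm_sq, norm_eigenfun, one_pow,
          Complex.ofReal_one, mul_one, mul_div_assoc, Complex.re_ofReal_mul]
      have hFs : Summable fun p => q p * u p := by
        simp_rw [← hF]
        exact Complex.reCLM.summable ((hsum x₀).div_const _)
      have hRe : (R₁ φ ρ η ε x₀ lam x₀ / ρ 0).re = ∑' p, q p * u p := by
        simp_rw [← hF]
        rw [R₁, ← tsum_div_const]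
        exact Complex.reCLM.map_tsum ((hsum x₀).div_const _)
      set κ' : ℝ := 1 / (16 * ((d : ℝ) + 1) ^ 2 * lam ^ 2) * (cv * (5 * (d + 1) * lam) ^ (-s))
        with hκ'
      have hκ'0 : 0 ≤ κ' := by positivity
      -- For `|j-k| ≥ Mv` both factors are nonnegative, so pairs outside `S` may be dropped. For
      -- `|j-k| < Mv` the sign of `u` is unknown and the term is charged to `W2`; such pairs are not
      -- in `S`, since there `|j-k| ≥ lam ≥ Mv`.
      have hsharp : ∀ p, Set.indicator (S : Set _) (fun _ => κ') p - D * W2 p ≤ -qs p * u p := by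
        intro p
        have hqn : 0 ≤ -qs p := neg_sharpQuot_nonneg (latticeNorm_nonneg _) (latticeNorm_nonneg _)
        have hW2n : 0 ≤ W2 p := mul_nonneg (shellWeight_nonneg hA2n _ _) (hUn p)
        rcases le_or_gt Mv (latticeNorm (p.1 - p.2)) with hm | hm
        · have hlow : cv * U p ≤ u p := hv' _ hm
          have h4 : -qs p * (cv * U p) ≤ -qs p * u p := by gcongr
          have h5 : 0 ≤ -qs p * (cv * U p) := mul_nonneg hqn (mul_nonneg hcv.le (hUn p))
          have h6 := mul_nonneg hDp.le hW2n
          by_cases hp : p ∈ S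
          · rw [Set.indicator_of_mem (by exact_mod_cast hp)]
            obtain ⟨g1, g2, g3⟩ := hS p hp
            -- On `S`, `1 + |j-k| ≤ 1 + 4(d+1) lam`, and the 1 is absorbed into a fifth multiple.
            have h7 : (5 * (d + 1) * lam) ^ (-s) ≤ U p := by
              refine Real.rpow_le_rpow_of_nonpos (by linarith) ?_ (by linarith)
              have := mul_nonneg (add_nonneg hd0 zero_le_one) (sub_nonneg.2 hlam)
              linarith
            have h8 : κ' ≤ -qs p * (cv * U p) := by
              rw [hκ']
              gcongr
            linarith
          · rw [Set.indicator_of_notMem (by exact_mod_cast hp)]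
            linarith
        · have hp : p ∉ S := fun hp => by linarith [(hS p hp).1]
          rw [Set.indicator_of_notMem (by exact_mod_cast hp), zero_sub]
          have hqs2 : |qs p| ≤ shellWeight A2 ⌊latticeNorm p.1⌋₊ ⌊latticeNorm p.2⌋₊ := by
            refine abs_sharpQuot_le (latticeNorm_nonneg _) (latticeNorm_nonneg _) hA2n
              fun ha hb => ?_
            have hmax : max (latticeNorm p.1) (latticeNorm p.2) ≤
                min (latticeNorm p.1) (latticeNorm p.2) + latticeNorm (p.1 - p.2) := by
              have t1 := latticeNorm_triangle p.1 p.2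
              have t2 := latticeNorm_triangle p.2 p.1
              rw [latticeNorm_sub_comm p.2 p.1] at t2
              rcases le_total (latticeNorm p.1) (latticeNorm p.2) with hle | hle
              · rw [max_eq_right hle, min_eq_left hle]; exact t1
              · rw [max_eq_left hle, min_eq_right hle]; exact t2
            have hfl : ⌊max (latticeNorm p.1) (latticeNorm p.2)⌋₊ ≤
                ⌊min (latticeNorm p.1) (latticeNorm p.2)⌋₊ + M := by
              have t3 := Nat.lt_floor_add_one (min (latticeNorm p.1) (latticeNorm p.2))
              have t4 := Nat.le_ceil Mv
              refine Nat.lt_succ_iff.1 ((Nat.floor_lt (le_max_of_le_left (latticeNorm_nonneg _))).2 ?_)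
              rw [hM]
              push_cast
              linarith
            simp only [hA2d]
            rw [if_pos ⟨ha, hb.trans hfl⟩]
            norm_num
          have h4 : |qs p * u p| ≤
              shellWeight A2 ⌊latticeNorm p.1⌋₊ ⌊latticeNorm p.2⌋₊ * (D * U p) := by
            rw [abs_mul]
            exact mul_le_mul hqs2 (huU p) (abs_nonneg _) ((abs_nonneg _).trans hqs2)
          have h5 := le_abs_self (qs p * u p)
          have h6 : D * W2 p =
              shellWeight A2 ⌊latticeNorm p.1⌋₊ ⌊latticeNorm p.2⌋₊ * (D * U p) := by
            rw [hW2]; ring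
          linarith
      have hpt : ∀ p, Set.indicator (S : Set _) (fun _ => κ') p - D * (W0 p + W2 p) ≤
          -(q p * u p) := by
        intro p
        have h4 : |(q p - qs p) * u p| ≤
            shellWeight A0 ⌊latticeNorm p.1⌋₊ ⌊latticeNorm p.2⌋₊ * (D * U p) := by
          rw [abs_mul]
          exact mul_le_mul (hr p) (huU p) (abs_nonneg _) ((abs_nonneg _).trans (hr p))
        have h5 := le_abs_self ((q p - qs p) * u p)
        have h6 : D * W0 p =
            shellWeight A0 ⌊latticeNorm p.1⌋₊ ⌊latticeNorm p.2⌋₊ * (D * U p) := by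
          rw [hW0]; ring
        have h7 := hsharp p
        rw [sub_mul] at h4 h5
        rw [mul_add]
        linarith
      have hind : Summable (Set.indicator (S : Set _) fun _ => κ') :=
        summable_of_ne_finset_zero (s := S) fun p hp =>
          Set.indicator_of_notMem (by exact_mod_cast hp) _
      have hindsum : ∑' p : (Fin (d + 1) → ℤ) × (Fin (d + 1) → ℤ),
          Set.indicator (S : Set _) (fun _ => κ') p = S.card * κ' := by
        rw [tsum_eq_sum (s := S)
            fun p hp => Set.indicator_of_notMem (fun hp' => hp (Finset.mem_coe.1 hp')) _,
          Finset.sum_indicator_subset _ (Finset.Subset.refl S), Finset.sum_const, nsmul_eq_mul]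
      have htot := Summable.tsum_le_tsum hpt (hind.sub ((hS0.add hS2).mul_left D)) hFs.neg
      rw [hind.tsum_sub ((hS0.add hS2).mul_left D), hindsum, tsum_mul_left, hS0.tsum_add hS2,
        tsum_neg, ← hRe] at htot
      have hmain : κ * lam ^ (d + 1 - η) ≤ S.card * κ' := by
        refine le_trans (le_of_eq ?_) (mul_le_mul_of_nonneg_right hScard hκ'0)
        -- Exponent count: `2(d+1) - 2 - s = d + 1 - η`, from the number of pairs, the quotient and
        -- the coefficient.
        have e1 : lam ^ (d + 1 - η) = lam ^ (2 * (d + 1)) * lam ^ (-s) / lam ^ 2 := by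
          rw [eq_div_iff (by positivity), ← Real.rpow_natCast, ← Real.rpow_natCast,
            ← Real.rpow_add hl0, ← Real.rpow_add hl0]
          congr 1
          push_cast
          rw [hsdef]; ring
        rw [hκ, hκ', e1, Real.mul_rpow (by positivity) hl0.le, div_pow, div_pow, one_pow]
        field_simp
      have hnormR : -(R₁ φ ρ η ε x₀ lam x₀ / ρ 0).re ≤ ‖R₁ φ ρ η ε x₀ lam x₀‖ / |ρ 0| := by
        have := Complex.abs_re_le_norm (R₁ φ ρ η ε x₀ lam x₀ / ρ 0)
        rw [norm_div, Complex.norm_real, Real.norm_eq_abs] at this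
        exact (neg_le_abs _).trans this
      have hfin : κ * lam ^ (d + 1 - η) - D * (Cs * lam ^ (d + 1 - η - ε) +
          Cs * lam ^ (d + 1 - η - ε)) ≤ ‖R₁ φ ρ η ε x₀ lam x₀‖ / |ρ 0| := by
        have h4 : D * (∑' p, W0 p + ∑' p, W2 p) ≤ D * (Cs * lam ^ (d + 1 - η - ε) +
          Cs * lam ^ (d + 1 - η - ε)) := by gcongr
        linarith
      rw [le_div_iff₀ hρa] at hfin
      refine le_trans (le_of_eq ?_) hfin
      rw [hD]
      field_simp
      ring
  refine ⟨Cv * (2 * Cs), |ρ 0| * κ, Cv * (2 * Cs), max 8 Mv, by positivity, by positivity,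
    by positivity, ?_, fun lam hlam x => (key lam hlam).1 x, fun lam hlam => ?_⟩
  · exact le_trans (by norm_num) (le_max_left _ _)
  · exact (key lam (le_trans (le_trans (by norm_num) (le_max_left _ _)) hlam)).2 hlam

end TorusWeyl

/-! ### The main theorem -/

theorem mainTheorem2 (n : ℕ) (hn : 2 ≤ n) (x₀ : TorusWeyl.Torus n)
    (η : ℝ) (hη0 : 0 < η) (hη1 : η < 1)
    (ε : ℝ) (hε0 : 0 < ε) (hε1 : ε < (1 / 10) * min η (1 - η))
    (ρ : ℝ → ℝ) (hρ : ContDiff ℝ ∞ ρ) (hρs : tsupport ρ ⊆ Set.Ioo (-π) π) (hρ0 : ρ 0 ≠ 0)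
    (φ : ℝ → ℝ) (hφ : ContDiff ℝ ∞ φ) (hφe : ∀ t, φ (-t) = φ t)
    (hφl : ∀ t, (Set.Icc (-(1 / 2) : ℝ) (1 / 2)).indicator 1 t ≤ φ t)
    (hφu : ∀ t, φ t ≤ (Set.Icc (-1 : ℝ) 1).indicator 1 t) :
    -- the double series defining `R₁` converges absolutely
    (∀ lam : ℝ, 1 ≤ lam → ∀ x : TorusWeyl.Torus n,
      Summable (TorusWeyl.duhamelTerm (TorusWeyl.cutoff φ η ε lam)
        (TorusWeyl.potential ρ η x₀) x)) ∧
    (∀ lam : ℝ, 1 ≤ lam →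
      BddAbove (Set.range fun x : TorusWeyl.Torus n => ‖TorusWeyl.R₁ φ ρ η ε x₀ lam x‖)) ∧
    ∃ c C Λ : ℝ, 0 < c ∧ 0 < C ∧ 1 ≤ Λ ∧
      (∀ lam : ℝ, 1 ≤ lam →
        (⨆ x : TorusWeyl.Torus n, ‖TorusWeyl.R₁ φ ρ η ε x₀ lam x‖) ≤ C * lam ^ ((n : ℝ) - η)) ∧
      (∀ lam : ℝ, Λ ≤ lam →
        c * lam ^ ((n : ℝ) - η) ≤ ‖TorusWeyl.R₁ φ ρ η ε x₀ lam x₀‖) ∧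
      (∀ lam : ℝ, Λ ≤ lam →
        c * lam ^ ((n : ℝ) - η) ≤ (⨆ x : TorusWeyl.Torus n, ‖TorusWeyl.R₁ φ ρ η ε x₀ lam x‖) ∧
        (⨆ x : TorusWeyl.Torus n, ‖TorusWeyl.R₁ φ ρ η ε x₀ lam x‖) ≤ C * lam ^ ((n : ℝ) - η)) := by
  obtain ⟨d, rfl⟩ : ∃ d, n = d + 1 := ⟨n - 1, by omega⟩
  have hηε : η + ε < 1 := by linarith [min_le_right η (1 - η)]
  have hs : ∀ r, π ≤ r → ρ r = 0 := fun r hr =>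
    image_eq_zero_of_notMem_tsupport fun h => (hρs h).2.not_ge hr
  have hρc : HasCompactSupport ρ :=
    (isCompact_Icc (a := -π) (b := π)).of_isClosed_subset (isClosed_tsupport ρ)
      (hρs.trans Set.Ioo_subset_Icc_self)
  obtain ⟨B, hB⟩ := hρc.exists_bound_of_continuous hρ.continuous
  -- Outside `[-1, 1]` both indicators vanish and squeeze `φ` to zero; at `0` both equal 1, which
  -- fixes `φ 0 = 1`.
  have hφz : ∀ t, t ∉ Set.Icc (-1 : ℝ) 1 → φ t = 0 := fun t ht => by
    have h1 := hφl t
    have h2 := hφu t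
    rw [Set.indicator_of_notMem ht] at h2
    rw [Set.indicator_of_notMem fun h =>
      ht (Set.Icc_subset_Icc (by norm_num) (by norm_num) h)] at h1
    exact le_antisymm h2 h1
  have hφc : HasCompactSupport φ := HasCompactSupport.intro isCompact_Icc fun t ht => hφz t ht
  have hφ0 : φ 0 = 1 := by
    have h1 := hφl 0
    have h2 := hφu 0
    rw [Set.indicator_of_mem (by norm_num)] at h1 h2
    exact le_antisymm h2 h1
  obtain ⟨C, c, C', Λ, hC, hc, hC', hΛ, hup, hlow⟩ :=
    TorusWeyl.duhamel_bounds (d := d) (x₀ := x₀) (by omega) hη0 hη1 hε0 hηε hρ hs hB hρ0 hφ hφc hφ0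
  have hcast : ((d + 1 : ℕ) : ℝ) = d + 1 := by push_cast; rfl
  have hbdd : ∀ lam : ℝ, 1 ≤ lam →
      BddAbove (Set.range fun x : TorusWeyl.Torus (d + 1) =>
        ‖TorusWeyl.R₁ φ ρ η ε x₀ lam x‖) := fun lam hlam =>
    ⟨C * lam ^ ((d : ℝ) + 1 - η), by rintro _ ⟨x, rfl⟩; exact (hup lam hlam x).2⟩
  have hsup : ∀ lam : ℝ, 1 ≤ lam → (⨆ x : TorusWeyl.Torus (d + 1),
      ‖TorusWeyl.R₁ φ ρ η ε x₀ lam x‖) ≤ C * lam ^ ((d : ℝ) + 1 - η) := fun lam hlam =>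
    ciSup_le fun x => (hup lam hlam x).2
  -- Beyond `Λ'` the lower-order term is at most half of the main one.
  obtain ⟨Λ', hΛ'⟩ := Filter.eventually_atTop.1
    ((tendsto_rpow_neg_atTop hε0).eventually (ge_mem_nhds (show 0 < c / (2 * C') by positivity)))
  have hinf : ∀ lam : ℝ, max Λ Λ' ≤ lam →
      c / 2 * lam ^ ((d : ℝ) + 1 - η) ≤ ‖TorusWeyl.R₁ φ ρ η ε x₀ lam x₀‖ := by
    intro lam hlam
    have hl : Λ ≤ lam := (le_max_left _ _).trans hlam
    have hl0 : 0 < lam := by linarith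
    have h1 := hΛ' lam ((le_max_right _ _).trans hlam)
    have h2 : lam ^ ((d : ℝ) + 1 - η - ε) = lam ^ ((d : ℝ) + 1 - η) * lam ^ (-ε) := by
      rw [← Real.rpow_add hl0, ← sub_eq_add_neg]
    have h3 : C' * lam ^ (-ε) ≤ c / 2 := by
      rw [le_div_iff₀ (by positivity)] at h1
      linarith
    have h4 := mul_le_mul_of_nonneg_right h3 (Real.rpow_nonneg hl0.le ((d : ℝ) + 1 - η))
    have h5 := hlow lam hl
    rw [h2] at h5
    linarith
  rw [hcast]
  refine ⟨fun lam hlam x => (hup lam hlam x).1, hbdd, c / 2, C, max Λ Λ', by positivity, hC,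
    hΛ.trans (le_max_left _ _), hsup, hinf, fun lam hlam => ?_⟩
  have h1 : 1 ≤ lam := (hΛ.trans (le_max_left _ _)).trans hlam
  exact ⟨(hinf lam hlam).trans (le_ciSup (hbdd lam h1) x₀), hsup lam h1⟩
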